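/- Let $p_+,p_-\ge 2$ be coprime integers and put $\alpha_+=\sqrt{2p_- /p_+}$, $\alpha_-=-\sqrt{2p_+/p_-}$, $\alpha_0=\alpha_++\alpha_-$, $\alpha=\sqrt{2p_+p_-}$ and $\alpha_{r,s;n}=\frac{1-r}{2}\alpha_++\frac{1-s}{2}\alpha_-+\frac n2\alpha$. **Simple modules and characters.** The simple modules of the $(p_+,p_-)$ singlet vertex operator algebra $V=\mathcal K_{1,1;0}$ are the typical Fock modules $\mathcal F_\lambda$ ($\lambda\in\mathbb C\setminus\frac1{\alpha}\mathbb Z$), the modules $\mathcal I_{r,s;n}$ ($1\le r\le p_+$, $1\le s\le p_-$, $n\in\mathbb Z$; $\mathcal I_{p_+,p_-;n}=\mathcal F_{p_+,p_-;n}$), and the Virasoro modules $\mathcal L_{r,s}$ with $(r,s)$ in the Kac table $1\le r<p_+$, $1\le s<p_-$, $sp_+>rp_-$. For $\epsilon\in\mathbb C$ and $q=e^{2\pi i\tau}$ their regularised characters are as follows, where $\mathcal F_{r,s;n}=\mathcal F_{\alpha_{r,s;n}}$: * $\mathrm{ch}[\mathcal F_\lambda^\epsilon]=e^{2\pi\epsilon(\lambda-\alpha_0/2)}q^{(\lambda-\alpha_0/2)^2/2}/\eta(\tau)$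 for every $\lambda\in\mathbb C$. * $\mathrm{ch}[\mathcal L_{r,s}]=\sum_{k\in\mathbb Z}\big(\mathrm{ch}[\mathcal F_{r,s;2k}^{0}]-\mathrm{ch}[\mathcal F_{p_+-r,s;2k+1}^{0}]\big)$, which is not regularised. * For $r<p_+$, $s<p_-$: $$\mathrm{ch}[\mathcal I_{r,s;n}^\epsilon]=\ell_n+\sum_{k\ge0}(k+1)\,\mathrm{ch}\big[\mathcal F^\epsilon_{p_+-r,s;n-2k-1}+\mathcal F^\epsilon_{r,p_--s;n-2k-3}-\mathcal F^\epsilon_{r,s;n-2k-2}-\mathcal F^\epsilon_{p_+-r,p_--s;n-2k-2}\big],$$ where $\ell_n=n\,\mathrm{ch}[\mathcal L_{r,s}]$ for even $n\ge0$, $\ell_n=-n\,\mathrm{ch}[\mathcal L_{r,p_--s}]$ for odd $n\ge0$, and $\ell_n=0$ for $n<0$. * For $r<p_+$: $\mathrm{ch}[\mathcal I_{r,p_-;n}^\epsilon]=\sum_{k\ge0}\mathrm{ch}[\mathcal F^\epsilon_{p_+-r,p_-;n-2k-1}-\mathcal F^\epsilon_{r,p_-;n-2k-2}]$. For $s<p_-$: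 $\mathrm{ch}[\mathcal I_{p_+,s;n}^\epsilon]=\sum_{k\ge0}\mathrm{ch}[\mathcal F^\epsilon_{p_+,s;n-2k}-\mathcal F^\epsilon_{p_+,p_--s;n-2k-1}]$. * $\mathrm{ch}[V^\epsilon]=\mathrm{ch}[\mathcal L_{1,1}]+\mathrm{ch}[\mathcal I^\epsilon_{1,1;0}]$. The regularised quantum dimension is $\mathrm{qdim}[M^\epsilon]=\lim_{y\to0^+}\mathrm{ch}[M^\epsilon](iy)/\mathrm{ch}[V^\epsilon](iy)$. **Verlinde ring.** Let $R$ be a commutative ring embedded in $\mathbb C$ (for instance $R=\mathbb Z$ or $R=\mathbb C$). Let $\mathcal V_R$ be the free $R$-module on the classes of the simple modules modulo the classes of the $\mathcal L_{r,s}$ (so the typical $\mathcal F_\lambda$ and the $\mathcal I_{r,s;n}$ form a basis). It has the $R$-bilinear product, with unit $[\mathcal I_{1,1;0}]=[V]$, $$\mathcal F_\lambda\times\mathcal F_\mu=\sum_{i=0}^{p_+-1}\sum_{j=0}^{p_--1}\mathcal F_{\lambda+\mu+i\alpha_++j\alpha_-},\qquad \mathcal I_{r,s;n}\times\mathcal F_\mu=\sum_{i=0}^{r-1}\sum_{j=0}^{s-1}\mathcal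 F_{\mu+\alpha_{r-2i,s-2j;n}},$$ $$\mathcal I_{r,s;n}\times\mathcal I_{r',s';n'}=\sum_{a}\sum_{b}\mathcal I_{a,b;n+n'},\quad a\in\{|r-r'|+1,|r-r'|+3,\dots,r+r'-1\},\ b\in\{|s-s'|+1,|s-s'|+3,\dots,s+s'-1\}.$$ Here, for $1\le r\le p_+$ and $1\le s\le p_-$, a reducible Fock module is read as $\mathcal F_{r,s;n}=\mathcal I_{r,s;n}+\mathcal I_{p_+-r,s;n+1}+\mathcal I_{r,p_--s;n-1}+\mathcal I_{p_+-r,p_--s;n}$ (with $\mathcal I_{0,s;n}=\mathcal I_{r,0;n}=0$), and symbols beyond the range are read as $\mathcal I_{p_++t,b;n}=\mathcal I_{p_+-t,b;n}+\mathcal I_{t,b;n+1}+\mathcal I_{t,b;n-1}$ and $\mathcal I_{a,p_-+t;n}=\mathcal I_{a,p_--t;n}+\mathcal I_{a,t;n+1}+\mathcal I_{a,t;n-1}$ for $t\ge1$. **Fusion rings.** The fusion ring of $A_1^{(1)}$ at level $k$ with coefficients in $R$ is the free $R$-module on $N_1,\dots,N_{k+1}$ with $N_rN_s=\sum_cN_c$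 over $c=|r-s|+1,|r-s|+3,\dots,\min(r+s-1,2(k+2)-1-r-s)$. The fusion ring of the $(p_+,p_-)$ Virasoro minimal model with coefficients in $R$ is the free $R$-module on the $L_{r,s}$ with $(r,s)$ in the Kac table, with $L_{r,s}L_{r',s'}=\sum_a\sum_bL_{a,b}$, where $a$ (resp. $b$) runs over the range just described for $r,r'$ at level $p_+-2$ (resp. for $s,s'$ at level $p_--2$), and $L_{a,b}=L_{p_+-a,p_--b}$. **Regions.** Let $B_\epsilon=-\min\{|\frac m\alpha-\mathrm{Im}\,\epsilon| : m\in\mathbb Z\setminus p_+p_-\mathbb Z\}$. For $k\in\mathbb Z$ and $0\le m<2p_+p_-$ let $$S_{k,m}=\Big\{\epsilon\in\mathbb C : k+\tfrac{2m-1}{4p_+p_-}<\tfrac{\mathrm{Im}\,\epsilon}{\alpha}<k+\tfrac{2m+1}{4p_+p_-}\Big\}.$$ Define * $D_1$: the $\epsilon$ with $\mathrm{Re}\,\epsilon>B_\epsilon$ and $\mathrm{Re}\,\epsilon\ne0$. * $D_2$: the $\epsilon$ with $\mathrm{Re}\,\epsilon<B_\epsilon$ that lie in some $S_{k,m}$ with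 $p_+\nmid m$ and $p_-\nmid m$, or in some $S_{k,m}$ with $m\in\{0,p_+p_-\}$ but not on its centre line $\frac{\mathrm{Im}\,\epsilon}{\alpha}=k+\frac{2m}{4p_+p_-}$. * $D_3$: the $\epsilon$ with $\mathrm{Re}\,\epsilon<B_\epsilon$ that lie in some $S_{k,m}$ with $p_-\mid m$ and $p_+\nmid m$. * $D_4$: the $\epsilon$ with $\mathrm{Re}\,\epsilon<B_\epsilon$ that lie in some $S_{k,m}$ with $p_+\mid m$ and $p_-\nmid m$. **Theorem.** For each $i=1,2,3,4$, the quantum dimension $\mathrm{qdim}[M^\epsilon]$ exists for every simple module $M$ and every $\epsilon\in D_i$, and the $R$-linear map from $\mathcal V_R$ to the ring of functions $D_i\to\mathbb C$ given by $\mathrm{ch}[M]\mapsto(\epsilon\mapsto\mathrm{qdim}[M^\epsilon])$ is well defined and a unital ring homomorphism $\Phi_i$. Moreover: 1. $\Phi_1$ is injective, hence a ring isomorphism onto its image. 2. The image of $\Phi_2$ is isomorphic to the fusion ring of the $(p_+,p_-)$ Virasoro minimal model with coefficients in $R$. 3. If $p_-$ is odd or $2$ is invertible in $R$, then the image of $\Phi_3$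 is isomorphic to the fusion ring of $A_1^{(1)}$ at level $p_+-2$ with coefficients in $R$. 4. If $p_+$ is odd or $2$ is invertible in $R$, then the image of $\Phi_4$ is isomorphic to the fusion ring of $A_1^{(1)}$ at level $p_--2$ with coefficients in $R$. The isomorphisms in 2–4 are compatible with multiplication by elements of $R$. -/

import Mathlib

noncomputable section

open Filter Topology

namespace Singlet

/-! ### Rings with a distinguished basis -/

/-- A multiplication table on a set `ι` of labels: the product of two labels is a finite integer
combination of labels, and one label is a two-sided unit. -/
structure FusionTable (ι : Type*) where
  prod : ι → ι → (ι →₀ ℤ)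
  unit : ι
  unit_prod : ∀ i, prod unit i = Finsupp.single i 1
  prod_unit : ∀ i, prod i unit = Finsupp.single i 1

namespace FusionTable

variable {ι : Type*}

/-- The free `R`-module on the labels, with the `R`-bilinear product given by the table. For
`R = ℤ` this is the fusion (or Verlinde) ring, for `R = ℂ` the fusion (or Verlinde) algebra. -/
def Alg (_T : FusionTable ι) (R : Type*) [CommRing R] : Type _ := ι →₀ R

variable (T : FusionTable ι) (R : Type*) [CommRing R]

instance : AddCommGroup (T.Alg R) := inferInstanceAs (AddCommGroup (ι →₀ R))

instance : Module R (T.Alg R) := inferInstanceAs (Module R (ι →₀ R))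

/-- The basis element attached to a label. -/
def basis (i : ι) : T.Alg R := (Finsupp.single i 1 : ι →₀ R)

/-- An integer combination of labels, read with coefficients in `R`. -/
def ofInt (x : ι →₀ ℤ) : T.Alg R := x.mapRange (Int.cast : ℤ → R) Int.cast_zero

/-- The bilinear extension of the multiplication table. -/
def mulAux : (ι →₀ R) →ₗ[R] (ι →₀ R) →ₗ[R] T.Alg R :=
  Finsupp.lift ((ι →₀ R) →ₗ[R] T.Alg R) R ι
    fun i => Finsupp.lift (T.Alg R) R ι fun j => T.ofInt R (T.prod i j)

instance : Mul (T.Alg R) := ⟨fun x y => T.mulAux R x y⟩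

instance : One (T.Alg R) := ⟨T.basis R T.unit⟩

theorem ofInt_single (i : ι) : T.ofInt R (Finsupp.single i 1) = T.basis R i := by
  rw [ofInt, Finsupp.mapRange_single, Int.cast_one]; rfl

theorem basis_mul_basis (i j : ι) :
    T.basis R i * T.basis R j = T.ofInt R (T.prod i j) := by
  change T.mulAux R (Finsupp.single i 1) (Finsupp.single j 1) = _
  simp [mulAux]

theorem one_mul_aux (x : T.Alg R) : T.mulAux R (T.basis R T.unit) x = x := by
  have h : T.mulAux R (T.basis R T.unit) = (LinearMap.id : T.Alg R →ₗ[R] T.Alg R) := by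
    refine Finsupp.lhom_ext' fun j => LinearMap.ext_ring ?_
    have := T.basis_mul_basis R T.unit j
    rw [T.unit_prod, ofInt_single] at this
    exact this
  rw [h]; rfl

theorem mul_one_aux (x : T.Alg R) : T.mulAux R x (T.basis R T.unit) = x := by
  have h : (T.mulAux R).flip (T.basis R T.unit) = (LinearMap.id : T.Alg R →ₗ[R] T.Alg R) := by
    refine Finsupp.lhom_ext' fun j => LinearMap.ext_ring ?_
    have := T.basis_mul_basis R j T.unit
    rw [T.prod_unit, ofInt_single] at this
    exact this
  exact LinearMap.congr_fun h x

/-- Associativity and commutativity are not part of this instance, since they are not formal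
consequences of the shape of a table; for the tables below they hold as theorems. -/
instance : NonAssocRing (T.Alg R) :=
  { (inferInstance : AddCommGroup (T.Alg R)), (inferInstance : Mul (T.Alg R)),
    (inferInstance : One (T.Alg R)) with
    left_distrib := fun x y z => (T.mulAux R x).map_add y z
    right_distrib := fun x y z => by
      change T.mulAux R (x + y) z = T.mulAux R x z + T.mulAux R y z
      exact congrArg (fun f : (ι →₀ R) →ₗ[R] T.Alg R => f z) ((T.mulAux R).map_add x y)
    zero_mul := fun x => by
      change T.mulAux R 0 x = 0
      exact congrArg (fun f : (ι →₀ R) →ₗ[R] T.Alg R => f x) (T.mulAux R).map_zero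
    mul_zero := fun x => (T.mulAux R x).map_zero
    one_mul := fun x => T.one_mul_aux R x
    mul_one := fun x => T.mul_one_aux R x }

end FusionTable

/-! ### Clebsch–Gordan ranges -/

/-- The numbers `|r - s| + 1, |r - s| + 3, …, r + s - 1`. -/
def clebschGordan (r s : ℕ) : Finset ℕ :=
  (Finset.Icc (max r s - min r s + 1) (r + s - 1)).filter fun c => Odd (r + s + c)

/-- The truncated range `|r - s| + 1, |r - s| + 3, …, min (r + s - 1) (2 p - 1 - r - s)`. -/
def truncatedClebschGordan (p r s : ℕ) : Finset ℕ :=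
  (clebschGordan r s).filter fun c => r + s + c < 2 * p

theorem clebschGordan_one_left {r : ℕ} (hr : 1 ≤ r) : clebschGordan 1 r = {r} := by
  ext c
  simp only [clebschGordan, Finset.mem_filter, Finset.mem_Icc, Finset.mem_singleton]
  constructor
  · rintro ⟨⟨h1, h2⟩, h3⟩
    rw [max_eq_right hr, min_eq_left hr] at h1
    omega
  · rintro rfl
    rw [max_eq_right hr, min_eq_left hr]
    exact ⟨⟨by omega, by omega⟩, ⟨c, by omega⟩⟩

theorem clebschGordan_comm (r s : ℕ) : clebschGordan r s = clebschGordan s r := by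
  simp only [clebschGordan, max_comm, min_comm, add_comm]

theorem truncatedClebschGordan_comm (p r s : ℕ) :
    truncatedClebschGordan p r s = truncatedClebschGordan p s r := by
  simp only [truncatedClebschGordan, clebschGordan_comm r s, add_comm r s]

theorem truncatedClebschGordan_one_left {p r : ℕ} (hr : 1 ≤ r) (hp : r < p) :
    truncatedClebschGordan p 1 r = {r} := by
  rw [truncatedClebschGordan, clebschGordan_one_left hr, Finset.filter_singleton,
    if_pos (by omega)]

theorem truncatedClebschGordan_top_left {p r : ℕ} (hr : 1 ≤ r) (hp : r < p) :
    truncatedClebschGordan p (p - 1) r = {p - r} := by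
  have h1 : r ≤ p - 1 := by omega
  ext c
  simp only [truncatedClebschGordan, clebschGordan, Finset.mem_filter, Finset.mem_Icc,
    Finset.mem_singleton, max_eq_left h1, min_eq_right h1]
  constructor
  · rintro ⟨⟨⟨h2, h3⟩, h4⟩, h5⟩
    omega
  · rintro rfl
    exact ⟨⟨⟨by omega, by omega⟩, ⟨p - 1, by omega⟩⟩, by omega⟩

/-! ### The fusion ring of `A₁⁽¹⁾` at level `k` -/

/-- The label `c - 1 ∈ {0, …, k}` for `1 ≤ c ≤ k + 1`, where `c` is the dimension of the top
space. -/
def affineClass (k c : ℕ) : Fin (k + 1) →₀ ℤ :=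
  if h : 1 ≤ c ∧ c ≤ k + 1 then Finsupp.single ⟨c - 1, by omega⟩ 1 else 0

theorem affineClass_succ (k : ℕ) (i : Fin (k + 1)) :
    affineClass k (i.val + 1) = Finsupp.single i 1 := by
  have := i.isLt
  rw [affineClass, dif_pos (by omega)]
  rfl

/-- Fusion rules of the affine vertex operator algebra of type `A₁⁽¹⁾` at level `k`; the integrable
highest weight modules are labelled by their highest weights `0, …, k`. -/
def affineFusion (k : ℕ) : FusionTable (Fin (k + 1)) where
  prod a b := ∑ c ∈ truncatedClebschGordan (k + 2) (a.val + 1) (b.val + 1), affineClass k c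
  unit := 0
  unit_prod i := by
    have := i.isLt
    change ∑ c ∈ truncatedClebschGordan (k + 2) 1 (i.val + 1), affineClass k c = _
    rw [truncatedClebschGordan_one_left (by omega) (by omega), Finset.sum_singleton,
      affineClass_succ]
  prod_unit i := by
    have := i.isLt
    change ∑ c ∈ truncatedClebschGordan (k + 2) (i.val + 1) 1, affineClass k c = _
    rw [truncatedClebschGordan_comm, truncatedClebschGordan_one_left (by omega) (by omega),
      Finset.sum_singleton, affineClass_succ]

/-! ### The parameters `p₊` and `p₋` -/

/-- Two coprime integers `p₊, p₋ ≥ 2`, written `pp` and `pm`. -/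
structure Params where
  pp : ℕ
  pm : ℕ
  two_le_pp : 2 ≤ pp
  two_le_pm : 2 ≤ pm
  coprime : pp.Coprime pm

namespace Params

variable (P : Params)

/-! ### The fusion ring of the Virasoro minimal model -/

/-- Membership in the Kac table `1 ≤ r < p₊`, `1 ≤ s < p₋`, `s p₊ > r p₋`. -/
def IsKac (r s : ℕ) : Prop :=
  1 ≤ r ∧ r < P.pp ∧ 1 ≤ s ∧ s < P.pm ∧ r * P.pm < s * P.pp

instance (r s : ℕ) : Decidable (P.IsKac r s) := by unfold IsKac; infer_instance

/-- Labels of the irreducible modules of the minimal model vertex operator algebra. -/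
structure KacLabel where
  r : ℕ
  s : ℕ
  isKac : P.IsKac r s

/-- The class of `L_{r,s}` for `1 ≤ r < p₊` and `1 ≤ s < p₋`, using the identification
`L_{r,s} = L_{p₊ - r, p₋ - s}`. -/
def kacClass (r s : ℕ) : P.KacLabel →₀ ℤ :=
  if h : P.IsKac r s then Finsupp.single ⟨r, s, h⟩ 1
  else if h : P.IsKac (P.pp - r) (P.pm - s) then
    Finsupp.single ⟨P.pp - r, P.pm - s, h⟩ 1
  else 0

theorem isKac_top (h : ¬ P.IsKac 1 1) : P.IsKac (P.pp - 1) (P.pm - 1) := by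
  have h1 := P.two_le_pp
  have h2 := P.two_le_pm
  have hne : P.pp ≠ P.pm := by
    intro he
    have hc := P.coprime
    rw [he, Nat.coprime_self] at hc
    omega
  have h3 : ¬ (1 * P.pm < 1 * P.pp) := fun hlt =>
    h ⟨le_rfl, by omega, le_rfl, by omega, hlt⟩
  refine ⟨by omega, by omega, by omega, by omega, ?_⟩
  rw [Nat.sub_mul, Nat.sub_mul, Nat.mul_comm P.pm P.pp]
  have h4 : P.pm ≤ P.pp * P.pm := Nat.le_mul_of_pos_left _ (by omega)
  omega

/-- The vacuum label `(1, 1) ∼ (p₊ - 1, p₋ - 1)`. -/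
def kacUnit : P.KacLabel :=
  if h : P.IsKac 1 1 then ⟨1, 1, h⟩ else ⟨P.pp - 1, P.pm - 1, P.isKac_top h⟩

/-- The minimal model fusion product of the labels `(r, s)` and `(r', s')`. -/
def kacProd (x y : P.KacLabel) : P.KacLabel →₀ ℤ :=
  ∑ a ∈ truncatedClebschGordan P.pp x.r y.r,
    ∑ b ∈ truncatedClebschGordan P.pm x.s y.s, P.kacClass a b

theorem kacProd_comm (x y : P.KacLabel) : P.kacProd x y = P.kacProd y x := by
  simp only [kacProd, truncatedClebschGordan_comm _ x.r, truncatedClebschGordan_comm _ x.s]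

theorem kacProd_unit_left (x : P.KacLabel) : P.kacProd P.kacUnit x = Finsupp.single x 1 := by
  obtain ⟨r, s, hx⟩ := x
  have hx' := hx
  obtain ⟨h1, h2, h3, h4, h5⟩ := hx'
  by_cases h : P.IsKac 1 1
  · rw [kacUnit, dif_pos h, kacProd]
    rw [truncatedClebschGordan_one_left h1 h2, truncatedClebschGordan_one_left h3 h4,
      Finset.sum_singleton, Finset.sum_singleton, kacClass, dif_pos hx]
  · rw [kacUnit, dif_neg h, kacProd]
    rw [truncatedClebschGordan_top_left h1 h2, truncatedClebschGordan_top_left h3 h4,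
      Finset.sum_singleton, Finset.sum_singleton]
    have e1 : P.pp - (P.pp - r) = r := by omega
    have e2 : P.pm - (P.pm - s) = s := by omega
    have hn : ¬ P.IsKac (P.pp - r) (P.pm - s) := by
      rintro ⟨-, -, -, -, h6⟩
      rw [Nat.sub_mul, Nat.sub_mul, Nat.mul_comm P.pm P.pp] at h6
      have h7 : s * P.pp ≤ P.pp * P.pm := by
        rw [Nat.mul_comm P.pp]; exact Nat.mul_le_mul_right _ h4.le
      omega
    have hx2 : P.IsKac (P.pp - (P.pp - r)) (P.pm - (P.pm - s)) := by rw [e1, e2]; exact hx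
    rw [kacClass, dif_neg hn, dif_pos hx2]
    congr 1
    simp only [e1, e2]

/-- The fusion rules of the `(p₊, p₋)` Virasoro minimal model. -/
def minimalModelFusion : FusionTable P.KacLabel where
  prod := P.kacProd
  unit := P.kacUnit
  unit_prod := P.kacProd_unit_left
  prod_unit i := by rw [kacProd_comm]; exact P.kacProd_unit_left i

/-! ### Heisenberg weights -/

/-- `α₊ = √(2 p₋ / p₊)` -/
def alphaPlus : ℝ := Real.sqrt (2 * P.pm / P.pp)

/-- `α₋ = -√(2 p₊ / p₋)` -/
def alphaMinus : ℝ := -Real.sqrt (2 * P.pp / P.pm)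

/-- `α₀ = α₊ + α₋` -/
def alphaZero : ℝ := P.alphaPlus + P.alphaMinus

/-- `α = √(2 p₊ p₋)` -/
def alpha : ℝ := Real.sqrt (2 * P.pp * P.pm)

/-- `α_{r,s;n} = (1 - r)/2 α₊ + (1 - s)/2 α₋ + n/2 α` -/
def weight (r s n : ℤ) : ℝ :=
  (1 - r) / 2 * P.alphaPlus + (1 - s) / 2 * P.alphaMinus + n / 2 * P.alpha

/-- The weights `l` that do not lie in `(2 p₊ p₋)^(-1/2) ℤ`. -/
def IsTypical (l : ℂ) : Prop := ∀ k : ℤ, l ≠ ((k / P.alpha : ℝ) : ℂ)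

theorem alphaPlus_eq : P.alphaPlus = 2 * P.pm / P.alpha := by
  have h1 : (0 : ℝ) < P.pp := by exact_mod_cast (by have := P.two_le_pp; omega : 0 < P.pp)
  have h2 : (0 : ℝ) < P.pm := by exact_mod_cast (by have := P.two_le_pm; omega : 0 < P.pm)
  have h3 : (2 * P.pm / P.pp : ℝ) = (2 * P.pm) ^ 2 / (2 * P.pp * P.pm) := by field_simp
  rw [alphaPlus, alpha, h3, Real.sqrt_div (by positivity), Real.sqrt_sq (by positivity)]

theorem alphaMinus_eq : P.alphaMinus = -(2 * P.pp / P.alpha) := by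
  have h1 : (0 : ℝ) < P.pp := by exact_mod_cast (by have := P.two_le_pp; omega : 0 < P.pp)
  have h2 : (0 : ℝ) < P.pm := by exact_mod_cast (by have := P.two_le_pm; omega : 0 < P.pm)
  have h3 : (2 * P.pp / P.pm : ℝ) = (2 * P.pp) ^ 2 / (2 * P.pp * P.pm) := by field_simp
  rw [alphaMinus, alpha, h3, Real.sqrt_div (by positivity), Real.sqrt_sq (by positivity)]

theorem alpha_pos : 0 < P.alpha := by
  have h1 : (0 : ℝ) < P.pp := by exact_mod_cast (by have := P.two_le_pp; omega : 0 < P.pp)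
  have h2 : (0 : ℝ) < P.pm := by exact_mod_cast (by have := P.two_le_pm; omega : 0 < P.pm)
  exact Real.sqrt_pos.mpr (by positivity)

theorem alpha_sq : P.alpha * P.alpha = 2 * P.pp * P.pm :=
  Real.mul_self_sqrt (by positivity)

/-- Every residue class modulo `p ≥ 1` has a representative in `{1, …, p}`. -/
theorem exists_rep (p : ℕ) (hp : 1 ≤ p) (u : ℤ) :
    ∃ r : ℕ, (1 ≤ r ∧ r ≤ p) ∧ ∃ c : ℤ, u = r + c * p := by
  have hp' : (0 : ℤ) < p := by exact_mod_cast hp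
  have h1 := Int.emod_nonneg (u - 1) hp'.ne'
  have h2 := Int.emod_lt_of_pos (u - 1) hp'
  have h3 := Int.emod_add_mul_ediv (u - 1) p
  refine ⟨((u - 1) % p).toNat + 1, ⟨by omega, by omega⟩, (u - 1) / p, ?_⟩
  have h4 : (((u - 1) % p).toNat : ℤ) = (u - 1) % p := Int.toNat_of_nonneg h1
  push_cast
  rw [h4]
  linarith [mul_comm (p : ℤ) ((u - 1) / p)]

/-- The atypical weights are exactly the `α_{r,s;n}`; this direction is used to decompose the
reducible Fock modules. -/
theorem exists_weight_eq {l : ℂ} (h : ¬ P.IsTypical l) :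
    ∃ x : ℕ × ℕ × ℤ, (1 ≤ x.1 ∧ x.1 ≤ P.pp) ∧ (1 ≤ x.2.1 ∧ x.2.1 ≤ P.pm) ∧
      l = (P.weight x.1 x.2.1 x.2.2 : ℂ) := by
  have h : ∃ k : ℤ, l = ((k / P.alpha : ℝ) : ℂ) := by
    by_contra hc
    exact h fun k hk => hc ⟨k, hk⟩
  obtain ⟨k, rfl⟩ := h
  have hb := Nat.gcd_eq_gcd_ab P.pp P.pm
  rw [P.coprime.gcd_eq_one] at hb
  set u := P.pp.gcdA P.pm
  set v := P.pp.gcdB P.pm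
  obtain ⟨r, hr, c, hc⟩ := exists_rep P.pp (by have := P.two_le_pp; omega) (1 - k * v)
  obtain ⟨s, hs, d, hd⟩ := exists_rep P.pm (by have := P.two_le_pm; omega) (1 + k * u)
  refine ⟨(r, s, d - c), hr, hs, ?_⟩
  have hk : (k : ℤ) = (1 - r) * P.pm - (1 - s) * P.pp + (d - c) * (P.pp * P.pm) := by
    have e1 : (1 - r : ℤ) = k * v + c * P.pp := by linarith
    have e2 : (1 - s : ℤ) = -(k * u) + d * P.pm := by linarith
    rw [e1, e2]
    push_cast at hb
    linear_combination k * hb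
  have hk' : (k : ℝ) = (1 - r) * P.pm - (1 - s) * P.pp + (d - c) * (P.pp * P.pm) := by
    exact_mod_cast hk
  have ha := P.alpha_pos.ne'
  have hw : (k : ℝ) / P.alpha = P.weight r s (d - c) := by
    rw [weight, P.alphaPlus_eq, P.alphaMinus_eq, hk']
    push_cast
    field_simp
    linear_combination (-(d - c : ℝ)) * P.alpha_sq
  rw [hw]

/-! ### Simple modules and the Verlinde ring -/

/-- Labels of the simple modules outside the minimal model: the typical Fock modules `F_l`
and the atypical modules `I_{r,s;n}` with `1 ≤ r ≤ p₊`, `1 ≤ s ≤ p₋`. The simple Fock modules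
`F_{p₊,p₋;n}` are the `I_{p₊,p₋;n}`. -/
inductive VerlindeLabel : Type
  | typical (l : ℂ) (h : P.IsTypical l)
  | atypical (r s : ℕ) (hr : 1 ≤ r ∧ r ≤ P.pp) (hs : 1 ≤ s ∧ s ≤ P.pm) (n : ℤ)

/-- Labels of all simple modules of the singlet algebra: those above and the irreducible
Virasoro modules `L_{r,s}` with `(r, s)` in the Kac table. -/
inductive SimpleModule : Type
  | verlinde (x : P.VerlindeLabel)
  | minimal (x : P.KacLabel)

/-- The class of `I_{r,s;n}`, and `0` if `(r, s)` is outside `1 ≤ r ≤ p₊`, `1 ≤ s ≤ p₋`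
(this is used for `r = 0` and for `s = 0`). -/
def atypicalClass (r s : ℕ) (n : ℤ) : P.VerlindeLabel →₀ ℤ :=
  if h : (1 ≤ r ∧ r ≤ P.pp) ∧ (1 ≤ s ∧ s ≤ P.pm) then
    Finsupp.single (.atypical r s h.1 h.2 n) 1
  else 0

/-- The class of the reducible Fock module `F_{r,s;n}` modulo the `L_{r,s}`, read off from the
exact Felder sequences. -/
def feiginFuchsClass (r s : ℕ) (n : ℤ) : P.VerlindeLabel →₀ ℤ :=
  P.atypicalClass r s n + P.atypicalClass (P.pp - r) s (n + 1)
    + P.atypicalClass r (P.pm - s) (n - 1) + P.atypicalClass (P.pp - r) (P.pm - s) n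

open Classical in
/-- The class of the Fock module `F_l`, for any weight `l`. -/
def fockClass (l : ℂ) : P.VerlindeLabel →₀ ℤ :=
  if h : P.IsTypical l then Finsupp.single (.typical l h) 1
  else
    let x := (P.exists_weight_eq h).choose
    P.feiginFuchsClass x.1 x.2.1 x.2.2

/-- For `1 ≤ r ≤ 2 p - 1` the pairs `(a, d)` such that "`r`" stands for the sum of the "`a`" with
`n` shifted by `d`: beyond `p`, the symbol `p + t` stands for
`(p - t) + t (shifted by 1) + t (shifted by -1)`. -/
def extend (p r : ℕ) : List (ℕ × ℤ) :=
  if r ≤ p then [(r, 0)] else [(2 * p - r, 0), (r - p, 1), (r - p, -1)]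

/-- The class of the symbol `I_{r,s;n}` for `1 ≤ r ≤ 2 p₊ - 1` and `1 ≤ s ≤ 2 p₋ - 1`. -/
def extendedClass (r s : ℕ) (n : ℤ) : P.VerlindeLabel →₀ ℤ :=
  ((extend P.pp r).map fun a =>
    ((extend P.pm s).map fun b => P.atypicalClass a.1 b.1 (n + a.2 + b.2)).sum).sum

/-- The product of an atypical and a typical class:
`I_{r,s;n} × F_l = ∑_{i < r} ∑_{j < s} F_{l + α_{r - 2 i, s - 2 j; n}}`. -/
def atypicalTypicalProd (r s : ℕ) (n : ℤ) (l : ℂ) : P.VerlindeLabel →₀ ℤ :=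
  ∑ i ∈ Finset.range r, ∑ j ∈ Finset.range s,
    P.fockClass (l + (P.weight ((r : ℤ) - 2 * i) ((s : ℤ) - 2 * j) n : ℂ))

/-- The Verlinde products of the classes of simple modules. -/
def verlindeProd : P.VerlindeLabel → P.VerlindeLabel → (P.VerlindeLabel →₀ ℤ)
  | .typical l _, .typical l' _ =>
      ∑ i ∈ Finset.range P.pp, ∑ j ∈ Finset.range P.pm,
        P.fockClass (l + l' + i * (P.alphaPlus : ℂ) + j * (P.alphaMinus : ℂ))
  | .typical l _, .atypical r s _ _ n => P.atypicalTypicalProd r s n l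
  | .atypical r s _ _ n, .typical l _ => P.atypicalTypicalProd r s n l
  | .atypical r s _ _ n, .atypical r' s' _ _ n' =>
      ∑ a ∈ clebschGordan r r', ∑ b ∈ clebschGordan s s', P.extendedClass a b (n + n')

/-- The label of `I_{1,1;0}`. Since the `L_{r,s}` are set to zero, this is also the class of the
vacuum module `K_{1,1;0}`, an extension of `L_{1,1}` by `I_{1,1;0}`. -/
def verlindeUnit : P.VerlindeLabel :=
  .atypical 1 1 ⟨le_rfl, by have := P.two_le_pp; omega⟩ ⟨le_rfl, by have := P.two_le_pm; omega⟩ 0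

theorem extendedClass_eq {r s : ℕ} (hr : 1 ≤ r ∧ r ≤ P.pp) (hs : 1 ≤ s ∧ s ≤ P.pm) (n : ℤ) :
    P.extendedClass r s n = Finsupp.single (.atypical r s hr hs n) 1 := by
  have h : (1 ≤ r ∧ r ≤ P.pp) ∧ (1 ≤ s ∧ s ≤ P.pm) := ⟨hr, hs⟩
  simp [extendedClass, extend, hr.2, hs.2, atypicalClass, h]

theorem fockClass_typical {l : ℂ} (h : P.IsTypical l) :
    P.fockClass l = Finsupp.single (.typical l h) 1 := by
  rw [fockClass, dif_pos h]

theorem atypicalTypicalProd_unit {l : ℂ} (h : P.IsTypical l) :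
    P.atypicalTypicalProd 1 1 0 l = Finsupp.single (.typical l h) 1 := by
  have hw : P.weight 1 1 0 = 0 := by simp [weight]
  have h0 : l + (P.weight (((1 : ℕ) : ℤ) - 2 * ((0 : ℕ) : ℤ))
      (((1 : ℕ) : ℤ) - 2 * ((0 : ℕ) : ℤ)) 0 : ℂ) = l := by
    simp [hw]
  rw [atypicalTypicalProd, Finset.sum_range_one, Finset.sum_range_one, h0,
    P.fockClass_typical h]

/-- The Verlinde ring of characters: the free abelian group on the simple modules, with the
irreducible Virasoro modules `L_{r,s}` set to zero, with the Verlinde products. -/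
def verlinde : FusionTable P.VerlindeLabel where
  prod := P.verlindeProd
  unit := P.verlindeUnit
  unit_prod i := by
    match i with
    | .typical l h => exact P.atypicalTypicalProd_unit h
    | .atypical r s hr hs n =>
      change ∑ a ∈ clebschGordan 1 r, ∑ b ∈ clebschGordan 1 s, P.extendedClass a b (0 + n) = _
      rw [clebschGordan_one_left hr.1, clebschGordan_one_left hs.1, Finset.sum_singleton,
        Finset.sum_singleton, P.extendedClass_eq hr hs, zero_add]
  prod_unit i := by
    match i with
    | .typical l h => exact P.atypicalTypicalProd_unit h
    | .atypical r s hr hs n =>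
      change ∑ a ∈ clebschGordan r 1, ∑ b ∈ clebschGordan s 1, P.extendedClass a b (n + 0) = _
      rw [clebschGordan_comm r, clebschGordan_comm s, clebschGordan_one_left hr.1,
        clebschGordan_one_left hs.1, Finset.sum_singleton,
        Finset.sum_singleton, P.extendedClass_eq hr hs, add_zero]

/-- The class of a simple module in the Verlinde ring with coefficients in `R`. -/
def simpleClass (R : Type*) [CommRing R] : P.SimpleModule → P.verlinde.Alg R
  | .verlinde x => P.verlinde.basis R x
  | .minimal _ => 0

/-! ### Regularised characters -/

/-- `ch[F_l^ε](τ) = exp(2 π ε (l - α₀/2)) q^((l - α₀/2)²/2) / η(τ)` with `q = exp(2 π i τ)`. The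
unregularised character is the case `ε = 0`. -/
def fockCh (l ε τ : ℂ) : ℂ :=
  Complex.exp (2 * Real.pi * ε * (l - P.alphaZero / 2)) *
    Complex.exp (2 * Real.pi * Complex.I * τ * ((l - P.alphaZero / 2) ^ 2 / 2)) /
      ModularForm.eta τ

/-- The regularised character of the Feigin–Fuchs module `F_{r,s;n}`. -/
def ffCh (r s n : ℤ) (ε τ : ℂ) : ℂ := P.fockCh (P.weight r s n) ε τ

/-- `ch[L_{r,s}]`, the alternating sum over the Felder complex; it is not regularised. -/
def minimalCh (r s : ℤ) (τ : ℂ) : ℂ :=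
  ∑' k : ℤ, (P.ffCh r s (2 * k) 0 τ - P.ffCh (P.pp - r) s (2 * k + 1) 0 τ)

/-- `ch[I_{r,s;n}^ε]` for `1 ≤ r < p₊` and `1 ≤ s < p₋`. -/
def innerCh (r s n : ℤ) (ε τ : ℂ) : ℂ :=
  (if 0 ≤ n then
    (n : ℂ) * (if Even n then P.minimalCh r s τ else -P.minimalCh r (P.pm - s) τ)
   else 0) +
  ∑' k : ℕ, ((k : ℂ) + 1) *
    (P.ffCh (P.pp - r) s (n - 2 * k - 1) ε τ + P.ffCh r (P.pm - s) (n - 2 * k - 3) ε τ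
      - P.ffCh r s (n - 2 * k - 2) ε τ - P.ffCh (P.pp - r) (P.pm - s) (n - 2 * k - 2) ε τ)

/-- `ch[I_{r,p₋;n}^ε]` for `1 ≤ r < p₊`; here `I_{r,p₋;n}` is the image of a power of the first
screening operator. -/
def plusBorderCh (r n : ℤ) (ε τ : ℂ) : ℂ :=
  ∑' k : ℕ, (P.ffCh (P.pp - r) P.pm (n - 2 * k - 1) ε τ - P.ffCh r P.pm (n - 2 * k - 2) ε τ)

/-- `ch[I_{p₊,s;n}^ε]` for `1 ≤ s < p₋`; here `I_{p₊,s;n}` is the image of a power of the second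
screening operator. -/
def minusBorderCh (s n : ℤ) (ε τ : ℂ) : ℂ :=
  ∑' k : ℕ, (P.ffCh P.pp s (n - 2 * k) ε τ - P.ffCh P.pp (P.pm - s) (n - 2 * k - 1) ε τ)

/-- `ch[I_{r,s;n}^ε]` for `1 ≤ r ≤ p₊` and `1 ≤ s ≤ p₋`. -/
def atypicalCh (r s : ℕ) (n : ℤ) (ε τ : ℂ) : ℂ :=
  if r < P.pp then
    if s < P.pm then P.innerCh r s n ε τ else P.plusBorderCh r n ε τ
  else
    if s < P.pm then P.minusBorderCh s n ε τ else P.ffCh P.pp P.pm n ε τ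

/-- The regularised character of a simple module. -/
def simpleCh : P.SimpleModule → ℂ → ℂ → ℂ
  | .verlinde (.typical l _), ε, τ => P.fockCh l ε τ
  | .verlinde (.atypical r s _ _ n), ε, τ => P.atypicalCh r s n ε τ
  | .minimal x, _, τ => P.minimalCh x.r x.s τ

/-- The regularised character of the singlet vertex operator algebra
`K_{1,1;0}`: `ch[L_{1,1}] + ch[I_{1,1;0}^ε]`. -/
def vacuumCh (ε τ : ℂ) : ℂ := P.minimalCh 1 1 τ + P.atypicalCh 1 1 0 ε τ

/-- The regularised quantum dimension of the simple module `M` at `ε` exists and equals `v`. -/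
def HasQdim (M : P.SimpleModule) (ε v : ℂ) : Prop :=
  Tendsto (fun y : ℝ => P.simpleCh M ε (Complex.I * y) / P.vacuumCh ε (Complex.I * y))
    (𝓝[>] 0) (𝓝 v)

/-- The ring homomorphism `Φ` from the Verlinde ring to the functions of `ε ∈ D` is the `R`-linear
map with `ch[M] ↦ (ε ↦ qdim[M^ε])` for every simple module `M`. -/
def IsQdimMap {R : Type*} [CommRing R] [Algebra R ℂ] {D : Set ℂ}
    (Φ : P.verlinde.Alg R →+* (D → ℂ)) : Prop :=
  (∀ (c : R) (x : P.verlinde.Alg R), Φ (c • x) = c • Φ x) ∧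
    ∀ (M : P.SimpleModule) (ε : D), P.HasQdim M ε (Φ (P.simpleClass R M) ε)

/-- The image of `Φ` is isomorphic, as a ring and compatibly with multiplication by elements of
`R`, to the fusion ring given by the table `T` with coefficients in `R`. -/
def ImageIsoFusion {R : Type*} [CommRing R] {D : Set ℂ}
    (Φ : P.verlinde.Alg R →+* (D → ℂ)) {ι : Type*} (T : FusionTable ι) : Prop :=
  ∃ e : Φ.range ≃+* T.Alg R, ∀ (c : R) (x : P.verlinde.Alg R),
    e (Φ.rangeRestrict (c • x)) = c • e (Φ.rangeRestrict x)

/-! ### Regions of the `ε`-plane -/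

/-- The wall `B_ε`. -/
def wall (ε : ℂ) : ℝ :=
  -sInf {x : ℝ | ∃ m : ℤ, ¬ ((P.pp * P.pm : ℕ) : ℤ) ∣ m ∧ x = |m / P.alpha - ε.im|}

/-- The open strip `S_{k,m}`. -/
def strip (k : ℤ) (m : ℕ) : Set ℂ :=
  {ε | k + (2 * m - 1) / (4 * P.pp * P.pm) < ε.im / P.alpha ∧
    ε.im / P.alpha < k + (2 * m + 1) / (4 * P.pp * P.pm)}

/-- `Re ε > B_ε` and `Re ε ≠ 0`. -/
def continuousRegion : Set ℂ := {ε | P.wall ε < ε.re ∧ ε.re ≠ 0}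

/-- `Re ε < B_ε`, and `ε` lies in a strip `S_{k,m}` such that either neither `p₊` nor `p₋` divides
`m`, or both do; in the second case `ε` is not on the centre line of the strip. -/
def minimalRegion : Set ℂ :=
  {ε | ε.re < P.wall ε ∧ ∃ (k : ℤ) (m : ℕ), m < 2 * P.pp * P.pm ∧ ε ∈ P.strip k m ∧
    ((¬ P.pp ∣ m ∧ ¬ P.pm ∣ m) ∨
      (P.pp ∣ m ∧ P.pm ∣ m ∧ ε.im / P.alpha ≠ k + 2 * m / (4 * P.pp * P.pm)))}

/-- `Re ε < B_ε`, and `ε` lies in a strip `S_{k,m}` such that `p₋` divides `m` and `p₊` does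
not. -/
def affinePlusRegion : Set ℂ :=
  {ε | ε.re < P.wall ε ∧ ∃ (k : ℤ) (m : ℕ), m < 2 * P.pp * P.pm ∧ ε ∈ P.strip k m ∧
    P.pm ∣ m ∧ ¬ P.pp ∣ m}

/-- `Re ε < B_ε`, and `ε` lies in a strip `S_{k,m}` such that `p₊` divides `m` and `p₋` does
not. -/
def affineMinusRegion : Set ℂ :=
  {ε | ε.re < P.wall ε ∧ ∃ (k : ℤ) (m : ℕ), m < 2 * P.pp * P.pm ∧ ε ∈ P.strip k m ∧
    P.pp ∣ m ∧ ¬ P.pm ∣ m}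

end Params

end Singlet

end

noncomputable section

open Filter Topology

namespace Singlet

/-! ### Gaussian sums over an arithmetic progression -/

/-! Multiply every character by η(iy). A Fock module becomes one Gaussian exp(2πεN/α - πyN²/α²),
where N is an integer if the weight is atypical. An atypical simple module that is not a Fock module
becomes, up to multiples of some ch[L_{r,s}], a signed sum of Gaussians over half lattices c - Lℕ
with L = α² = 2p₊p₋; the weights are k + 1 for r < p₊, s < p₋, and 1 if exactly one of r = p₊, s =
p₋ holds. Factors common to all characters cancel in the quantum dimension, so only relative sizes
as y → 0 matter.

For Re ε > 0 a half sum tends to its value at y = 0, a geometric series. For Re ε < 0 it is the full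
lattice sum minus a tail; the tail is a half sum for -ε and tends to minus the analytically
continued geometric series. Poisson summation (`hasSum_gauss_dual`) writes the full sum over modes m
of size exp(π((Re ε)² - (Im ε - m/α)²)/y), up to powers of y. Modes divisible by both p₊ and p₋
cancel in all characters. On D₁ with Re ε < 0 the remaining modes decay and the continued series is
the limit. On D₂, D₃, D₄ a single mode M wins, the integer not divisible by p₊p₋ that is closest to
α Im ε, and characters are compared through their coefficients at M.

Both mechanisms produce the same formula. With X = exp(2πe p₋/α), Y = exp(2πe p₊/α) and Z = X^{p₊} =
Y^{p₋}, the quantum dimension of I_{r,s;n} is Z^n [r]_X [s]_Y, that of F_l is exp(2πe(l - α₀/2))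
[p₊]_X [p₋]_Y, and that of L_{r,s} is 0. Here e = ε on D₁ (`hasQdim_continuous`) and e = iM/α
elsewhere (`Dominates.hasQdim_generic`, `Dominates.hasQdim_plus`, `Dominates.hasQdim_minus`). For
every complex e this formula respects the Verlinde products, by identities between quantum integers
(`evInt_verlindeProd`), so the maps are ring homomorphisms.

On D₁ the value of each label, times (X - X⁻¹)(Y - Y⁻¹), is a combination of exponentials in ε with
a leading exponent that determines the label; independence of exponentials gives injectivity. On the
other regions X and Y are roots of unity and Z = ±1. If M is divisible by neither p₊ nor p₋, then
[p₊]_X = [p₋]_Y = 0 and the surviving values satisfy [r] = -Z[p - r] in both variables, which are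
the truncation and the Kac symmetry of the minimal model. If p₋ divides M, then Y = ±1 and the
values are s times a signed [r] at a power of a primitive 2p₊-th root of unity. Independence of the
characters of ℤ shows that there are no further relations. -/

/-- The Gaussian `exp (2 π ε N / a - π y (N / a)²)`. -/
def gauss (a : ℝ) (ε : ℂ) (y : ℝ) (N : ℤ) : ℂ :=
  Complex.exp (2 * Real.pi * ε * (N / a) - Real.pi * y * (N / a) ^ 2)

/-- The exponential `exp (π (ε - i m / a)² / y)` attached to the `m`-th Fourier mode. -/
def modeExp (a : ℝ) (ε : ℂ) (m : ℤ) (y : ℝ) : ℂ :=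
  Complex.exp (Real.pi * (ε - Complex.I * m / a) ^ 2 / y)

/-- The root of unity `exp (2 π i m c / L)`. -/
def phase (L : ℕ) (m c : ℤ) : ℂ := Complex.exp (2 * Real.pi * Complex.I * m * c / L)

variable {a : ℝ} {L : ℕ}

/-- Since L = a², a step by the period turns the quadratic exponent into a theta term with z = i(aε
- yc) and τ = iyL; this is the entry point for Jacobi's functional equation. -/
theorem gauss_sub_mul (ha : 0 < a) (hL : a * a = L) (ε : ℂ) (y : ℝ) (c k : ℤ) :
    gauss a ε y (c - L * k) = gauss a ε y c *
      jacobiTheta₂_term k (Complex.I * a * ε - Complex.I * y * c) (Complex.I * y * L) := by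
  have ha' : (a : ℂ) ≠ 0 := by exact_mod_cast ha.ne'
  have hL' : (a : ℂ) * a = L := by exact_mod_cast hL
  rw [gauss, gauss, jacobiTheta₂_term, ← Complex.exp_add, ← hL']
  have hI := Complex.I_sq
  congr 1
  push_cast
  rw [← hL']
  have e : ((c : ℂ) - a * a * k) / a = c / a - a * k := by field_simp
  have e2 : (c : ℂ) / a * a = c := by field_simp
  rw [e]
  linear_combination (-(2 * a * k * ε * Real.pi) + 2 * y * k * c * Real.pi
    - Real.pi * k ^ 2 * y * a ^ 2 : ℂ) * hI + (2 * Real.pi * y * k : ℂ) * e2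

/-- The two parts are multiples of the series of θ and of its z-derivative, which converge because
Im τ = yL > 0. -/
theorem summable_gauss_int (ha : 0 < a) (hL : a * a = L) (ε u v : ℂ) {y : ℝ} (hy : 0 < y)
    (c : ℤ) : Summable fun k : ℤ => (u + v * k) * gauss a ε y (c - L * k) := by
  have hL0 : (0 : ℝ) < L := by rw [← hL]; positivity
  have hτ : 0 < (Complex.I * y * L : ℂ).im := by
    have : (Complex.I * y * L : ℂ) = ((y * L : ℝ) : ℂ) * Complex.I := by push_cast; ring
    rw [this, Complex.im_ofReal_mul]
    simpa using mul_pos hy hL0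
  have h1 := (summable_jacobiTheta₂_term_iff (Complex.I * a * ε - Complex.I * y * c) _).2 hτ
  have h2 := (summable_jacobiTheta₂'_term_iff (Complex.I * a * ε - Complex.I * y * c) _).2 hτ
  refine ((h1.mul_left (u * gauss a ε y c)).add
    (h2.mul_left (v * gauss a ε y c / (2 * Real.pi * Complex.I)))).congr fun k => ?_
  rw [gauss_sub_mul ha hL, jacobiTheta₂'_term]
  have : (Real.pi : ℂ) ≠ 0 := by exact_mod_cast Real.pi_ne_zero
  field_simp [Complex.I_ne_zero]
  try ring

/-- Poisson summation for Gaussians with a linear weight. -/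
theorem hasSum_gauss_dual (ha : 0 < a) (hL : a * a = L) (ε u v : ℂ) {y : ℝ} (hy : 0 < y)
    (c : ℤ) : HasSum (fun m : ℤ => modeExp a ε m y * (phase L m c *
        (u + v * c / L - v * (ε - Complex.I * m / a) / (y * a))))
      (a * √y * ∑' k : ℤ, (u + v * k) * gauss a ε y (c - L * k)) := by
  have hL0 : (0 : ℝ) < L := by rw [← hL]; positivity
  have hLc : (L : ℂ) ≠ 0 := by exact_mod_cast hL0.ne'
  have ha' : (a : ℂ) ≠ 0 := by exact_mod_cast ha.ne'
  have hy' : (y : ℂ) ≠ 0 := by exact_mod_cast hy.ne'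
  have hL' : (a : ℂ) * a = L := by exact_mod_cast hL
  have hpi : (Real.pi : ℂ) ≠ 0 := by exact_mod_cast Real.pi_ne_zero
  have hs : ((√y : ℝ) : ℂ) ≠ 0 := by exact_mod_cast (Real.sqrt_pos.2 hy).ne'
  have hI0 := Complex.I_ne_zero
  have hI := Complex.I_sq
  set z : ℂ := Complex.I * a * ε - Complex.I * y * c with hz
  set τ : ℂ := Complex.I * y * L with hτd
  have hτ : 0 < τ.im := by
    have : τ = ((y * L : ℝ) : ℂ) * Complex.I := by rw [hτd]; push_cast; ring
    rw [this, Complex.im_ofReal_mul]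
    simpa using mul_pos hy hL0
  have hτ' : 0 < (-1 / τ).im := by
    have : (-1 / τ) = (((y * L)⁻¹ : ℝ) : ℂ) * Complex.I := by
      rw [hτd]; push_cast; field_simp; rw [hI]
    rw [this, Complex.im_ofReal_mul, Complex.I_im, mul_one]
    positivity
  have hsum : ∑' k : ℤ, (u + v * k) * gauss a ε y (c - L * k) =
      gauss a ε y c * (u * jacobiTheta₂ z τ
        + v / (2 * Real.pi * Complex.I) * jacobiTheta₂' z τ) := by
    have h1 := (hasSum_jacobiTheta₂_term z hτ).mul_left u
    have h2 := (hasSum_jacobiTheta₂'_term z hτ).mul_left (v / (2 * Real.pi * Complex.I))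
    refine HasSum.tsum_eq ((((h1.add h2)).mul_left (gauss a ε y c)).congr_fun ?_)
    intro k
    rw [gauss_sub_mul ha hL, jacobiTheta₂'_term, ← hz, ← hτd]
    field_simp
  -- The automorphy factor (-iτ)^{1/2} is the normalisation a√y in the statement.
  have hpow : (-Complex.I * τ) ^ (1 / 2 : ℂ) = (a * √y : ℂ) := by
    have : -Complex.I * τ = ((y * L : ℝ) : ℂ) := by
      rw [hτd]; push_cast; linear_combination (-(y * L) : ℂ) * hI
    rw [this, show (1 / 2 : ℂ) = ((1 / 2 : ℝ) : ℂ) by push_cast; ring,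
      ← Complex.ofReal_cpow (by positivity), ← Real.sqrt_eq_rpow, ← hL,
      Real.sqrt_mul hy.le, Real.sqrt_mul_self ha.le]
    push_cast; ring
  -- θ is even and θ' is odd in z; passing from z/τ to -z/τ makes the dual index m agree in sign
  -- with ε - im/a and with the phase.
  rw [hsum, jacobiTheta₂'_functional_equation, jacobiTheta₂_functional_equation, hpow,
    ← jacobiTheta₂_neg_left (z / τ), ← neg_neg (jacobiTheta₂' (z / τ) (-1 / τ)),
    ← jacobiTheta₂'_neg_left]
  have h1 := (hasSum_jacobiTheta₂_term (-(z / τ)) hτ')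
  have h2 := (hasSum_jacobiTheta₂'_term (-(z / τ)) hτ')
  have h3 := (((h1.mul_left (u - v * z / τ)).sub
    (h2.mul_left (v / (2 * Real.pi * Complex.I) / τ))).mul_left
      (gauss a ε y c * Complex.exp (-Real.pi * Complex.I * z ^ 2 / τ)))
  have hterm : ∀ m : ℤ, modeExp a ε m y * (phase L m c *
        (u + v * c / L - v * (ε - Complex.I * m / a) / (y * a))) =
      gauss a ε y c * Complex.exp (-Real.pi * Complex.I * z ^ 2 / τ) *
        ((u - v * z / τ) * jacobiTheta₂_term m (-(z / τ)) (-1 / τ) -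
          v / (2 * Real.pi * Complex.I) / τ * jacobiTheta₂'_term m (-(z / τ)) (-1 / τ)) := by
    intro m
    have e0 : z / τ = (a * ε - y * c) / (y * L) := by
      rw [hz, hτd]; field_simp
    have e3 : (-1 : ℂ) / τ = Complex.I / (y * L) := by
      rw [hτd]; field_simp; rw [hI]
    have e4 : -Real.pi * Complex.I * z ^ 2 / τ = Real.pi * (a * ε - y * c) ^ 2 / (y * L) := by
      rw [mul_div_assoc, pow_two, mul_div_assoc, e0, hz]
      field_simp
      linear_combination (-(a * ε - y * c) ^ 2 : ℂ) * hI
    have e1 : modeExp a ε m y * phase L m c = gauss a ε y c *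
        Complex.exp (-Real.pi * Complex.I * z ^ 2 / τ) *
          jacobiTheta₂_term m (-(z / τ)) (-1 / τ) := by
      rw [modeExp, phase, gauss, jacobiTheta₂_term, ← Complex.exp_add, ← Complex.exp_add,
        ← Complex.exp_add, e0, e3, e4, ← hL']
      congr 1
      field_simp
      ring
    have e2 : u + v * c / L - v * (ε - Complex.I * m / a) / (y * a) =
        u - v * z / τ - v / τ * m := by
      rw [mul_div_assoc v z, e0, hτd, ← hL']
      field_simp
      linear_combination (v * m : ℂ) * hI
    rw [← mul_assoc, e1, e2, jacobiTheta₂'_term]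
    field_simp
  simp only [hterm]
  refine (congrArg (HasSum _) ?_).mpr h3
  field_simp
  ring

end Singlet

/-! ### Growth rates of the Fourier modes -/

namespace Singlet

variable {a : ℝ} {L : ℕ}

/-- The growth rate of the `m`-th Fourier mode. -/
def modeRate (a : ℝ) (ε : ℂ) (m : ℤ) : ℝ := ε.re ^ 2 - (ε.im - m / a) ^ 2

theorem norm_modeExp (a : ℝ) (ε : ℂ) (m : ℤ) (y : ℝ) :
    ‖modeExp a ε m y‖ = Real.exp (Real.pi * modeRate a ε m / y) := by
  rw [modeExp, Complex.norm_exp]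
  congr 1
  have h : (Real.pi * (ε - Complex.I * m / a) ^ 2 / y : ℂ) =
      ((Real.pi / y : ℝ) : ℂ) * ((ε - Complex.I * ((m / a : ℝ) : ℂ)) ^ 2) := by
    push_cast; ring
  rw [h, Complex.re_ofReal_mul, pow_two, Complex.mul_re, modeRate]
  simp only [Complex.sub_re, Complex.sub_im, Complex.mul_re, Complex.mul_im, Complex.I_re,
    Complex.I_im, Complex.ofReal_re, Complex.ofReal_im]
  ring

theorem modeExp_ne_zero (a : ℝ) (ε : ℂ) (m : ℤ) (y : ℝ) : modeExp a ε m y ≠ 0 :=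
  Complex.exp_ne_zero _

/-- The rate is a negative quadratic in m, so κ minus the rate is at least m²/(4a²) for large |m|
and its cube beats the linear numerator. Indices where the difference vanishes contribute 0 by the
convention for division by zero. -/
theorem summable_mode_bound (ha : 0 < a) (ε : ℂ) (κ : ℝ) :
    Summable fun m : ℤ => (1 + |(m : ℝ)|) / |κ - modeRate a ε m| ^ 3 := by
  have h2 : Summable fun m : ℤ => (128 * a ^ 6) * (1 / (m : ℝ) ^ 2) :=
    (Real.summable_one_div_int_pow.2 one_lt_two).mul_left _
  refine h2.of_norm_bounded_eventually ?_
  set D : ℝ := ε.im ^ 2 + |κ - ε.re ^ 2| with hD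
  have hD0 : 0 ≤ D := by positivity
  have hfin : {m : ℤ | |m| < ⌈1 + 4 * a ^ 2 * D⌉}.Finite :=
    (Set.finite_Ioo (-⌈1 + 4 * a ^ 2 * D⌉) ⌈1 + 4 * a ^ 2 * D⌉).subset
      fun m hm => abs_lt.1 hm
  filter_upwards [hfin.compl_mem_cofinite] with m hm
  have hm1 : 1 + 4 * a ^ 2 * D ≤ |(m : ℝ)| := by
    have : ⌈1 + 4 * a ^ 2 * D⌉ ≤ |m| := not_lt.1 hm
    have h3 : ((⌈1 + 4 * a ^ 2 * D⌉ : ℤ) : ℝ) ≤ ((|m| : ℤ) : ℝ) := by exact_mod_cast this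
    rw [Int.cast_abs] at h3
    exact (Int.le_ceil _).trans h3
  have hm0 : 1 ≤ |(m : ℝ)| :=
    le_trans (by nlinarith [sq_nonneg a, mul_nonneg (sq_nonneg a) hD0]) hm1
  have hmsq : 4 * a ^ 2 * D ≤ (m : ℝ) ^ 2 := by
    rw [← sq_abs (m : ℝ)]; nlinarith [mul_nonneg (sq_nonneg a) hD0]
  have hδ : (m : ℝ) ^ 2 / (4 * a ^ 2) ≤ κ - modeRate a ε m := by
    rw [modeRate]
    have e1 : (m : ℝ) ^ 2 / (4 * a ^ 2) = (m / a) ^ 2 / 4 := by field_simp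
    have e2 : D ≤ (m / a) ^ 2 / 4 := by
      rw [← e1, le_div_iff₀ (by positivity)]; linarith
    rw [e1]
    have e3 := neg_abs_le (κ - ε.re ^ 2)
    nlinarith [sq_nonneg (2 * ε.im - m / a)]
  have hpos : 0 < (m : ℝ) ^ 2 / (4 * a ^ 2) := by
    have : 0 < (m : ℝ) ^ 2 := by rw [← sq_abs]; positivity
    positivity
  rw [Real.norm_of_nonneg (by positivity), abs_of_pos (hpos.trans_le hδ)]
  have hm2 : 0 < (m : ℝ) ^ 2 := by rw [← sq_abs]; positivity
  calc (1 + |(m : ℝ)|) / (κ - modeRate a ε m) ^ 3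
      ≤ (2 * (m : ℝ) ^ 2 * (m : ℝ) ^ 2) / ((m : ℝ) ^ 2 / (4 * a ^ 2)) ^ 3 := by
        gcongr
        have : 1 ≤ (m : ℝ) ^ 2 := by rw [← sq_abs]; nlinarith
        have : |(m : ℝ)| ≤ (m : ℝ) ^ 2 := by rw [← sq_abs]; nlinarith
        nlinarith
    _ = (128 * a ^ 6) * (1 / (m : ℝ) ^ 2) := by
        field_simp; norm_num

/-- A sum over the Fourier modes is exponentially small relative to any rate that exceeds the
rates of the modes involved. -/
theorem tendsto_modeSum_zero (ha : 0 < a) (ε : ℂ) (κ : ℝ) (w : ℤ → ℝ → ℂ) (C : ℝ) (F : ℝ → ℂ)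
    (hw : ∀ m y, 0 < y → y ≤ 1 → ‖w m y‖ ≤ C * (1 + |(m : ℝ)|) / y)
    (h0 : ∀ m y, κ ≤ modeRate a ε m → w m y = 0)
    (hF : ∀ y, 0 < y → HasSum (fun m => modeExp a ε m y * w m y) (F y)) :
    Tendsto (fun y => y⁻¹ * Real.exp (-(Real.pi * κ / y)) * ‖F y‖) (𝓝[>] 0) (𝓝 0) := by
  set G : ℤ → ℝ := fun m => (1 + |(m : ℝ)|) / |κ - modeRate a ε m| ^ 3 with hG
  have hGs : Summable G := summable_mode_bound ha ε κ
  have hbound : ∀ y, 0 < y → y ≤ 1 →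
      ‖F y‖ ≤ y ^ 2 * Real.exp (Real.pi * κ / y) * 6 * |C| * ∑' m, G m := by
    intro y hy hy1
    refine (hF y hy).norm_le_of_bounded (hGs.hasSum.mul_left _) fun m => ?_
    by_cases hm : κ ≤ modeRate a ε m
    · rw [h0 m y hm, mul_zero, norm_zero]; positivity
    push Not at hm
    set δ := κ - modeRate a ε m with hδ
    have hδ0 : 0 < δ := sub_pos.2 hm
    have e1 : Real.pi * modeRate a ε m / y = Real.pi * κ / y - Real.pi * δ / y := by
      rw [hδ]; ring
    -- From x³/3! ≤ exp x. Of the three powers of y, one pays for the 1/y in the coefficient bound,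
    -- one for the factor y⁻¹ in the conclusion, and the third gives the decay; δ³ makes the sum
    -- over m converge.
    have e2 : Real.exp (-(Real.pi * δ / y)) ≤ 6 * y ^ 3 / δ ^ 3 := by
      have h3 : (δ / y) ^ 3 / 6 ≤ Real.exp (Real.pi * δ / y) := by
        have h4 := Real.pow_div_factorial_le_exp (δ / y) (by positivity) 3
        have h5 : δ / y ≤ Real.pi * δ / y := by
          gcongr; nlinarith [Real.pi_gt_three]
        have h6 : ((Nat.factorial 3 : ℕ) : ℝ) = 6 := by norm_num [Nat.factorial]
        rw [h6] at h4
        exact h4.trans (Real.exp_le_exp.2 h5)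
      rw [Real.exp_neg, inv_le_comm₀ (Real.exp_pos _) (by positivity)]
      have e3 : (6 * y ^ 3 / δ ^ 3)⁻¹ = (δ / y) ^ 3 / 6 := by field_simp
      rw [e3]
      exact h3
    rw [norm_mul, norm_modeExp, e1, sub_eq_add_neg, Real.exp_add]
    calc Real.exp (Real.pi * κ / y) * Real.exp (-(Real.pi * δ / y)) * ‖w m y‖
        ≤ Real.exp (Real.pi * κ / y) * (6 * y ^ 3 / δ ^ 3) * (|C| * (1 + |(m : ℝ)|) / y) := by
          gcongr
          refine (hw m y hy hy1).trans ?_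
          gcongr
          exact le_abs_self C
      _ = y ^ 2 * Real.exp (Real.pi * κ / y) * 6 * |C| * G m := by
          rw [hG]
          simp only
          rw [← hδ, abs_of_pos hδ0]
          field_simp
  have hlim : Tendsto (fun y : ℝ => y * (6 * |C| * ∑' m, G m)) (𝓝[>] 0) (𝓝 0) := by
    have : Tendsto (fun y : ℝ => y * (6 * |C| * ∑' m, G m)) (𝓝 0)
        (𝓝 (0 * (6 * |C| * ∑' m, G m))) := tendsto_id.mul_const _
    rw [zero_mul] at this
    exact this.mono_left nhdsWithin_le_nhds
  refine squeeze_zero' ?_ ?_ hlim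
  · filter_upwards [self_mem_nhdsWithin] with y hy
    have : (0 : ℝ) < y := hy
    positivity
  · filter_upwards [Ioo_mem_nhdsGT (zero_lt_one' ℝ)] with y hy
    have h1 := hbound y hy.1 hy.2.le
    have hy0 := hy.1
    calc y⁻¹ * Real.exp (-(Real.pi * κ / y)) * ‖F y‖
        ≤ y⁻¹ * Real.exp (-(Real.pi * κ / y)) *
          (y ^ 2 * Real.exp (Real.pi * κ / y) * 6 * |C| * ∑' m, G m) := by gcongr
      _ = y * (6 * |C| * ∑' m, G m) := by
          rw [Real.exp_neg]
          field_simp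

end Singlet

/-! ### Finite combinations of lattice sums and their dominant mode -/

namespace Singlet

variable {a : ℝ} {L : ℕ} {ι : Type*} [Fintype ι]

theorem norm_phase (L : ℕ) (m c : ℤ) : ‖phase L m c‖ = 1 := by
  have : (2 * Real.pi * Complex.I * m * c / L : ℂ) =
      ((2 * Real.pi * m * c / L : ℝ) : ℂ) * Complex.I := by push_cast; ring
  rw [phase, this, Complex.norm_exp_ofReal_mul_I]

/-- The amplitude of the `m`-th Fourier mode in a combination of lattice sums. -/
def amp (L : ℕ) (σ : ι → ℂ) (c : ι → ℤ) (m : ℤ) : ℂ := ∑ i, σ i * phase L m (c i)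

/-- The linear sum over the lattice `c + L ℤ`, in finite combinations. -/
def fullSum (a : ℝ) (L : ℕ) (ε u v : ℂ) (σ : ι → ℂ) (c : ι → ℤ) (y : ℝ) : ℂ :=
  ∑ i, σ i * ∑' k : ℤ, (u + v * k) * gauss a ε y (c i - L * k)

/-- The linear sum over the half lattice `c - L ℕ`, in finite combinations. -/
def halfSum (a : ℝ) (L : ℕ) (ε u v : ℂ) (σ : ι → ℂ) (c : ι → ℤ) (y : ℝ) : ℂ :=
  ∑ i, σ i * ∑' k : ℕ, (u + v * k) * gauss a ε y (c i - L * k)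

/-- The coefficient of the `m`-th Fourier mode in `fullSum`. -/
def modeCoef (a : ℝ) (L : ℕ) (ε u v : ℂ) (σ : ι → ℂ) (c : ι → ℤ) (m : ℤ) (y : ℝ) : ℂ :=
  (u * amp L σ c m + v * amp L (fun i => σ i * c i) c m / L) +
    (-(v * (ε - Complex.I * m / a) / a) * amp L σ c m) / y

theorem hasSum_fullSum (ha : 0 < a) (hL : a * a = L) (ε u v : ℂ) (σ : ι → ℂ) (c : ι → ℤ)
    {y : ℝ} (hy : 0 < y) :
    HasSum (fun m : ℤ => modeExp a ε m y * modeCoef a L ε u v σ c m y)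
      (a * √y * fullSum a L ε u v σ c y) := by
  have h := hasSum_sum fun (i : ι) (_ : i ∈ Finset.univ) =>
    (hasSum_gauss_dual ha hL ε u v hy (c i)).mul_left (σ i)
  have e1 : a * √y * fullSum a L ε u v σ c y = ∑ i, σ i * (a * √y *
      ∑' k : ℤ, (u + v * k) * gauss a ε y (c i - L * k)) := by
    rw [fullSum, Finset.mul_sum]
    exact Finset.sum_congr rfl fun i _ => by ring
  have e2 : ∀ m : ℤ, modeExp a ε m y * modeCoef a L ε u v σ c m y =
      ∑ i, σ i * (modeExp a ε m y * (phase L m (c i) *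
        (u + v * c i / L - v * (ε - Complex.I * m / a) / (y * a)))) := by
    intro m
    rw [modeCoef, amp, amp, Finset.mul_sum, Finset.mul_sum, Finset.mul_sum, Finset.sum_div,
      Finset.sum_div, ← Finset.sum_add_distrib, ← Finset.sum_add_distrib, Finset.mul_sum]
    refine Finset.sum_congr rfl fun i _ => ?_
    have hy' : (y : ℂ) ≠ 0 := by exact_mod_cast hy.ne'
    have ha' : (a : ℂ) ≠ 0 := by exact_mod_cast ha.ne'
    field_simp
    ring
  rw [e1]
  simp only [e2]
  exact h

theorem norm_amp_le (L : ℕ) (σ : ι → ℂ) (c : ι → ℤ) (m : ℤ) : ‖amp L σ c m‖ ≤ ∑ i, ‖σ i‖ := by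
  refine (norm_sum_le _ _).trans (Finset.sum_le_sum fun i _ => ?_)
  rw [norm_mul, norm_phase, mul_one]

/-- The index enters linearly through ε - im/a, phases have modulus 1, and for y ≤ 1 the part
without 1/y is absorbed into the bound. -/
theorem norm_modeCoef_le (ha : 0 < a) (ε u v : ℂ) (σ : ι → ℂ) (c : ι → ℤ) :
    ∃ C : ℝ, ∀ m y, 0 < y → y ≤ 1 →
      ‖modeCoef a L ε u v σ c m y‖ ≤ C * (1 + |(m : ℝ)|) / y := by
  set S := ∑ i, ‖σ i‖
  set T := ∑ i, ‖σ i * c i‖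
  have hS : 0 ≤ S := Finset.sum_nonneg fun i _ => norm_nonneg _
  have hT : 0 ≤ T := Finset.sum_nonneg fun i _ => norm_nonneg _
  refine ⟨‖u‖ * S + ‖v‖ * T / L + ‖v‖ * (‖ε‖ + 1 / a) / a * S, fun m y hy hy1 => ?_⟩
  have h1 : ‖u * amp L σ c m + v * amp L (fun i => σ i * c i) c m / L‖ ≤
      (‖u‖ * S + ‖v‖ * T / L) * (1 + |(m : ℝ)|) / y := by
    have e : ‖u * amp L σ c m + v * amp L (fun i => σ i * c i) c m / L‖ ≤
        ‖u‖ * S + ‖v‖ * T / L := by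
      refine (norm_add_le _ _).trans ?_
      rw [norm_mul, norm_div, norm_mul, Complex.norm_natCast]
      gcongr
      · exact norm_amp_le L σ c m
      · exact norm_amp_le L _ c m
    refine e.trans ?_
    rw [le_div_iff₀ hy]
    have hn : 0 ≤ ‖u‖ * S + ‖v‖ * T / L := by positivity
    have := abs_nonneg (m : ℝ)
    exact mul_le_mul_of_nonneg_left (by linarith) hn
  have h2 : ‖(-(v * (ε - Complex.I * m / a) / a) * amp L σ c m) / y‖ ≤
      (‖v‖ * (‖ε‖ + 1 / a) / a * S) * (1 + |(m : ℝ)|) / y := by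
    have e : ‖ε - Complex.I * m / a‖ ≤ (‖ε‖ + 1 / a) * (1 + |(m : ℝ)|) := by
      refine (norm_sub_le _ _).trans ?_
      rw [norm_div, norm_mul, Complex.norm_I, Complex.norm_intCast, Complex.norm_real,
        Real.norm_of_nonneg ha.le, one_mul]
      have h3 : 0 ≤ ‖ε‖ * |(m : ℝ)| := by positivity
      have h4 : 0 ≤ 1 / a := by positivity
      have h5 : |(m : ℝ)| / a = 1 / a * |(m : ℝ)| := by ring
      rw [h5]; nlinarith
    rw [norm_div, norm_mul, norm_neg, norm_div, norm_mul, Complex.norm_real, Complex.norm_real,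
      Real.norm_of_nonneg ha.le, Real.norm_of_nonneg hy.le]
    calc ‖v‖ * ‖ε - Complex.I * m / a‖ / a * ‖amp L σ c m‖ / y
        ≤ ‖v‖ * ((‖ε‖ + 1 / a) * (1 + |(m : ℝ)|)) / a * S / y := by
          gcongr
          exact norm_amp_le L σ c m
      _ = _ := by ring
  refine (norm_add_le _ _).trans ((add_le_add h1 h2).trans (le_of_eq ?_))
  ring

/-- The amplitudes of the `m`-th mode vanish. -/
def ModeVanishes (L : ℕ) (v : ℂ) (σ : ι → ℂ) (c : ι → ℤ) (m : ℤ) : Prop :=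
  amp L σ c m = 0 ∧ v * amp L (fun i => σ i * c i) c m = 0

/-- The factor v in the second condition of `ModeVanishes` makes it vacuous for constant weights,
where only the plain amplitude matters. -/
theorem ModeVanishes.modeCoef_eq {v : ℂ} {σ : ι → ℂ} {c : ι → ℤ} {m : ℤ}
    (h : ModeVanishes L v σ c m) (ε u : ℂ) (y : ℝ) : modeCoef a L ε u v σ c m y = 0 := by
  rw [modeCoef, h.1, h.2]; simp

/-- Only modes of negative rate are left, so `tendsto_modeSum_zero` applies with κ = 0; its factor
y⁻¹ compensates the normalisation √y, as y ≤ √y near 0. -/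
theorem tendsto_fullSum_zero (ha : 0 < a) (hL : a * a = L) (ε u v : ℂ) (σ : ι → ℂ)
    (c : ι → ℤ) (h0 : ∀ m, 0 ≤ modeRate a ε m → ModeVanishes L v σ c m) :
    Tendsto (fullSum a L ε u v σ c) (𝓝[>] 0) (𝓝 0) := by
  obtain ⟨C, hC⟩ := norm_modeCoef_le (L := L) ha ε u v σ c
  have h := tendsto_modeSum_zero ha ε 0 (modeCoef a L ε u v σ c) C _ hC
    (fun m y hm => (h0 m hm).modeCoef_eq ε u y) (fun y hy => hasSum_fullSum ha hL ε u v σ c hy)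
  rw [tendsto_zero_iff_norm_tendsto_zero]
  have h' := h.const_mul a⁻¹
  simp only [mul_zero, zero_div, neg_zero, Real.exp_zero, mul_one] at h'
  refine squeeze_zero' (Eventually.of_forall fun _ => norm_nonneg _) ?_ h'
  filter_upwards [Ioo_mem_nhdsGT (zero_lt_one' ℝ)] with y hy
  rw [norm_mul, norm_mul, Complex.norm_real, Complex.norm_real, Real.norm_of_nonneg ha.le,
    Real.norm_of_nonneg (Real.sqrt_nonneg _)]
  have h1 : y ≤ √y := by
    rw [Real.le_sqrt' hy.1]; nlinarith [hy.1, hy.2]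
  have hy0 := hy.1
  calc ‖fullSum a L ε u v σ c y‖ = a⁻¹ * (y⁻¹ * (a * y * ‖fullSum a L ε u v σ c y‖)) := by
        field_simp
    _ ≤ _ := by gcongr

/-- After the term at M is removed from the series, every mode that still contributes has rate below
that of M, so `tendsto_modeSum_zero` applies with κ equal to the rate of M. -/
theorem tendsto_fullSum_mode (ha : 0 < a) (hL : a * a = L) (ε u v : ℂ) (σ : ι → ℂ)
    (c : ι → ℤ) (M : ℤ)
    (h0 : ∀ m, m ≠ M → modeRate a ε M ≤ modeRate a ε m → ModeVanishes L v σ c m) :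
    Tendsto (fun y : ℝ => a * √y * (modeExp a ε M y)⁻¹ * fullSum a L ε u v σ c y -
      modeCoef a L ε u v σ c M y) (𝓝[>] 0) (𝓝 0) := by
  obtain ⟨C, hC⟩ := norm_modeCoef_le (L := L) ha ε u v σ c
  have h := tendsto_modeSum_zero ha ε (modeRate a ε M)
    (fun m y => if m = M then 0 else modeCoef a L ε u v σ c m y) |C|
    (fun y => a * √y * fullSum a L ε u v σ c y - modeExp a ε M y * modeCoef a L ε u v σ c M y)
    (fun m y hy hy1 => ?_) (fun m y hm => ?_) (fun y hy => ?_)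
  · rw [tendsto_zero_iff_norm_tendsto_zero]
    refine squeeze_zero' (Eventually.of_forall fun _ => norm_nonneg _) ?_ h
    filter_upwards [Ioo_mem_nhdsGT (zero_lt_one' ℝ)] with y hy
    have hne := modeExp_ne_zero a ε M y
    have e : a * √y * (modeExp a ε M y)⁻¹ * fullSum a L ε u v σ c y -
        modeCoef a L ε u v σ c M y = (modeExp a ε M y)⁻¹ *
        (a * √y * fullSum a L ε u v σ c y - modeExp a ε M y * modeCoef a L ε u v σ c M y) := by
      field_simp
    rw [e, norm_mul, norm_inv, norm_modeExp, ← Real.exp_neg]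
    have : 1 ≤ y⁻¹ := (one_le_inv₀ hy.1).2 hy.2.le
    have hp := Real.exp_pos (-(Real.pi * modeRate a ε M / y))
    gcongr
    exact le_mul_of_one_le_left hp.le this
  · split_ifs
    · rw [norm_zero]; positivity
    · exact (hC m y hy hy1).trans (by gcongr; exact le_abs_self C)
  · split_ifs with hmM
    · rfl
    · exact (h0 m hmM hm).modeCoef_eq ε u y
  · have h1 := (hasSum_fullSum ha hL ε u v σ c hy).sub
      (hasSum_ite_eq M (modeExp a ε M y * modeCoef a L ε u v σ c M y))
    refine h1.congr_fun fun m => ?_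
    split_ifs with hm
    · subst hm; simp
    · simp

end Singlet

/-! ### Half lattice sums -/

namespace Singlet

variable {a : ℝ} {L : ℕ} {ι : Type*} [Fintype ι]

/-- The `y → 0` limit of the half lattice sum with weights `u + v k`. -/
def halfLimit (a : ℝ) (L : ℕ) (ε u v : ℂ) (c : ℤ) : ℂ :=
  Complex.exp (2 * Real.pi * ε * c / a) *
    (u / (1 - Complex.exp (-(2 * Real.pi * ε * L / a))) +
      v * (Complex.exp (-(2 * Real.pi * ε * L / a)) /
        (1 - Complex.exp (-(2 * Real.pi * ε * L / a))) ^ 2))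

theorem norm_exp_period_lt_one (ha : 0 < a) (hL : a * a = L) {ε : ℂ} (hε : 0 < ε.re) :
    ‖Complex.exp (-(2 * Real.pi * ε * L / a))‖ < 1 := by
  have h : (-(2 * Real.pi * ε * L / a) : ℂ) = ((-(2 * Real.pi * a) : ℝ) : ℂ) * ε := by
    have ha' : (a : ℂ) ≠ 0 := by exact_mod_cast ha.ne'
    have hL' : (a : ℂ) * a = L := by exact_mod_cast hL
    rw [← hL']; push_cast; field_simp
  rw [Complex.norm_exp, h, Complex.re_ofReal_mul, Real.exp_lt_one_iff, neg_mul, neg_lt_zero]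
  have := Real.pi_pos
  positivity

theorem gauss_neg (ε : ℂ) (y : ℝ) (N : ℤ) : gauss a (-ε) y (-N) = gauss a ε y N := by
  rw [gauss, gauss]; congr 1; push_cast; ring

theorem norm_gauss_le (ε : ℂ) {y : ℝ} (hy : 0 ≤ y) (N : ℤ) :
    ‖gauss a ε y N‖ ≤ ‖Complex.exp (2 * Real.pi * ε * N / a)‖ := by
  have h : (Real.pi * y * (N / a) ^ 2 : ℂ) = ((Real.pi * y * (N / a) ^ 2 : ℝ) : ℂ) := by
    push_cast; ring
  rw [gauss, Complex.norm_exp, Complex.norm_exp, h, Complex.sub_re, Complex.ofReal_re,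
    ← mul_div_assoc]
  have := Real.pi_pos
  exact Real.exp_le_exp.2 (sub_le_self _ (by positivity))

theorem tendsto_gauss (ε : ℂ) (N : ℤ) :
    Tendsto (fun y : ℝ => gauss a ε y N) (𝓝[>] 0) (𝓝 (Complex.exp (2 * Real.pi * ε * N / a))) := by
  have h : Continuous fun y : ℝ => gauss a ε y N := by unfold gauss; fun_prop
  have h0 := h.tendsto 0
  have e : gauss a ε 0 N = Complex.exp (2 * Real.pi * ε * N / a) := by
    rw [gauss]; congr 1; push_cast; ring
  rw [e] at h0
  exact h0.mono_left nhdsWithin_le_nhds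

theorem exp_sub_mul (ε : ℂ) (c : ℤ) (k : ℕ) :
    Complex.exp (2 * Real.pi * ε * ((c - L * k : ℤ) : ℂ) / a) =
      Complex.exp (2 * Real.pi * ε * c / a) *
        Complex.exp (-(2 * Real.pi * ε * L / a)) ^ k := by
  rw [← Complex.exp_nat_mul, ← Complex.exp_add]; congr 1; push_cast; ring

/-- Dominated convergence: the factor exp(-πyN²/a²) is at most 1, and the series at y = 0 is
geometric of ratio below 1 because Re ε > 0. -/
theorem tendsto_halfTsum_of_re_pos (ha : 0 < a) (hL : a * a = L) {ε : ℂ} (hε : 0 < ε.re)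
    (u v : ℂ) (c : ℤ) :
    Tendsto (fun y : ℝ => ∑' k : ℕ, (u + v * k) * gauss a ε y (c - L * k)) (𝓝[>] 0)
      (𝓝 (halfLimit a L ε u v c)) := by
  set w := Complex.exp (-(2 * Real.pi * ε * L / a)) with hw
  have hw1 : ‖w‖ < 1 := norm_exp_period_lt_one ha hL hε
  have hval : HasSum (fun k : ℕ => (u + v * k) *
      Complex.exp (2 * Real.pi * ε * ((c - L * k : ℤ) : ℂ) / a)) (halfLimit a L ε u v c) := by
    have h1 := ((hasSum_geometric_of_norm_lt_one hw1).mul_left u).add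
      ((hasSum_coe_mul_geometric_of_norm_lt_one hw1).mul_left v)
    have h2 := h1.mul_left (Complex.exp (2 * Real.pi * ε * c / a))
    rw [halfLimit, ← hw, div_eq_mul_inv u]
    refine h2.congr_fun fun k => ?_
    rw [exp_sub_mul, ← hw]
    ring
  rw [← hval.tsum_eq]
  refine tendsto_tsum_of_dominated_convergence
    (bound := fun k : ℕ => ‖(u + v * k) *
      Complex.exp (2 * Real.pi * ε * ((c - L * k : ℤ) : ℂ) / a)‖)
    hval.summable.norm (fun k => (tendsto_gauss ε _).const_mul _) ?_
  filter_upwards [self_mem_nhdsWithin] with y hy k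
  rw [norm_mul, norm_mul]
  exact mul_le_mul_of_nonneg_left (norm_gauss_le ε (le_of_lt hy) _) (norm_nonneg _)

/-- The substitution k ↦ -(k + 1) turns the negative half of the lattice into a half sum for -ε. The
shift by one is what changes u to u - v and c to -c - L. -/
theorem fullTsum_eq (ha : 0 < a) (hL : a * a = L) (ε u v : ℂ) {y : ℝ} (hy : 0 < y) (c : ℤ) :
    ∑' k : ℤ, (u + v * k) * gauss a ε y (c - L * k) =
      ∑' k : ℕ, (u + v * k) * gauss a ε y (c - L * k) +
        ∑' k : ℕ, ((u - v) + -v * k) * gauss a (-ε) y (-c - L - L * k) := by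
  obtain ⟨f, hf⟩ : ∃ f : ℤ → ℂ, ∀ k, f k = (u + v * k) * gauss a ε y (c - L * k) :=
    ⟨_, fun _ => rfl⟩
  have hs : Summable f := (summable_gauss_int ha hL ε u v hy c).congr fun k => (hf k).symm
  have h1 : Summable fun k : ℕ => f k := hs.comp_injective Nat.cast_injective
  have h2 : Summable fun k : ℕ => f (-(k + 1)) :=
    hs.comp_injective (i := fun k : ℕ => (-(k + 1) : ℤ)) fun x y h => by
      simp only at h; omega
  have h3 : ∀ k : ℕ, ((u - v) + -v * k) * gauss a (-ε) y (-c - L - L * k) = f (-(k + 1)) := by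
    intro k
    have e : -c - (L : ℤ) - L * k = -(c - L * (-(k + 1))) := by ring
    rw [hf, e, gauss_neg]
    push_cast
    ring
  have h4 : ∀ k : ℕ, (u + v * k) * gauss a ε y (c - L * k) = f k := by
    intro k; rw [hf]; push_cast; rfl
  simp only [← hf, h3, h4]
  exact tsum_of_nat_of_neg_add_one h1 h2

/-- As rational functions, the geometric series over k ≥ 0 and over k < 0 add up to zero, also with
linear weights. Hence the tail tends to minus the analytic continuation of the half sum. -/
theorem halfLimit_neg (ha : 0 < a) (hL : a * a = L) {ε : ℂ} (hε : ε.re < 0) (u v : ℂ) (c : ℤ) :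
    halfLimit a L (-ε) (u - v) (-v) (-c - L) = -halfLimit a L ε u v c := by
  have h1 : ‖Complex.exp (-(2 * Real.pi * (-ε) * L / a))‖ < 1 :=
    norm_exp_period_lt_one ha hL (by simpa using hε)
  have e1 : Complex.exp (-(2 * Real.pi * ε * L / a)) =
      (Complex.exp (-(2 * Real.pi * (-ε) * L / a)))⁻¹ := by
    rw [← Complex.exp_neg]; congr 1; ring
  have e2 : Complex.exp (2 * Real.pi * (-ε) * ((-c - L : ℤ) : ℂ) / a) =
      Complex.exp (2 * Real.pi * ε * c / a) *
        (Complex.exp (-(2 * Real.pi * (-ε) * L / a))) := by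
    rw [← Complex.exp_add]; congr 1; push_cast; ring
  rw [halfLimit, halfLimit, e1, e2]
  have h0 := Complex.exp_ne_zero (-(2 * Real.pi * (-ε) * L / a))
  generalize Complex.exp (-(2 * Real.pi * (-ε) * L / a)) = q at *
  have hq : 1 - q ≠ 0 := fun h => by
    rw [← sub_eq_zero.1 h] at h1; simp at h1
  have hq' : q - 1 ≠ 0 := fun h => hq (by linear_combination -h)
  have hq2 : 1 - q⁻¹ ≠ 0 := by
    intro h; apply hq'; field_simp at h; simpa using h
  have e3 : 1 - q⁻¹ = (q - 1) / q := by field_simp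
  rw [e3, show 1 - q = -(q - 1) by ring]
  field_simp
  ring

theorem fullSum_eq (ha : 0 < a) (hL : a * a = L) (ε u v : ℂ) (σ : ι → ℂ) (c : ι → ℤ) {y : ℝ}
    (hy : 0 < y) : fullSum a L ε u v σ c y = halfSum a L ε u v σ c y +
      halfSum a L (-ε) (u - v) (-v) σ (fun i => -c i - L) y := by
  rw [fullSum, halfSum, halfSum, ← Finset.sum_add_distrib]
  refine Finset.sum_congr rfl fun i _ => ?_
  rw [fullTsum_eq ha hL ε u v hy, mul_add]

theorem tendsto_halfSum_of_re_pos (ha : 0 < a) (hL : a * a = L) {ε : ℂ} (hε : 0 < ε.re)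
    (u v : ℂ) (σ : ι → ℂ) (c : ι → ℤ) :
    Tendsto (halfSum a L ε u v σ c) (𝓝[>] 0) (𝓝 (∑ i, σ i * halfLimit a L ε u v (c i))) :=
  tendsto_finsetSum _ fun _ _ => (tendsto_halfTsum_of_re_pos ha hL hε u v _).const_mul _

theorem tendsto_tail_of_re_neg (ha : 0 < a) (hL : a * a = L) {ε : ℂ} (hε : ε.re < 0)
    (u v : ℂ) (σ : ι → ℂ) (c : ι → ℤ) :
    Tendsto (halfSum a L (-ε) (u - v) (-v) σ (fun i => -c i - L)) (𝓝[>] 0)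
      (𝓝 (-∑ i, σ i * halfLimit a L ε u v (c i))) := by
  have h := tendsto_halfSum_of_re_pos ha hL (ε := -ε) (by simpa using hε) (u - v) (-v) σ
    (fun i => -c i - L)
  convert h using 2
  rw [← Finset.sum_neg_distrib]
  refine Finset.sum_congr rfl fun i _ => ?_
  rw [halfLimit_neg ha hL hε]; ring

/-- In the continuous region the half lattice sums converge to the analytic continuation of the
geometric series. -/
theorem tendsto_halfSum_continuous (ha : 0 < a) (hL : a * a = L) {ε : ℂ} (hε : ε.re ≠ 0)
    (u v : ℂ) (σ : ι → ℂ) (c : ι → ℤ)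
    (h0 : ε.re < 0 → ∀ m, 0 ≤ modeRate a ε m → ModeVanishes L v σ c m) :
    Tendsto (halfSum a L ε u v σ c) (𝓝[>] 0) (𝓝 (∑ i, σ i * halfLimit a L ε u v (c i))) := by
  rcases lt_or_gt_of_ne hε with hneg | hpos
  -- For Re ε < 0 the half sum is the full sum, which tends to 0, minus the tail.
  · have h := (tendsto_fullSum_zero ha hL ε u v σ c (h0 hneg)).sub
      (tendsto_tail_of_re_neg ha hL hneg u v σ c)
    rw [sub_neg_eq_add, zero_add] at h
    refine h.congr' ?_
    filter_upwards [self_mem_nhdsWithin] with y hy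
    rw [fullSum_eq ha hL ε u v σ c hy, add_sub_cancel_right]
  · exact tendsto_halfSum_of_re_pos ha hL hpos u v σ c

theorem tendsto_modeScale_zero (ε : ℂ) (M : ℤ) (hM : 0 < modeRate a ε M) :
    Tendsto (fun y : ℝ => (a * √y * (modeExp a ε M y)⁻¹ : ℂ) / y) (𝓝[>] 0) (𝓝 0) := by
  have h1 : Tendsto (fun y : ℝ => Real.pi * modeRate a ε M / y) (𝓝[>] 0) atTop := by
    simp only [div_eq_mul_inv]
    exact tendsto_inv_nhdsGT_zero.const_mul_atTop (mul_pos Real.pi_pos hM)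
  have h2 := (Real.tendsto_pow_mul_exp_neg_atTop_nhds_zero 1).comp h1
  have h3 := h2.const_mul (|a| / (Real.pi * modeRate a ε M))
  rw [mul_zero] at h3
  rw [tendsto_zero_iff_norm_tendsto_zero]
  refine squeeze_zero' (Eventually.of_forall fun _ => norm_nonneg _) ?_ h3
  filter_upwards [Ioo_mem_nhdsGT (zero_lt_one' ℝ)] with y hy
  have hy0 := hy.1
  have hs : √y ≤ 1 := Real.sqrt_le_one.2 hy.2.le
  have hp := Real.exp_pos (-(Real.pi * modeRate a ε M / y))
  rw [norm_div, norm_mul, norm_mul, norm_inv, norm_modeExp, Complex.norm_real, Complex.norm_real,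
    Complex.norm_real, Real.norm_of_nonneg (Real.sqrt_nonneg _), Real.norm_of_nonneg hy0.le,
    ← Real.exp_neg, Function.comp_apply, pow_one, Real.norm_eq_abs]
  have hpi := Real.pi_pos
  calc |a| * √y * Real.exp (-(Real.pi * modeRate a ε M / y)) / y
      ≤ |a| * 1 * Real.exp (-(Real.pi * modeRate a ε M / y)) / y := by gcongr
    _ = _ := by field_simp

/-- Anything with a finite limit is invisible on the scale of a growing mode. This disposes of the
tails, the Fock modules and the Virasoro modules. -/
theorem tendsto_modeScale_mul_zero {ε : ℂ} {M : ℤ} (hM : 0 < modeRate a ε M) {f : ℝ → ℂ} {l : ℂ}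
    (hf : Tendsto f (𝓝[>] 0) (𝓝 l)) :
    Tendsto (fun y : ℝ => a * √y * (modeExp a ε M y)⁻¹ * f y) (𝓝[>] 0) (𝓝 0) := by
  have h1 : Tendsto (fun y : ℝ => (y : ℂ)) (𝓝[>] 0) (𝓝 0) := by
    have : Continuous fun y : ℝ => (y : ℂ) := Complex.continuous_ofReal
    simpa using (this.tendsto 0).mono_left nhdsWithin_le_nhds
  have h := ((tendsto_modeScale_zero ε M hM).mul h1).mul hf
  rw [zero_mul, zero_mul] at h
  refine h.congr' ?_
  filter_upwards [self_mem_nhdsWithin] with y hy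
  have : (y : ℂ) ≠ 0 := by exact_mod_cast (ne_of_gt hy)
  field_simp

/-- When the mode `M` dominates, the half lattice sums are asymptotic to the coefficient of
that mode. -/
theorem tendsto_halfSum_mode (ha : 0 < a) (hL : a * a = L) {ε : ℂ} (hε : ε.re < 0) (u v : ℂ)
    (σ : ι → ℂ) (c : ι → ℤ) {M : ℤ} (hM : 0 < modeRate a ε M)
    (h0 : ∀ m, m ≠ M → modeRate a ε M ≤ modeRate a ε m → ModeVanishes L v σ c m) :
    Tendsto (fun y : ℝ => a * √y * (modeExp a ε M y)⁻¹ * halfSum a L ε u v σ c y -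
      modeCoef a L ε u v σ c M y) (𝓝[>] 0) (𝓝 0) := by
  have h := (tendsto_fullSum_mode ha hL ε u v σ c M h0).sub
    (tendsto_modeScale_mul_zero hM (tendsto_tail_of_re_neg ha hL hε u v σ c))
  rw [sub_zero] at h
  refine h.congr' ?_
  filter_upwards [self_mem_nhdsWithin] with y hy
  rw [fullSum_eq ha hL ε u v σ c hy]
  ring

end Singlet

namespace Singlet

/-! ### Quantum integers -/

/-- The quantum integer `X^(r-1) + X^(r-3) + ⋯ + X^(1-r)`. -/
def qInt (r : ℕ) (X : ℂ) : ℂ := ∑ i ∈ Finset.range r, X ^ (2 * (i : ℤ) + 1 - r)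

theorem qInt_zero (X : ℂ) : qInt 0 X = 0 := by simp [qInt]

theorem qInt_one (X : ℂ) : qInt 1 X = 1 := by simp [qInt]

/-- The sum telescopes. Multiplied by the Weyl denominator, quantum integers become differences of
two powers, which reduces the identities below to algebra of monomials. -/
theorem sub_inv_mul_qInt (r : ℕ) {X : ℂ} (hX : X ≠ 0) :
    (X - X⁻¹) * qInt r X = X ^ (r : ℤ) - X ^ (-(r : ℤ)) := by
  have h : ∀ i : ℕ, (X - X⁻¹) * X ^ (2 * (i : ℤ) + 1 - r) =
      X ^ (2 * ((i + 1 : ℕ) : ℤ) - r) - X ^ (2 * (i : ℤ) - r) := by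
    intro i
    rw [sub_mul, ← zpow_one_add₀ hX, ← zpow_neg_one, ← zpow_add₀ hX]
    congr 2 <;> push_cast <;> ring
  rw [qInt, Finset.mul_sum, Finset.sum_congr rfl fun i _ => h i,
    Finset.sum_range_sub (fun i : ℕ => X ^ (2 * (i : ℤ) - r))]
  congr 2 <;> push_cast <;> ring

/-- All exponents have the same parity, so for X = ±1 all r terms are equal. The extra factor X
avoids the exponent r - 1 at r = 0. -/
theorem qInt_of_sq_eq_one (r : ℕ) {X : ℂ} (hX : X ^ 2 = 1) : X * qInt r X = r * X ^ r := by
  have hX0 : X ≠ 0 := fun h => by simp [h] at hX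
  have h : ∀ i : ℕ, X ^ (2 * (i : ℤ) + 1 - r) = X * X ^ r := by
    intro i
    have h2 : ∀ k : ℤ, X ^ (2 * k) = 1 := fun k => by
      rw [zpow_mul, zpow_ofNat, hX, one_zpow]
    have e : (2 * (i : ℤ) + 1 - r) = 2 * (i - r) + 1 + r := by ring
    rw [e, zpow_add₀ hX0, zpow_add₀ hX0, h2, one_mul, zpow_one, zpow_natCast]
  rw [qInt, Finset.sum_congr rfl fun i _ => h i, Finset.sum_const, Finset.card_range,
    nsmul_eq_mul]
  linear_combination (r * X ^ r : ℂ) * hX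

theorem continuousOn_qInt (r : ℕ) : ContinuousOn (qInt r) {0}ᶜ := by
  unfold qInt
  exact continuousOn_finsetSum _ fun i _ => (continuousOn_zpow₀ _)

/-- Identities between continuous functions may be checked after multiplication by `X - X⁻¹`. -/
theorem eq_of_sub_inv_mul_eq {F G : ℂ → ℂ} (hF : ContinuousOn F {0}ᶜ) (hG : ContinuousOn G {0}ᶜ)
    (h : ∀ X ≠ 0, (X - X⁻¹) * F X = (X - X⁻¹) * G X) {X : ℂ} (hX : X ≠ 0) : F X = G X := by
  have hmem : ({0}ᶜ : Set ℂ) ∈ 𝓝 X := isOpen_compl_singleton.mem_nhds hX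
  have h1 : Tendsto F (𝓝[≠] X) (𝓝 (F X)) :=
    ((hF.continuousAt hmem).tendsto).mono_left nhdsWithin_le_nhds
  have h2 : Tendsto G (𝓝[≠] X) (𝓝 (G X)) :=
    ((hG.continuousAt hmem).tendsto).mono_left nhdsWithin_le_nhds
  refine tendsto_nhds_unique_of_eventuallyEq h1 h2 ?_
  -- The factor vanishes only at ±1, so it is nonzero on a punctured neighbourhood of X; both sides
  -- agree there and continuity gives equality at X.
  have hfin : (({1, -1} : Set ℂ) \ {X})ᶜ ∈ 𝓝 X :=
    ((Set.toFinite _).isClosed.isOpen_compl).mem_nhds (by simp)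
  filter_upwards [nhdsWithin_le_nhds hmem, nhdsWithin_le_nhds hfin, self_mem_nhdsWithin]
    with Z hZ0 hZ1 hZ2
  have hZ0' : Z ≠ 0 := hZ0
  refine mul_left_cancel₀ (fun h0 => hZ1 ⟨?_, hZ2⟩) (h Z hZ0)
  have : Z * Z = 1 := by
    have := congrArg (· * Z) h0
    simp only [sub_mul, inv_mul_cancel₀ hZ0', zero_mul] at this
    linear_combination this
  rcases mul_self_eq_one_iff.1 this with h | h <;> simp [h]

theorem qInt_inv (r : ℕ) (X : ℂ) : qInt r X⁻¹ = qInt r X := by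
  rw [qInt, qInt, ← Finset.sum_range_reflect]
  refine Finset.sum_congr rfl fun i hi => ?_
  have hi' := Finset.mem_range.1 hi
  rw [inv_zpow', show ((r - 1 - i : ℕ) : ℤ) = r - 1 - i by omega]
  congr 1; ring

/-- With X^p = Z this is the rule for reading the symbol p + t as (p - t) plus two copies of t
shifted by ±1. -/
theorem qInt_add_of_le {p t : ℕ} (ht : t ≤ p) {X : ℂ} (hX : X ≠ 0) :
    qInt (p + t) X = qInt (p - t) X + (X ^ (p : ℤ) + X ^ (-(p : ℤ))) * qInt t X := by
  refine eq_of_sub_inv_mul_eq (F := qInt (p + t))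
    (G := fun X => qInt (p - t) X + (X ^ (p : ℤ) + X ^ (-(p : ℤ))) * qInt t X)
    (continuousOn_qInt _) ?_ (fun X hX => ?_) hX
  · exact (continuousOn_qInt _).add
      (((continuousOn_zpow₀ _).add (continuousOn_zpow₀ _)).mul (continuousOn_qInt _))
  · have h1 := sub_inv_mul_qInt (p + t) hX
    have h2 := sub_inv_mul_qInt (p - t) hX
    have h3 := sub_inv_mul_qInt t hX
    rw [mul_add, h1, h2, mul_left_comm, h3, Nat.cast_sub ht]
    push_cast
    rw [neg_add, neg_sub, zpow_add₀ hX, zpow_add₀ hX, zpow_sub₀ hX, zpow_sub₀ hX, zpow_neg,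
      zpow_neg]
    field_simp
    ring

/-- With X^p = Z the left side pairs r with p - r shifted by one; a product of two such identities
evaluates the four composition factors of a reducible Fock module. -/
theorem qInt_add_mul {p r : ℕ} (hr : r ≤ p) {X : ℂ} (hX : X ≠ 0) :
    qInt r X + X ^ (p : ℤ) * qInt (p - r) X = X ^ ((p : ℤ) - r) * qInt p X := by
  refine eq_of_sub_inv_mul_eq (F := fun X => qInt r X + X ^ (p : ℤ) * qInt (p - r) X)
    (G := fun X => X ^ ((p : ℤ) - r) * qInt p X) ?_ ?_ (fun X hX => ?_) hX
  · exact (continuousOn_qInt _).add ((continuousOn_zpow₀ _).mul (continuousOn_qInt _))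
  · exact (continuousOn_zpow₀ _).mul (continuousOn_qInt _)
  · have h1 := sub_inv_mul_qInt r hX
    have h2 := sub_inv_mul_qInt (p - r) hX
    have h3 := sub_inv_mul_qInt p hX
    rw [mul_add, mul_left_comm, h1, h2, mul_left_comm, h3, Nat.cast_sub hr, neg_sub,
      zpow_sub₀ hX, zpow_sub₀ hX, zpow_neg, zpow_neg]
    field_simp
    ring

theorem sum_clebschGordan_of_le {M : Type*} [AddCommMonoid M] {r s : ℕ}
    (hsr : s ≤ r) (f : ℕ → M) :
    ∑ c ∈ clebschGordan r s, f c = ∑ j ∈ Finset.range s, f (r - s + 1 + 2 * j) := by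
  have h : clebschGordan r s = (Finset.range s).image fun j => r - s + 1 + 2 * j := by
    ext c
    simp only [clebschGordan, Finset.mem_filter, Finset.mem_Icc, Finset.mem_image,
      Finset.mem_range, max_eq_left hsr, min_eq_right hsr]
    constructor
    · rintro ⟨⟨h1, h2⟩, k, h3⟩
      exact ⟨(c - (r - s + 1)) / 2, by omega, by omega⟩
    · rintro ⟨j, hj, rfl⟩
      exact ⟨⟨by omega, by omega⟩, ⟨r + j, by omega⟩⟩
  rw [h, Finset.sum_image]
  intro x _ y _ hxy
  simp only at hxy
  omega

/-- Clebsch–Gordan: with s ≤ r, each monomial of [s] shifts X^r and X^{-r}. The sum for X^{-r} is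
read in reverse order, so that the two shifted powers recombine into one quantum integer. -/
theorem qInt_mul_qInt {r s : ℕ} (hr : 1 ≤ r) (hs : 1 ≤ s) {X : ℂ} (hX : X ≠ 0) :
    qInt r X * qInt s X = ∑ c ∈ clebschGordan r s, qInt c X := by
  wlog hsr : s ≤ r generalizing r s
  · rw [mul_comm, clebschGordan_comm]
    exact this hs hr (by omega)
  rw [sum_clebschGordan_of_le hsr]
  refine eq_of_sub_inv_mul_eq (F := fun X => qInt r X * qInt s X)
    (G := fun X => ∑ j ∈ Finset.range s, qInt (r - s + 1 + 2 * j) X) ?_ ?_ (fun X hX => ?_) hX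
  · exact (continuousOn_qInt _).mul (continuousOn_qInt _)
  · exact continuousOn_finsetSum _ fun j _ => continuousOn_qInt _
  · rw [← mul_assoc, sub_inv_mul_qInt r hX, Finset.mul_sum,
      Finset.sum_congr rfl fun j _ => sub_inv_mul_qInt _ hX, Finset.sum_sub_distrib, sub_mul]
    congr 1
    · rw [qInt, Finset.mul_sum]
      refine Finset.sum_congr rfl fun j _ => ?_
      rw [← zpow_add₀ hX]
      congr 1
      omega
    · rw [qInt, Finset.mul_sum, ← Finset.sum_range_reflect]
      refine Finset.sum_congr rfl fun j hj => ?_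
      have := Finset.mem_range.1 hj
      rw [← zpow_add₀ hX]
      congr 1
      omega

section RootOfUnity

variable {p : ℕ} {X : ℂ}

theorem qInt_two_mul_sub (hX0 : X ≠ 0) (hX : X - X⁻¹ ≠ 0) (hp : X ^ (2 * p) = 1) {c : ℕ}
    (hc : c ≤ 2 * p) : qInt (2 * p - c) X = -qInt c X := by
  refine mul_left_cancel₀ hX ?_
  have h2 : X ^ (2 * (p : ℤ)) = 1 := by exact_mod_cast hp
  rw [mul_neg, sub_inv_mul_qInt _ hX0, sub_inv_mul_qInt _ hX0, Nat.cast_sub hc, neg_sub,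
    zpow_sub₀ hX0, zpow_sub₀ hX0]
  push_cast
  rw [h2, zpow_neg]
  ring

theorem qInt_self_eq_zero (hX0 : X ≠ 0) (hX : X - X⁻¹ ≠ 0) (hp : X ^ (2 * p) = 1) :
    qInt p X = 0 := by
  have h := qInt_two_mul_sub hX0 hX hp (c := p) (by omega)
  rw [show 2 * p - p = p by omega] at h
  have : (2 : ℂ) * qInt p X = 0 := by linear_combination h
  simpa using this

/-- At a 2p-th root of unity other than ±1 one has [2p - c] = -[c]. The terms beyond the truncation
are stable under c ↦ 2p - c and cancel in pairs; the fixed point c = p contributes [p] = 0. -/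
theorem qInt_mul_qInt_truncated (hX0 : X ≠ 0) (hX : X - X⁻¹ ≠ 0) (hp : X ^ (2 * p) = 1)
    {r s : ℕ} (hr : 1 ≤ r) (hrp : r < p) (hs : 1 ≤ s) (hsp : s < p) :
    qInt r X * qInt s X = ∑ c ∈ truncatedClebschGordan p r s, qInt c X := by
  rw [qInt_mul_qInt hr hs hX0, truncatedClebschGordan,
    ← Finset.sum_filter_add_sum_filter_not (clebschGordan r s) (fun c => r + s + c < 2 * p)]
  rw [add_eq_left]
  refine Finset.sum_involution (fun c _ => 2 * p - c) ?_ ?_ ?_ ?_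
  · intro c hc
    simp only [clebschGordan, Finset.mem_filter, Finset.mem_Icc] at hc
    rw [qInt_two_mul_sub hX0 hX hp (by omega), add_neg_cancel]
  · intro c hc hne heq
    simp only [clebschGordan, Finset.mem_filter, Finset.mem_Icc] at hc
    have : c = p := by omega
    exact hne (by rw [this, qInt_self_eq_zero hX0 hX hp])
  · intro c hc
    simp only [clebschGordan, Finset.mem_filter, Finset.mem_Icc] at hc ⊢
    obtain ⟨⟨⟨h1, h2⟩, k, h3⟩, h4⟩ := hc
    refine ⟨⟨⟨?_, ?_⟩, ?_⟩, ?_⟩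
    · omega
    · omega
    · exact ⟨r + s + p - k - 1, by omega⟩
    · omega
  · intro c hc
    simp only [clebschGordan, Finset.mem_filter, Finset.mem_Icc] at hc
    show 2 * p - (2 * p - c) = c
    omega

end RootOfUnity

end Singlet

/-! ### Ring homomorphisms from multiplication tables -/

namespace Singlet

namespace FusionTable

variable {ι : Type*} (T : FusionTable ι) (R : Type*) [CommRing R]

/-- The ring homomorphism from a fusion ring determined by a character of its table. -/
def evalHom {A : Type*} [CommRing A] [Algebra R A] (f : ι → A) (h1 : f T.unit = 1)
    (hmul : ∀ i j, Finsupp.linearCombination ℤ f (T.prod i j) = f i * f j) : T.Alg R →+* A where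
  toFun x := Finsupp.linearCombination R f (x : ι →₀ R)
  map_one' := by
    change Finsupp.linearCombination R f (Finsupp.single T.unit 1) = 1
    rw [Finsupp.linearCombination_single, h1, one_smul]
  map_zero' := (Finsupp.linearCombination R f).map_zero
  map_add' x y := (Finsupp.linearCombination R f).map_add x y
  map_mul' x y := by
    have hint : ∀ z : ι →₀ ℤ, Finsupp.linearCombination R f (T.ofInt R z : ι →₀ R) =
        Finsupp.linearCombination ℤ f z := by
      intro z
      rw [ofInt, Finsupp.linearCombination_apply, Finsupp.linearCombination_apply,
        Finsupp.sum_mapRange_index (fun i => by exact zero_smul R (f i))]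
      exact Finsupp.sum_congr fun i _ => Int.cast_smul_eq_zsmul R _ _
    -- Both sides of multiplicativity are bilinear, so equality is checked on pairs of basis
    -- elements; the structure constants are integers, whence the hypothesis over ℤ suffices.
    have h : (T.mulAux R).compr₂ (Finsupp.linearCombination R f : (ι →₀ R) →ₗ[R] A) =
        (LinearMap.mul R A).compl₁₂ (Finsupp.linearCombination R f)
          (Finsupp.linearCombination R f) := by
      refine Finsupp.lhom_ext' fun i => LinearMap.ext_ring (Finsupp.lhom_ext' fun j =>
        LinearMap.ext_ring ?_)
      have e := T.basis_mul_basis R i j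
      change Finsupp.linearCombination R f (T.basis R i * T.basis R j : T.Alg R) =
        Finsupp.linearCombination R f (Finsupp.single i 1) *
          Finsupp.linearCombination R f (Finsupp.single j 1)
      rw [e, hint, hmul, Finsupp.linearCombination_single, Finsupp.linearCombination_single,
        one_smul, one_smul]
    exact LinearMap.congr_fun (LinearMap.congr_fun h x) y

variable {A : Type*} [CommRing A] [Algebra R A] {f : ι → A} (h1 : f T.unit = 1)
    (hmul : ∀ i j, Finsupp.linearCombination ℤ f (T.prod i j) = f i * f j)

theorem evalHom_apply (x : T.Alg R) :
    T.evalHom R f h1 hmul x = Finsupp.linearCombination R f (x : ι →₀ R) := rfl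

theorem evalHom_basis (i : ι) : T.evalHom R f h1 hmul (T.basis R i) = f i := by
  rw [evalHom_apply, basis, Finsupp.linearCombination_single, one_smul]

theorem evalHom_smul (c : R) (x : T.Alg R) :
    T.evalHom R f h1 hmul (c • x) = c • T.evalHom R f h1 hmul x :=
  (Finsupp.linearCombination R f).map_smul c x

end FusionTable

theorem linearCombination_pi_apply {ι D : Type*} (f : ι → D → ℂ) (x : ι →₀ ℤ) (d : D) :
    Finsupp.linearCombination ℤ f x d = Finsupp.linearCombination ℤ (fun i => f i d) x := by
  rw [Finsupp.linearCombination_apply, Finsupp.linearCombination_apply, Finsupp.sum, Finsupp.sum,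
    Finset.sum_apply]
  rfl

namespace Params

variable (P : Params)

/-! ### The characters of the Verlinde ring -/

/-- `exp (2 π e p₋ / α)` -/
def qX (e : ℂ) : ℂ := Complex.exp (2 * Real.pi * e * P.pm / P.alpha)

/-- `exp (2 π e p₊ / α)` -/
def qY (e : ℂ) : ℂ := Complex.exp (2 * Real.pi * e * P.pp / P.alpha)

/-- `exp (2 π e p₊ p₋ / α)` -/
def qZ (e : ℂ) : ℂ := Complex.exp (2 * Real.pi * e * (P.pp * P.pm) / P.alpha)

theorem qX_ne_zero (e : ℂ) : P.qX e ≠ 0 := Complex.exp_ne_zero _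

theorem qY_ne_zero (e : ℂ) : P.qY e ≠ 0 := Complex.exp_ne_zero _

theorem qZ_ne_zero (e : ℂ) : P.qZ e ≠ 0 := Complex.exp_ne_zero _

theorem qX_pow (e : ℂ) : P.qX e ^ (P.pp : ℤ) = P.qZ e := by
  rw [qX, qZ, ← Complex.exp_int_mul]; congr 1; push_cast; ring

theorem qY_pow (e : ℂ) : P.qY e ^ (P.pm : ℤ) = P.qZ e := by
  rw [qY, qZ, ← Complex.exp_int_mul]; congr 1; push_cast; ring

/-- The value of the character at the Fock module of weight `l`. -/
def fockVal (e l : ℂ) : ℂ :=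
  Complex.exp (2 * Real.pi * e * (l - P.alphaZero / 2)) *
    (qInt P.pp (P.qX e) * qInt P.pm (P.qY e))

/-- The value of the character at `I_{r,s;n}`. -/
def atypicalVal (e : ℂ) (r s : ℕ) (n : ℤ) : ℂ :=
  P.qZ e ^ n * (qInt r (P.qX e) * qInt s (P.qY e))

/-- The character of the Verlinde ring with parameter `e`. -/
def labelVal (e : ℂ) : P.VerlindeLabel → ℂ
  | .typical l _ => P.fockVal e l
  | .atypical r s _ _ n => P.atypicalVal e r s n

/-- The additive extension of `labelVal`. -/
abbrev evInt (e : ℂ) : (P.VerlindeLabel →₀ ℤ) →ₗ[ℤ] ℂ :=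
  Finsupp.linearCombination ℤ (P.labelVal e)

theorem evInt_atypicalClass (e : ℂ) {r s : ℕ} (hr : r ≤ P.pp) (hs : s ≤ P.pm) (n : ℤ) :
    P.evInt e (P.atypicalClass r s n) = P.atypicalVal e r s n := by
  rw [atypicalClass]
  split_ifs with h
  · rw [Finsupp.linearCombination_single, one_smul]; rfl
  · rw [map_zero, atypicalVal]
    have : r = 0 ∨ s = 0 := by omega
    rcases this with rfl | rfl <;> simp [qInt_zero]

/-- Measured from α₀/2, atypical weights are integers divided by α. This integer is the exponent N
of the Gaussians. -/
theorem weight_sub (r s n : ℤ) : (P.weight r s n - P.alphaZero / 2 : ℝ) =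
    ((s * P.pp - r * P.pm + n * (P.pp * P.pm) : ℤ) : ℝ) / P.alpha := by
  have ha := P.alpha_pos.ne'
  rw [weight, alphaZero, P.alphaPlus_eq, P.alphaMinus_eq]
  push_cast
  field_simp
  linear_combination (n : ℝ) * P.alpha_sq

theorem weight_sub' (r s n : ℤ) : ((P.weight r s n : ℂ) - P.alphaZero / 2) =
    ((s * P.pp - r * P.pm + n * (P.pp * P.pm) : ℤ) : ℂ) / P.alpha := by
  have := congrArg (fun x : ℝ => (x : ℂ)) (P.weight_sub r s n)
  push_cast at this ⊢
  exact this

theorem fockVal_weight (e : ℂ) (r s n : ℤ) : P.fockVal e (P.weight r s n) =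
    P.qY e ^ s * P.qX e ^ (-r) * P.qZ e ^ n * (qInt P.pp (P.qX e) * qInt P.pm (P.qY e)) := by
  rw [fockVal, weight_sub']
  congr 1
  rw [qX, qY, qZ, ← Complex.exp_int_mul, ← Complex.exp_int_mul, ← Complex.exp_int_mul,
    ← Complex.exp_add, ← Complex.exp_add]
  congr 1
  push_cast
  ring

/-- The four factors are the product of two instances of `qInt_add_mul`, one in X and one in Y⁻¹.
The inverse is needed because replacing s by p₋ - s shifts n by -1, while replacing r by p₊ - r
shifts it by +1. -/
theorem evInt_feiginFuchsClass (e : ℂ) {r s : ℕ} (hr : r ≤ P.pp) (hs : s ≤ P.pm) (n : ℤ) :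
    P.evInt e (P.feiginFuchsClass r s n) = P.fockVal e (P.weight r s n) := by
  rw [feiginFuchsClass, map_add, map_add, map_add, P.evInt_atypicalClass e hr hs,
    P.evInt_atypicalClass e (Nat.sub_le _ _) hs, P.evInt_atypicalClass e hr (Nat.sub_le _ _),
    P.evInt_atypicalClass e (Nat.sub_le _ _) (Nat.sub_le _ _), fockVal_weight]
  simp only [atypicalVal]
  have h1 := qInt_add_mul hr (P.qX_ne_zero e)
  have h2 := qInt_add_mul hs (inv_ne_zero (P.qY_ne_zero e))
  rw [qInt_inv, qInt_inv, qInt_inv, inv_zpow', inv_zpow', zpow_neg, P.qY_pow, neg_sub,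
    zpow_sub₀ (P.qY_ne_zero e), P.qY_pow] at h2
  rw [zpow_sub₀ (P.qX_ne_zero e), P.qX_pow] at h1
  have hZ := P.qZ_ne_zero e
  rw [zpow_add₀ hZ, zpow_sub₀ hZ, zpow_one, zpow_neg]
  have h3 := congrArg₂ (· * ·) h1 h2
  linear_combination P.qZ e ^ n * h3 + (P.qZ e ^ n * ((P.qX e) ^ (r : ℤ))⁻¹ * P.qY e ^ (s : ℤ) *
    (qInt P.pp (P.qX e) * qInt P.pm (P.qY e)) - P.qZ e ^ n * qInt (P.pp - r) (P.qX e) *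
      qInt (P.pm - s) (P.qY e)) * (mul_inv_cancel₀ hZ)

/-- `fockClass` chooses a triple (r, s; n) for an atypical weight; the value depends on the weight l
alone, so the choice is harmless. -/
theorem evInt_fockClass (e l : ℂ) : P.evInt e (P.fockClass l) = P.fockVal e l := by
  by_cases h : P.IsTypical l
  · rw [P.fockClass_typical h, Finsupp.linearCombination_single, one_smul]; rfl
  · rw [fockClass, dif_neg h]
    have hx := (P.exists_weight_eq h).choose_spec
    rw [P.evInt_feiginFuchsClass e hx.1.2 hx.2.1.2, ← hx.2.2]

theorem evInt_extendedClass (e : ℂ) {r s : ℕ} (hr : r ≤ 2 * P.pp) (hs : s ≤ 2 * P.pm) (n : ℤ) :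
    P.evInt e (P.extendedClass r s n) = P.atypicalVal e r s n := by
  have hZ := P.qZ_ne_zero e
  have hplus : ∀ t : ℕ, t ≤ P.pp → qInt (P.pp + t) (P.qX e) =
      qInt (P.pp - t) (P.qX e) + (P.qZ e + (P.qZ e)⁻¹) * qInt t (P.qX e) := by
    intro t ht
    rw [qInt_add_of_le ht (P.qX_ne_zero e), zpow_neg, P.qX_pow]
  have hminus : ∀ t : ℕ, t ≤ P.pm → qInt (P.pm + t) (P.qY e) =
      qInt (P.pm - t) (P.qY e) + (P.qZ e + (P.qZ e)⁻¹) * qInt t (P.qY e) := by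
    intro t ht
    rw [qInt_add_of_le ht (P.qY_ne_zero e), zpow_neg, P.qY_pow]
  rw [extendedClass, extend, extend]
  by_cases h1 : r ≤ P.pp <;> by_cases h2 : s ≤ P.pm <;> simp only [h1, h2, if_true, if_false]
  · simp only [List.map_cons, List.map_nil, List.sum_cons, List.sum_nil, add_zero]
    rw [P.evInt_atypicalClass e h1 h2]
  · obtain ⟨t, rfl⟩ := Nat.exists_eq_add_of_le (not_le.1 h2).le
    have e1 : 2 * P.pm - (P.pm + t) = P.pm - t := by omega
    have e2 : P.pm + t - P.pm = t := by omega
    simp only [List.map_cons, List.map_nil, List.sum_cons, List.sum_nil, add_zero, map_add, e1, e2]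
    rw [P.evInt_atypicalClass e h1 (by omega), P.evInt_atypicalClass e h1 (by omega),
      P.evInt_atypicalClass e h1 (by omega)]
    simp only [atypicalVal]
    rw [hminus t (by omega), zpow_add₀ hZ, zpow_add₀ hZ, zpow_one, zpow_neg, zpow_one]
    ring
  · obtain ⟨t, rfl⟩ := Nat.exists_eq_add_of_le (not_le.1 h1).le
    have e1 : 2 * P.pp - (P.pp + t) = P.pp - t := by omega
    have e2 : P.pp + t - P.pp = t := by omega
    simp only [List.map_cons, List.map_nil, List.sum_cons, List.sum_nil, add_zero, map_add, e1, e2]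
    rw [P.evInt_atypicalClass e (by omega) h2, P.evInt_atypicalClass e (by omega) h2,
      P.evInt_atypicalClass e (by omega) h2]
    simp only [atypicalVal]
    rw [hplus t (by omega), zpow_add₀ hZ, zpow_add₀ hZ, zpow_one, zpow_neg, zpow_one]
    ring
  · obtain ⟨t, rfl⟩ := Nat.exists_eq_add_of_le (not_le.1 h1).le
    obtain ⟨t', rfl⟩ := Nat.exists_eq_add_of_le (not_le.1 h2).le
    have e1 : 2 * P.pp - (P.pp + t) = P.pp - t := by omega
    have e2 : P.pp + t - P.pp = t := by omega
    have e3 : 2 * P.pm - (P.pm + t') = P.pm - t' := by omega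
    have e4 : P.pm + t' - P.pm = t' := by omega
    have h3 : t ≤ P.pp := by omega
    have h4 : t' ≤ P.pm := by omega
    simp only [List.map_cons, List.map_nil, List.sum_cons, List.sum_nil, add_zero, map_add, e1, e2,
      e3, e4, P.evInt_atypicalClass e (Nat.sub_le P.pp t) (Nat.sub_le P.pm t'),
      P.evInt_atypicalClass e (Nat.sub_le P.pp t) h4,
      P.evInt_atypicalClass e h3 (Nat.sub_le P.pm t'), P.evInt_atypicalClass e h3 h4]
    simp only [atypicalVal]
    rw [hplus t h3, hminus t' h4]
    simp only [zpow_add₀ hZ, zpow_one, zpow_neg]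
    ring

theorem exp_alphaPlus (e : ℂ) : Complex.exp (Real.pi * e * P.alphaPlus) = P.qX e := by
  rw [qX, P.alphaPlus_eq]; congr 1; push_cast; ring

theorem exp_alphaMinus (e : ℂ) : Complex.exp (Real.pi * e * P.alphaMinus) = (P.qY e)⁻¹ := by
  rw [qY, P.alphaMinus_eq, ← Complex.exp_neg]; congr 1; push_cast; ring

theorem exp_alpha (e : ℂ) : Complex.exp (Real.pi * e * P.alpha) = P.qZ e := by
  have ha : (P.alpha : ℂ) ≠ 0 := by exact_mod_cast P.alpha_pos.ne'
  have h : (P.alpha : ℂ) * P.alpha = 2 * P.pp * P.pm := by exact_mod_cast P.alpha_sq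
  rw [qZ]; congr 1; field_simp; linear_combination e * h

/-- The weight shifts contribute the monomials X^{2i+1-r} and (Y⁻¹)^{2j+1-s}, whose sums are the
quantum integers; the inversion of Y does not matter by symmetry. -/
theorem evInt_atypicalTypicalProd (e : ℂ) (r s : ℕ) (n : ℤ) (l : ℂ) :
    P.evInt e (P.atypicalTypicalProd r s n l) = P.atypicalVal e r s n * P.fockVal e l := by
  rw [atypicalTypicalProd, map_sum]
  have h : ∀ i j : ℕ, P.evInt e (P.fockClass
      (l + (P.weight ((r : ℤ) - 2 * i) ((s : ℤ) - 2 * j) n : ℂ))) =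
      P.qZ e ^ n * (P.qX e ^ (2 * (i : ℤ) + 1 - r) * (P.qY e)⁻¹ ^ (2 * (j : ℤ) + 1 - s)) *
        P.fockVal e l := by
    intro i j
    rw [evInt_fockClass, fockVal, fockVal, ← exp_alpha, ← exp_alphaPlus, ← exp_alphaMinus,
      ← mul_assoc]
    rw [← Complex.exp_int_mul, ← Complex.exp_int_mul, ← Complex.exp_int_mul,
      ← Complex.exp_add, ← Complex.exp_add, ← mul_assoc, ← Complex.exp_add, mul_assoc]
    congr 2
    rw [weight]
    push_cast
    ring
  simp only [map_sum, h]
  rw [atypicalVal, ← qInt_inv s, qInt, qInt, Finset.sum_mul_sum, Finset.mul_sum, Finset.sum_mul]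
  refine Finset.sum_congr rfl fun i _ => ?_
  rw [Finset.mul_sum, Finset.sum_mul]

theorem evInt_typicalProd (e l l' : ℂ) :
    P.evInt e (∑ i ∈ Finset.range P.pp, ∑ j ∈ Finset.range P.pm,
      P.fockClass (l + l' + i * (P.alphaPlus : ℂ) + j * (P.alphaMinus : ℂ))) =
      P.fockVal e l * P.fockVal e l' := by
  have hX := P.qX_ne_zero e
  have hY := inv_ne_zero (P.qY_ne_zero e)
  have h : ∀ i j : ℕ, P.evInt e (P.fockClass
      (l + l' + i * (P.alphaPlus : ℂ) + j * (P.alphaMinus : ℂ))) =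
      Complex.exp (2 * Real.pi * e * (l - P.alphaZero / 2)) * P.fockVal e l' *
        (P.qX e ^ (2 * (i : ℤ) + 1 - P.pp) * (P.qY e)⁻¹ ^ (2 * (j : ℤ) + 1 - P.pm)) := by
    intro i j
    -- X^{-p₊} gives Z⁻¹ and (Y⁻¹)^{-p₋} gives Z, so the centring of the two quantum integers
    -- cancels.
    have e1 : P.qX e ^ (2 * (i : ℤ) + 1 - P.pp) * (P.qY e)⁻¹ ^ (2 * (j : ℤ) + 1 - P.pm) =
        P.qX e ^ (2 * (i : ℤ) + 1) * (P.qY e)⁻¹ ^ (2 * (j : ℤ) + 1) := by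
      rw [zpow_sub₀ hX, zpow_sub₀ hY, P.qX_pow, inv_zpow _ (P.pm : ℤ), P.qY_pow]
      have := P.qZ_ne_zero e
      field_simp
    -- Splitting l + l' into two weights centred at α₀/2 leaves an extra α₀/2, which supplies the +1
    -- in the odd exponents.
    have e2 : Complex.exp (2 * Real.pi * e *
        (l + l' + i * (P.alphaPlus : ℂ) + j * (P.alphaMinus : ℂ) - P.alphaZero / 2)) =
        Complex.exp (2 * Real.pi * e * (l - P.alphaZero / 2)) *
          Complex.exp (2 * Real.pi * e * (l' - P.alphaZero / 2)) *
          (P.qX e ^ (2 * (i : ℤ) + 1) * (P.qY e)⁻¹ ^ (2 * (j : ℤ) + 1)) := by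
      rw [← exp_alphaPlus, ← exp_alphaMinus, ← Complex.exp_int_mul, ← Complex.exp_int_mul,
        ← Complex.exp_add, ← Complex.exp_add, ← Complex.exp_add]
      congr 1
      rw [alphaZero]
      push_cast
      ring
    rw [e1, evInt_fockClass, fockVal, fockVal, e2]
    ring
  simp only [map_sum, h]
  conv_rhs => rw [fockVal, ← qInt_inv P.pm, qInt, qInt, Finset.sum_mul_sum, mul_right_comm,
    Finset.mul_sum]
  refine Finset.sum_congr rfl fun i _ => ?_
  rw [Finset.mul_sum]

/-- Multiplicativity of the universal formula. For two atypical labels the X and Y factors separate,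
and the indices produced are at most r + r' - 1 ≤ 2p₊ - 1 and s + s' - 1 ≤ 2p₋ - 1, so every symbol
is covered by `evInt_extendedClass`. -/
theorem evInt_verlindeProd (e : ℂ) (x y : P.VerlindeLabel) :
    P.evInt e (P.verlindeProd x y) = P.labelVal e x * P.labelVal e y := by
  cases x with
  | typical l h =>
    cases y with
    | typical l' h' => exact P.evInt_typicalProd e l l'
    | atypical r s hr hs n =>
      exact (P.evInt_atypicalTypicalProd e r s n l).trans (mul_comm _ _)
  | atypical r s hr hs n =>
    cases y with
    | typical l h => exact P.evInt_atypicalTypicalProd e r s n l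
    | atypical r' s' hr' hs' n' =>
      change P.evInt e (∑ a ∈ clebschGordan r r', ∑ b ∈ clebschGordan s s',
        P.extendedClass a b (n + n')) = P.atypicalVal e r s n * P.atypicalVal e r' s' n'
      have h : ∀ a ∈ clebschGordan r r', ∀ b ∈ clebschGordan s s',
          P.evInt e (P.extendedClass a b (n + n')) = P.atypicalVal e a b (n + n') := by
        intro a ha b hb
        simp only [clebschGordan, Finset.mem_filter, Finset.mem_Icc] at ha hb
        exact P.evInt_extendedClass e (by omega) (by omega) _
      simp only [map_sum]
      rw [Finset.sum_congr rfl fun a ha => Finset.sum_congr rfl fun b hb => h a ha b hb]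
      simp only [atypicalVal]
      have h1 := qInt_mul_qInt hr.1 hr'.1 (P.qX_ne_zero e)
      have h2 := qInt_mul_qInt hs.1 hs'.1 (P.qY_ne_zero e)
      rw [mul_mul_mul_comm, mul_mul_mul_comm (qInt r _), h1, h2, ← zpow_add₀ (P.qZ_ne_zero e),
        Finset.sum_mul_sum, Finset.mul_sum]
      exact Finset.sum_congr rfl fun a _ => (Finset.mul_sum _ _ _).symm

theorem labelVal_unit (e : ℂ) : P.labelVal e P.verlindeUnit = 1 := by
  change P.atypicalVal e 1 1 0 = 1
  simp [atypicalVal, qInt_one]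

/-- The family of characters of the Verlinde ring with parameters `e d`, `d ∈ D`. -/
def familyHom (R : Type*) [CommRing R] [Algebra R ℂ] {D : Set ℂ} (e : D → ℂ) :
    P.verlinde.Alg R →+* (D → ℂ) :=
  P.verlinde.evalHom R (fun x d => P.labelVal (e d) x) (funext fun d => P.labelVal_unit (e d))
    fun x y => funext fun d => by
      rw [linearCombination_pi_apply]
      exact P.evInt_verlindeProd (e d) x y

end Params

end Singlet

/-! ### Characters times η as lattice sums -/

namespace Singlet

variable {a : ℝ} {L : ℕ} {ι : Type*} [Fintype ι]

theorem summable_gauss_nat (ha : 0 < a) (hL : a * a = L) (ε u v : ℂ) {y : ℝ} (hy : 0 < y)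
    (c : ℤ) : Summable fun k : ℕ => (u + v * k) * gauss a ε y (c - L * k) := by
  obtain ⟨f, hf⟩ : ∃ f : ℤ → ℂ, ∀ k, f k = (u + v * k) * gauss a ε y (c - L * k) :=
    ⟨_, fun _ => rfl⟩
  have hs : Summable f := (summable_gauss_int ha hL ε u v hy c).congr fun k => (hf k).symm
  have h1 : Summable fun k : ℕ => f k := hs.comp_injective Nat.cast_injective
  refine h1.congr fun k => ?_
  rw [hf]; push_cast; rfl

theorem halfSum_eq_tsum (ha : 0 < a) (hL : a * a = L) (ε u v : ℂ) (σ : ι → ℂ) (c : ι → ℤ)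
    {y : ℝ} (hy : 0 < y) : halfSum a L ε u v σ c y =
      ∑' k : ℕ, ∑ i, σ i * ((u + v * k) * gauss a ε y (c i - L * k)) := by
  rw [Summable.tsum_finsetSum
    fun i _ => (summable_gauss_nat ha hL ε u v hy (c i)).mul_left (σ i), halfSum]
  exact Finset.sum_congr rfl fun i _ => tsum_mul_left.symm

theorem fullSum_eq_tsum (ha : 0 < a) (hL : a * a = L) (ε u v : ℂ) (σ : ι → ℂ) (c : ι → ℤ)
    {y : ℝ} (hy : 0 < y) : fullSum a L ε u v σ c y =
      ∑' k : ℤ, ∑ i, σ i * ((u + v * k) * gauss a ε y (c i - L * k)) := by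
  rw [Summable.tsum_finsetSum
    fun i _ => (summable_gauss_int ha hL ε u v hy (c i)).mul_left (σ i), fullSum]
  exact Finset.sum_congr rfl fun i _ => tsum_mul_left.symm

/-- The signs `±1`. -/
def sgn (b : Bool) : ℤ := if b then 1 else -1

/-- The signs in an alternating sum of two terms. -/
def sign₁ (b : Bool) : ℂ := sgn b

/-- The exponents `± A + N`. -/
def expo₁ (A N : ℤ) (b : Bool) : ℤ := sgn b * A + N

/-- The signs in an alternating sum of four terms. -/
def sign₂ (b : Bool × Bool) : ℂ := sgn b.1 * sgn b.2

/-- The exponents `± A ± B + N`. -/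
def expo₂ (A B N : ℤ) (b : Bool × Bool) : ℤ := sgn b.1 * A + sgn b.2 * B + N

theorem sum_sign₁ (f : Bool → ℂ) : ∑ b, sign₁ b * f b = f true - f false := by
  rw [Fintype.sum_bool]; simp [sign₁, sgn]; ring

theorem sum_sign₂ (f : Bool × Bool → ℂ) : ∑ b, sign₂ b * f b =
    f (true, true) - f (true, false) - f (false, true) + f (false, false) := by
  rw [Fintype.sum_prod_type, Fintype.sum_bool, Fintype.sum_bool, Fintype.sum_bool]
  simp [sign₂, sgn]; ring

namespace Params

variable (P : Params)

/-- The period `2 p₊ p₋`. -/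
def period : ℕ := 2 * P.pp * P.pm

theorem alpha_mul_self : P.alpha * P.alpha = (P.period : ℝ) := by
  rw [alpha_sq, period]; push_cast; ring

theorem ffCh_eq (r s n : ℤ) (ε : ℂ) (y : ℝ) : P.ffCh r s n ε (Complex.I * y) =
    gauss P.alpha ε y (s * P.pp - r * P.pm + n * (P.pp * P.pm)) /
      ModularForm.eta (Complex.I * y) := by
  rw [ffCh, fockCh, weight_sub', ← Complex.exp_add, gauss]
  congr 2
  have hI := Complex.I_sq
  push_cast
  linear_combination (Real.pi * y *
    ((s * P.pp - r * P.pm + n * (P.pp * P.pm) : ℂ) / P.alpha) ^ 2) * hI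

theorem eta_ne_zero' {y : ℝ} (hy : 0 < y) : ModularForm.eta (Complex.I * y) ≠ 0 := by
  refine ModularForm.eta_ne_zero ?_
  change 0 < (Complex.I * y : ℂ).im
  simpa using hy

/-- The character of a simple module, multiplied by `η`. -/
def numer (M : P.SimpleModule) (ε : ℂ) (y : ℝ) : ℂ :=
  P.simpleCh M ε (Complex.I * y) * ModularForm.eta (Complex.I * y)

/-- `ch[L_{r,s}]`, multiplied by `η`. -/
def minimalNumer (r s : ℤ) (y : ℝ) : ℂ :=
  P.minimalCh r s (Complex.I * y) * ModularForm.eta (Complex.I * y)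

theorem minimalNumer_eq (r s : ℤ) {y : ℝ} (hy : 0 < y) : P.minimalNumer r s y =
    fullSum P.alpha P.period 0 1 0 sign₁ (expo₁ (-(r * P.pm)) (s * P.pp)) y := by
  have hη := eta_ne_zero' hy
  -- The index is reversed because the exponents of `fullSum` descend with k while those of the
  -- Felder sum ascend.
  rw [fullSum_eq_tsum P.alpha_pos P.alpha_mul_self 0 1 0 _ _ hy, minimalNumer, minimalCh,
    ← tsum_mul_right, ← (Equiv.neg ℤ).tsum_eq]
  refine tsum_congr fun k => ?_
  rw [sum_sign₁, ffCh_eq, ffCh_eq]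
  have e1 : (s * P.pp - r * P.pm + (2 * (Equiv.neg ℤ) k) * (P.pp * P.pm) : ℤ) =
      expo₁ (-(r * P.pm)) (s * P.pp) true - P.period * k := by
    simp [expo₁, sgn, period]; ring
  have e2 : (s * P.pp - (P.pp - r) * P.pm + (2 * (Equiv.neg ℤ) k + 1) * (P.pp * P.pm) : ℤ) =
      expo₁ (-(r * P.pm)) (s * P.pp) false - P.period * k := by
    simp [expo₁, sgn, period]; ring
  rw [e1, e2]
  field_simp
  ring

/-- The four Fock exponents are ±s p₊ ± r p₋ around the common centre (n - 2)p₊p₋, and lowering n by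
2 lowers the exponent by one period. The weight k + 1 is the case u = v = 1. -/
theorem innerCh_eq (r s n : ℤ) (ε : ℂ) {y : ℝ} (hy : 0 < y) :
    P.innerCh r s n ε (Complex.I * y) * ModularForm.eta (Complex.I * y) =
      (if 0 ≤ n then (n : ℂ) * (if Even n then P.minimalNumer r s y
        else -P.minimalNumer r (P.pm - s) y) else 0) +
      halfSum P.alpha P.period ε 1 1 sign₂
        (expo₂ (s * P.pp) (r * P.pm) ((n - 2) * (P.pp * P.pm))) y := by
  have hη := eta_ne_zero' hy
  rw [halfSum_eq_tsum P.alpha_pos P.alpha_mul_self _ _ _ _ _ hy, innerCh, add_mul,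
    ← tsum_mul_right]
  congr 1
  · simp only [minimalNumer]
    split_ifs <;> ring
  refine tsum_congr fun k => ?_
  rw [sum_sign₂, ffCh_eq, ffCh_eq, ffCh_eq, ffCh_eq]
  have e1 : (s * P.pp - (P.pp - r) * P.pm + (n - 2 * k - 1) * (P.pp * P.pm) : ℤ) =
      expo₂ (s * P.pp) (r * P.pm) ((n - 2) * (P.pp * P.pm)) (true, true) - P.period * k := by
    simp [expo₂, sgn, period]; ring
  have e2 : ((P.pm - s) * P.pp - r * P.pm + (n - 2 * k - 3) * (P.pp * P.pm) : ℤ) =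
      expo₂ (s * P.pp) (r * P.pm) ((n - 2) * (P.pp * P.pm)) (false, false) - P.period * k := by
    simp [expo₂, sgn, period]; ring
  have e3 : (s * P.pp - r * P.pm + (n - 2 * k - 2) * (P.pp * P.pm) : ℤ) =
      expo₂ (s * P.pp) (r * P.pm) ((n - 2) * (P.pp * P.pm)) (true, false) - P.period * k := by
    simp [expo₂, sgn, period]; ring
  have e4 : ((P.pm - s) * P.pp - (P.pp - r) * P.pm + (n - 2 * k - 2) * (P.pp * P.pm) : ℤ) =
      expo₂ (s * P.pp) (r * P.pm) ((n - 2) * (P.pp * P.pm)) (false, true) - P.period * k := by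
    simp [expo₂, sgn, period]; ring
  rw [e1, e2, e3, e4]
  field_simp
  ring

/-- Here two exponents ±r p₋ around (n - 1)p₊p₋ remain, with constant weight, so u = 1 and v = 0. -/
theorem plusBorderCh_eq (r n : ℤ) (ε : ℂ) {y : ℝ} (hy : 0 < y) :
    P.plusBorderCh r n ε (Complex.I * y) * ModularForm.eta (Complex.I * y) =
      halfSum P.alpha P.period ε 1 0 sign₁ (expo₁ (r * P.pm) ((n - 1) * (P.pp * P.pm))) y := by
  have hη := eta_ne_zero' hy
  rw [halfSum_eq_tsum P.alpha_pos P.alpha_mul_self _ _ _ _ _ hy, plusBorderCh,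
    ← tsum_mul_right]
  refine tsum_congr fun k => ?_
  rw [sum_sign₁, ffCh_eq, ffCh_eq]
  have e1 : ((P.pm : ℤ) * P.pp - (P.pp - r) * P.pm + (n - 2 * k - 1) * (P.pp * P.pm) : ℤ) =
      expo₁ (r * P.pm) ((n - 1) * (P.pp * P.pm)) true - P.period * k := by
    simp [expo₁, sgn, period]; ring
  have e2 : ((P.pm : ℤ) * P.pp - r * P.pm + (n - 2 * k - 2) * (P.pp * P.pm) : ℤ) =
      expo₁ (r * P.pm) ((n - 1) * (P.pp * P.pm)) false - P.period * k := by
    simp [expo₁, sgn, period]; ring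
  rw [e1, e2]
  field_simp
  ring

theorem minusBorderCh_eq (s n : ℤ) (ε : ℂ) {y : ℝ} (hy : 0 < y) :
    P.minusBorderCh s n ε (Complex.I * y) * ModularForm.eta (Complex.I * y) =
      halfSum P.alpha P.period ε 1 0 sign₁ (expo₁ (s * P.pp) ((n - 1) * (P.pp * P.pm))) y := by
  have hη := eta_ne_zero' hy
  rw [halfSum_eq_tsum P.alpha_pos P.alpha_mul_self _ _ _ _ _ hy, minusBorderCh,
    ← tsum_mul_right]
  refine tsum_congr fun k => ?_
  rw [sum_sign₁, ffCh_eq, ffCh_eq]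
  have e1 : (s * P.pp - (P.pp : ℤ) * P.pm + (n - 2 * k) * (P.pp * P.pm) : ℤ) =
      expo₁ (s * P.pp) ((n - 1) * (P.pp * P.pm)) true - P.period * k := by
    simp [expo₁, sgn, period]; ring
  have e2 : ((P.pm - s) * P.pp - (P.pp : ℤ) * P.pm + (n - 2 * k - 1) * (P.pp * P.pm) : ℤ) =
      expo₁ (s * P.pp) ((n - 1) * (P.pp * P.pm)) false - P.period * k := by
    simp [expo₁, sgn, period]; ring
  rw [e1, e2]
  field_simp
  ring

theorem tendsto_fockCh (l ε : ℂ) :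
    Tendsto (fun y : ℝ => P.fockCh l ε (Complex.I * y) * ModularForm.eta (Complex.I * y))
      (𝓝[>] 0) (𝓝 (Complex.exp (2 * Real.pi * ε * (l - P.alphaZero / 2)))) := by
  have h : Continuous fun y : ℝ => Complex.exp (2 * Real.pi * ε * (l - P.alphaZero / 2)) *
    Complex.exp (2 * Real.pi * Complex.I * (Complex.I * y) * ((l - P.alphaZero / 2) ^ 2 / 2)) := by
    fun_prop
  have h0 := (h.tendsto 0).mono_left (nhdsWithin_le_nhds (s := Set.Ioi 0))
  simp only [Complex.ofReal_zero, mul_zero, zero_mul, Complex.exp_zero, mul_one] at h0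
  refine h0.congr' ?_
  filter_upwards [self_mem_nhdsWithin] with y hy
  rw [fockCh, div_mul_cancel₀ _ (eta_ne_zero' hy)]

/-- At ε = 0 only the mode m = 0 has nonnegative rate, and its amplitude is the sum of the signs,
which is 0. This is why the Virasoro modules have quantum dimension 0. -/
theorem tendsto_minimalNumer (r s : ℤ) : Tendsto (P.minimalNumer r s) (𝓝[>] 0) (𝓝 0) := by
  have h := tendsto_fullSum_zero P.alpha_pos P.alpha_mul_self 0 1 0 sign₁
    (expo₁ (-(r * P.pm)) (s * P.pp)) fun m hm => ?_
  · refine h.congr' ?_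
    filter_upwards [self_mem_nhdsWithin] with y hy
    rw [minimalNumer_eq P r s hy]
  · have hm0 : m = 0 := by
      rw [modeRate] at hm
      simp only [Complex.zero_re, Complex.zero_im] at hm
      have h1 : (m / P.alpha : ℝ) ^ 2 ≤ 0 := by nlinarith
      have h2 : (m / P.alpha : ℝ) = 0 := by
        have := sq_nonneg (m / P.alpha : ℝ)
        exact pow_eq_zero_iff two_ne_zero |>.1 (le_antisymm h1 this)
      rcases div_eq_zero_iff.1 h2 with h3 | h3
      · exact_mod_cast h3
      · exact absurd h3 P.alpha_pos.ne'
    refine ⟨?_, zero_mul _⟩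
    rw [amp, sum_sign₁, hm0]
    simp [phase]

end Params

end Singlet

/-! ### Amplitudes of the modes as values of the universal formula -/

namespace Singlet

namespace Params

variable (P : Params)

/-- `exp (2 π e c / α)` -/
def qE (e : ℂ) (c : ℤ) : ℂ := Complex.exp (2 * Real.pi * e * c / P.alpha)

theorem qE_ne_zero (e : ℂ) (c : ℤ) : P.qE e c ≠ 0 := Complex.exp_ne_zero _

theorem qE_add (e : ℂ) (c d : ℤ) : P.qE e (c + d) = P.qE e c * P.qE e d := by
  rw [qE, qE, qE, ← Complex.exp_add]; congr 1; push_cast; ring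

theorem qE_neg (e : ℂ) (c : ℤ) : P.qE e (-c) = (P.qE e c)⁻¹ := by
  rw [qE, qE, ← Complex.exp_neg]; congr 1; push_cast; ring

theorem qE_mul_pm (e : ℂ) (r : ℤ) : P.qE e (r * P.pm) = P.qX e ^ r := by
  rw [qE, qX, ← Complex.exp_int_mul]; congr 1; push_cast; ring

theorem qE_mul_pp (e : ℂ) (s : ℤ) : P.qE e (s * P.pp) = P.qY e ^ s := by
  rw [qE, qY, ← Complex.exp_int_mul]; congr 1; push_cast; ring

theorem qE_mul_pp_pm (e : ℂ) (n : ℤ) : P.qE e (n * (P.pp * P.pm)) = P.qZ e ^ n := by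
  rw [qE, qZ, ← Complex.exp_int_mul]; congr 1; push_cast; ring

theorem sum_sign₁_qE (e : ℂ) (A N : ℤ) : ∑ b, sign₁ b * P.qE e (expo₁ A N b) =
    P.qE e N * (P.qE e A - (P.qE e A)⁻¹) := by
  rw [sum_sign₁]
  simp only [expo₁, sgn, if_true, Bool.false_eq_true, if_false, one_mul, neg_one_mul, qE_add,
    qE_neg]
  ring

theorem sum_sign₂_qE (e : ℂ) (A B N : ℤ) : ∑ b, sign₂ b * P.qE e (expo₂ A B N b) =
    P.qE e N * ((P.qE e A - (P.qE e A)⁻¹) * (P.qE e B - (P.qE e B)⁻¹)) := by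
  rw [sum_sign₂]
  simp only [expo₂, sgn, if_true, Bool.false_eq_true, if_false, one_mul, neg_one_mul, qE_add,
    qE_neg]
  ring

/-- Weighting by the exponent acts as a derivative on the product of `sum_sign₂_qE`; the three terms
are Leibniz's rule for the factors belonging to A, B and N. -/
theorem sum_sign₂_expo₂_qE (e : ℂ) (A B N : ℤ) :
    ∑ b, sign₂ b * expo₂ A B N b * P.qE e (expo₂ A B N b) =
    P.qE e N * (A * ((P.qE e A + (P.qE e A)⁻¹) * (P.qE e B - (P.qE e B)⁻¹)) +
      B * ((P.qE e A - (P.qE e A)⁻¹) * (P.qE e B + (P.qE e B)⁻¹)) +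
      N * ((P.qE e A - (P.qE e A)⁻¹) * (P.qE e B - (P.qE e B)⁻¹))) := by
  simp only [mul_assoc]
  rw [sum_sign₂]
  simp only [expo₂, sgn, if_true, Bool.false_eq_true, if_false, one_mul, neg_one_mul, qE_add,
    qE_neg]
  push_cast
  ring

/-- The parameter of the character attached to the Fourier mode `m`. -/
def modeParam (m : ℤ) : ℂ := Complex.I * m / P.alpha

/-- Because L = α², the phase at mode m is an exponential with parameter e = im/α. Mode amplitudes
are thereby the same expressions in X, Y, Z as the geometric limits, evaluated at this e. -/
theorem phase_eq (m c : ℤ) : phase P.period m c = P.qE (P.modeParam m) c := by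
  have h : (P.alpha : ℂ) * P.alpha = P.period := by exact_mod_cast P.alpha_mul_self
  have ha : (P.alpha : ℂ) ≠ 0 := by exact_mod_cast P.alpha_pos.ne'
  rw [phase, qE, modeParam, ← h]
  congr 1
  field_simp

theorem pp_ne_zero : (P.pp : ℂ) ≠ 0 := by
  have := P.two_le_pp
  exact_mod_cast (by omega : P.pp ≠ 0)

theorem pm_ne_zero : (P.pm : ℂ) ≠ 0 := by
  have := P.two_le_pm
  exact_mod_cast (by omega : P.pm ≠ 0)

theorem qX_modeParam (m : ℤ) :
    P.qX (P.modeParam m) = Complex.exp (Real.pi * Complex.I * m / P.pp) := by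
  have h : (P.alpha : ℂ) * P.alpha = 2 * P.pp * P.pm := by exact_mod_cast P.alpha_sq
  have ha : (P.alpha : ℂ) ≠ 0 := by exact_mod_cast P.alpha_pos.ne'
  have h1 := P.pp_ne_zero
  rw [qX, modeParam]
  congr 1
  field_simp
  linear_combination (-m : ℂ) * h

theorem qY_modeParam (m : ℤ) :
    P.qY (P.modeParam m) = Complex.exp (Real.pi * Complex.I * m / P.pm) := by
  have h : (P.alpha : ℂ) * P.alpha = 2 * P.pp * P.pm := by exact_mod_cast P.alpha_sq
  have ha : (P.alpha : ℂ) ≠ 0 := by exact_mod_cast P.alpha_pos.ne'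
  have h1 := P.pm_ne_zero
  rw [qY, modeParam]
  congr 1
  field_simp
  linear_combination (-m : ℂ) * h

end Params

theorem exp_div_sq_eq_one_iff {p : ℕ} (hp : (p : ℂ) ≠ 0) (m : ℤ) :
    Complex.exp (Real.pi * Complex.I * m / p) ^ 2 = 1 ↔ (p : ℤ) ∣ m := by
  have hpi : (Real.pi : ℂ) ≠ 0 := by exact_mod_cast Real.pi_ne_zero
  rw [← Complex.exp_nat_mul, Complex.exp_eq_one_iff]
  constructor
  · rintro ⟨n, hn⟩
    refine ⟨n, ?_⟩
    have hI := Complex.I_ne_zero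
    field_simp at hn
    push_cast at hn
    have : (m : ℂ) = p * n := by linear_combination hn / 2
    exact_mod_cast this
  · rintro ⟨n, rfl⟩
    refine ⟨n, ?_⟩
    push_cast
    field_simp

theorem sub_inv_eq_zero_iff {X : ℂ} (hX : X ≠ 0) : X - X⁻¹ = 0 ↔ X ^ 2 = 1 := by
  constructor
  · intro h
    field_simp at h
    linear_combination h
  · intro h
    field_simp
    linear_combination h

theorem sub_inv_ne_zero {X : ℂ} (hX0 : X ≠ 0) (hX : X ^ 2 ≠ 1) : X - X⁻¹ ≠ 0 :=
  fun h => hX ((sub_inv_eq_zero_iff hX0).1 h)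

theorem zpow_sub_inv_of_sq {X : ℂ} (hX : X ^ 2 = 1) (r : ℤ) : X ^ r - (X ^ r)⁻¹ = 0 := by
  have hX0 : X ≠ 0 := fun h => by simp [h] at hX
  rw [sub_inv_eq_zero_iff (zpow_ne_zero _ hX0), ← zpow_natCast, zpow_comm, zpow_natCast, hX,
    one_zpow]

namespace Params

variable (P : Params)

theorem qX_sq_iff (m : ℤ) : P.qX (P.modeParam m) ^ 2 = 1 ↔ (P.pp : ℤ) ∣ m := by
  rw [qX_modeParam, exp_div_sq_eq_one_iff P.pp_ne_zero]

theorem qY_sq_iff (m : ℤ) : P.qY (P.modeParam m) ^ 2 = 1 ↔ (P.pm : ℤ) ∣ m := by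
  rw [qY_modeParam, exp_div_sq_eq_one_iff P.pm_ne_zero]

theorem qZ_modeParam_sq (m : ℤ) : P.qZ (P.modeParam m) ^ 2 = 1 := by
  have h : (P.alpha : ℂ) * P.alpha = 2 * P.pp * P.pm := by exact_mod_cast P.alpha_sq
  have ha : (P.alpha : ℂ) ≠ 0 := by exact_mod_cast P.alpha_pos.ne'
  rw [qZ, modeParam, ← Complex.exp_nat_mul, Complex.exp_eq_one_iff]
  refine ⟨m, ?_⟩
  field_simp
  push_cast
  linear_combination (-(m : ℂ)) * h

theorem amp_sign₁ (A N m : ℤ) : amp P.period sign₁ (expo₁ A N) m =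
    P.qE (P.modeParam m) N *
      (P.qE (P.modeParam m) A - (P.qE (P.modeParam m) A)⁻¹) := by
  simp only [amp, phase_eq]
  exact P.sum_sign₁_qE _ A N

theorem amp_sign₂ (A B N m : ℤ) : amp P.period sign₂ (expo₂ A B N) m =
    P.qE (P.modeParam m) N *
      ((P.qE (P.modeParam m) A - (P.qE (P.modeParam m) A)⁻¹) *
        (P.qE (P.modeParam m) B - (P.qE (P.modeParam m) B)⁻¹)) := by
  simp only [amp, phase_eq]
  exact P.sum_sign₂_qE _ A B N

theorem amp_sign₂_expo₂ (A B N m : ℤ) :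
    amp P.period (fun b => sign₂ b * expo₂ A B N b) (expo₂ A B N) m =
    P.qE (P.modeParam m) N * (A * ((P.qE (P.modeParam m) A + (P.qE (P.modeParam m) A)⁻¹) *
        (P.qE (P.modeParam m) B - (P.qE (P.modeParam m) B)⁻¹)) +
      B * ((P.qE (P.modeParam m) A - (P.qE (P.modeParam m) A)⁻¹) *
        (P.qE (P.modeParam m) B + (P.qE (P.modeParam m) B)⁻¹)) +
      N * ((P.qE (P.modeParam m) A - (P.qE (P.modeParam m) A)⁻¹) *
        (P.qE (P.modeParam m) B - (P.qE (P.modeParam m) B)⁻¹))) := by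
  simp only [amp, phase_eq]
  exact P.sum_sign₂_expo₂_qE _ A B N

/-- If p₊ and p₋ divide m, then X = ±1 and Y = ±1, so both factors of the amplitude vanish. This
double zero also kills the amplitude weighted by the exponents. -/
theorem modeVanishes_inner {m : ℤ} (hp : (P.pp : ℤ) ∣ m) (hm : (P.pm : ℤ) ∣ m) (r s N : ℤ)
    (v : ℂ) : ModeVanishes P.period v sign₂ (expo₂ (s * P.pp) (r * P.pm) N) m := by
  have h1 := zpow_sub_inv_of_sq ((P.qX_sq_iff m).2 hp) r
  have h2 := zpow_sub_inv_of_sq ((P.qY_sq_iff m).2 hm) s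
  constructor
  · rw [amp_sign₂, qE_mul_pm, qE_mul_pp, h1, h2]; simp
  · rw [amp_sign₂_expo₂, qE_mul_pm, qE_mul_pp, h1, h2]; simp

/-- With constant weights only the X-factor of the amplitude occurs, so divisibility by p₊ alone is
enough. -/
theorem modeVanishes_plusBorder {m : ℤ} (hp : (P.pp : ℤ) ∣ m) (r N : ℤ) :
    ModeVanishes P.period 0 sign₁ (expo₁ (r * P.pm) N) m := by
  have h1 := zpow_sub_inv_of_sq ((P.qX_sq_iff m).2 hp) r
  exact ⟨by rw [amp_sign₁, qE_mul_pm, h1, mul_zero], zero_mul _⟩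

theorem modeVanishes_minusBorder {m : ℤ} (hm : (P.pm : ℤ) ∣ m) (s N : ℤ) :
    ModeVanishes P.period 0 sign₁ (expo₁ (s * P.pp) N) m := by
  have h1 := zpow_sub_inv_of_sq ((P.qY_sq_iff m).2 hm) s
  exact ⟨by rw [amp_sign₁, qE_mul_pp, h1, mul_zero], zero_mul _⟩

theorem halfLimit_eq (ε u v : ℂ) (c : ℤ) : halfLimit P.alpha P.period ε u v c =
    P.qE ε c * (u / (1 - (P.qZ ε ^ 2)⁻¹) +
      v * ((P.qZ ε ^ 2)⁻¹ / (1 - (P.qZ ε ^ 2)⁻¹) ^ 2)) := by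
  have h : Complex.exp (-(2 * Real.pi * ε * P.period / P.alpha)) = (P.qZ ε ^ 2)⁻¹ := by
    rw [qZ, ← Complex.exp_nat_mul, ← Complex.exp_neg, period]
    congr 1; push_cast; ring
  rw [halfLimit, h]; rfl

/-! ### Quantum dimensions from asymptotics -/

/-- The value of the character with parameter `e` at a simple module. -/
def moduleVal (e : ℂ) : P.SimpleModule → ℂ
  | .verlinde x => P.labelVal e x
  | .minimal _ => 0

/-- If, after a common rescaling, the characters tend to the values of a character of the Verlinde
ring times a common nonzero constant, then these values are the quantum dimensions. -/
theorem hasQdim_of_scale (ε e g : ℂ) (t : ℝ → ℂ) (hg : g ≠ 0)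
    (ht : ∀ y : ℝ, 0 < y → t y ≠ 0)
    (hmin : ∀ r s, Tendsto (fun y => t y * P.minimalNumer r s y) (𝓝[>] 0) (𝓝 0))
    (hfock : ∀ l, Tendsto (fun y : ℝ => t y * (P.fockCh l ε (Complex.I * y) *
      ModularForm.eta (Complex.I * y))) (𝓝[>] 0) (𝓝 (P.fockVal e l * g)))
    (hinner : ∀ (r s : ℕ) (n : ℤ), r < P.pp → s < P.pm → Tendsto (fun y => t y *
      halfSum P.alpha P.period ε 1 1 sign₂
        (expo₂ (s * P.pp) (r * P.pm) ((n - 2) * (P.pp * P.pm))) y) (𝓝[>] 0)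
      (𝓝 (P.atypicalVal e r s n * g)))
    (hplus : ∀ (r : ℕ) (n : ℤ), r < P.pp → Tendsto (fun y => t y *
      halfSum P.alpha P.period ε 1 0 sign₁ (expo₁ (r * P.pm) ((n - 1) * (P.pp * P.pm))) y)
      (𝓝[>] 0) (𝓝 (P.atypicalVal e r P.pm n * g)))
    (hminus : ∀ (s : ℕ) (n : ℤ), s < P.pm → Tendsto (fun y => t y *
      halfSum P.alpha P.period ε 1 0 sign₁ (expo₁ (s * P.pp) ((n - 1) * (P.pp * P.pm))) y)
      (𝓝[>] 0) (𝓝 (P.atypicalVal e P.pp s n * g)))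
    (M : P.SimpleModule) : P.HasQdim M ε (P.moduleVal e M) := by
  have hatyp : ∀ (r s : ℕ) (n : ℤ), r ≤ P.pp → s ≤ P.pm → Tendsto (fun y : ℝ => t y *
      (P.atypicalCh r s n ε (Complex.I * y) * ModularForm.eta (Complex.I * y))) (𝓝[>] 0)
      (𝓝 (P.atypicalVal e r s n * g)) := by
    intro r s n hr hs
    unfold atypicalCh
    split_ifs with h1 h2 h2
    -- The multiples of Virasoro characters in ch[I_{r,s;n}] are negligible on the scale t.
    · have h3 : Tendsto (fun y => t y * (if 0 ≤ n then (n : ℂ) *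
          (if Even n then P.minimalNumer r s y else -P.minimalNumer r (P.pm - s) y) else 0))
          (𝓝[>] 0) (𝓝 0) := by
        split_ifs
        · have := (hmin r s).const_mul (n : ℂ)
          rw [mul_zero] at this
          exact this.congr fun y => by ring
        · have := (hmin r (P.pm - s)).const_mul (-n : ℂ)
          rw [mul_zero] at this
          exact this.congr fun y => by ring
        · simp
      have h4 := h3.add (hinner r s n h1 h2)
      rw [zero_add] at h4
      refine h4.congr' ?_
      filter_upwards [self_mem_nhdsWithin] with y hy
      rw [innerCh_eq P _ _ _ _ hy, mul_add]
    · obtain rfl : s = P.pm := by omega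
      refine (hplus r n h1).congr' ?_
      filter_upwards [self_mem_nhdsWithin] with y hy
      rw [plusBorderCh_eq P _ _ _ hy]
    · obtain rfl : r = P.pp := by omega
      refine (hminus s n h2).congr' ?_
      filter_upwards [self_mem_nhdsWithin] with y hy
      rw [minusBorderCh_eq P _ _ _ hy]
    · obtain rfl : r = P.pp := by omega
      obtain rfl : s = P.pm := by omega
      -- For (r, s) = (p₊, p₋) the powers X^{-p₊} = Z⁻¹ and Y^{p₋} = Z cancel, so the Fock value is
      -- the atypical value.
      have h := hfock (P.weight P.pp P.pm n)
      rw [fockVal_weight, zpow_neg, P.qX_pow, P.qY_pow, mul_inv_cancel₀ (P.qZ_ne_zero e),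
        one_mul] at h
      exact h
  have hM : Tendsto (fun y => t y * P.numer M ε y) (𝓝[>] 0) (𝓝 (P.moduleVal e M * g)) := by
    rcases M with (⟨l, hl⟩ | ⟨r, s, hr, hs, n⟩) | x
    · exact hfock l
    · exact hatyp r s n hr.2 hs.2
    · rw [moduleVal, zero_mul]; exact hmin x.r x.s
  -- The vacuum has label value 1, so it is asymptotic to g on the scale t; this is where g ≠ 0
  -- enters.
  have hV := (hmin 1 1).add (hatyp 1 1 0 (by have := P.two_le_pp; omega)
    (by have := P.two_le_pm; omega))
  have h1 : P.atypicalVal e 1 1 0 = 1 := by simp [atypicalVal, qInt_one]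
  rw [h1, one_mul, zero_add] at hV
  have h := hM.div hV hg
  rw [mul_div_cancel_right₀ _ hg] at h
  refine h.congr' ?_
  filter_upwards [self_mem_nhdsWithin] with y hy
  have hη := eta_ne_zero' hy
  have ht' := ht y hy
  rw [Pi.div_apply, ← mul_add, minimalNumer, ← add_mul, numer, mul_div_mul_left _ _ ht',
    mul_div_mul_right _ _ hη]
  rfl

end Params

end Singlet

/-! ### Quantum dimensions governed by the constant terms -/

namespace Singlet

namespace Params

variable (P : Params)

theorem norm_qZ (e : ℂ) : ‖P.qZ e‖ = Real.exp (Real.pi * P.alpha * e.re) := by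
  rw [← exp_alpha, Complex.norm_exp]
  congr 1
  have : (Real.pi * e * P.alpha : ℂ) = ((Real.pi * P.alpha : ℝ) : ℂ) * e := by push_cast; ring
  rw [this, Complex.re_ofReal_mul]

theorem qZ_sq_ne_one {e : ℂ} (he : e.re ≠ 0) : P.qZ e ^ 2 ≠ 1 := by
  intro h
  have h1 := congrArg norm h
  rw [norm_pow, norm_qZ, norm_one, ← Real.exp_nat_mul, Real.exp_eq_one_iff] at h1
  have := P.alpha_pos.ne'
  have := Real.pi_ne_zero
  simp_all

theorem qX_sq_ne_one {e : ℂ} (he : e.re ≠ 0) : P.qX e ^ 2 ≠ 1 := by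
  intro h
  refine P.qZ_sq_ne_one he ?_
  rw [← qX_pow, zpow_natCast, ← pow_mul, mul_comm, pow_mul, h, one_pow]

theorem qY_sq_ne_one {e : ℂ} (he : e.re ≠ 0) : P.qY e ^ 2 ≠ 1 := by
  intro h
  refine P.qZ_sq_ne_one he ?_
  rw [← qY_pow, zpow_natCast, ← pow_mul, mul_comm, pow_mul, h, one_pow]

theorem qX_mul_qInt (e : ℂ) (r : ℕ) :
    (P.qX e - (P.qX e)⁻¹) * qInt r (P.qX e) = P.qX e ^ (r : ℤ) - (P.qX e ^ (r : ℤ))⁻¹ := by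
  rw [sub_inv_mul_qInt r (P.qX_ne_zero e), zpow_neg]

theorem qY_mul_qInt (e : ℂ) (s : ℕ) :
    (P.qY e - (P.qY e)⁻¹) * qInt s (P.qY e) = P.qY e ^ (s : ℤ) - (P.qY e ^ (s : ℤ))⁻¹ := by
  rw [sub_inv_mul_qInt s (P.qY_ne_zero e), zpow_neg]

theorem sum_halfLimit {ι : Type*} [Fintype ι] (ε u v : ℂ) (σ : ι → ℂ) (c : ι → ℤ) :
    ∑ i, σ i * halfLimit P.alpha P.period ε u v (c i) = (∑ i, σ i * P.qE ε (c i)) *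
      (u / (1 - (P.qZ ε ^ 2)⁻¹) + v * ((P.qZ ε ^ 2)⁻¹ / (1 - (P.qZ ε ^ 2)⁻¹) ^ 2)) := by
  rw [Finset.sum_mul]
  exact Finset.sum_congr rfl fun i _ => by rw [halfLimit_eq, mul_assoc]

/-- Quantum dimensions where the characters are governed by their constant terms. -/
theorem hasQdim_continuous {ε : ℂ} (hε : ε.re ≠ 0)
    (h0 : ε.re < 0 → ∀ m, 0 ≤ modeRate P.alpha ε m → (P.pp : ℤ) ∣ m ∧ (P.pm : ℤ) ∣ m)
    (M : P.SimpleModule) : P.HasQdim M ε (P.moduleVal ε M) := by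
  have ha := P.alpha_pos
  have hL := P.alpha_mul_self
  have hX0 := P.qX_ne_zero ε
  have hY0 := P.qY_ne_zero ε
  have hZ0 := P.qZ_ne_zero ε
  have hX : P.qX ε - (P.qX ε)⁻¹ ≠ 0 :=
    fun h => P.qX_sq_ne_one hε ((sub_inv_eq_zero_iff hX0).1 h)
  have hY : P.qY ε - (P.qY ε)⁻¹ ≠ 0 :=
    fun h => P.qY_sq_ne_one hε ((sub_inv_eq_zero_iff hY0).1 h)
  have hZ : P.qZ ε - (P.qZ ε)⁻¹ ≠ 0 :=
    fun h => P.qZ_sq_ne_one hε ((sub_inv_eq_zero_iff hZ0).1 h)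
  have hw : 1 - (P.qZ ε ^ 2)⁻¹ = (P.qZ ε - (P.qZ ε)⁻¹) / P.qZ ε := by field_simp
  have hXp := P.qX_mul_qInt ε P.pp
  have hYp := P.qY_mul_qInt ε P.pm
  rw [qX_pow] at hXp
  rw [qY_pow] at hYp
  -- The constant is the limit of the vacuum: for weights k + 1 and ratio w = Z⁻² the series sums to
  -- 1/(1 - w)², and with the prefactor Z⁻² this is 1/(Z - Z⁻¹)².
  refine P.hasQdim_of_scale ε ε ((P.qX ε - (P.qX ε)⁻¹) * (P.qY ε - (P.qY ε)⁻¹) /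
    (P.qZ ε - (P.qZ ε)⁻¹) ^ 2) (fun _ => 1) (by positivity) (fun _ _ => one_ne_zero)
    (fun r s => by simpa using P.tendsto_minimalNumer r s) (fun l => ?_) (fun r s n hr hs => ?_)
    (fun r n hr => ?_) (fun s n hs => ?_) M
  · simp only [one_mul]
    convert P.tendsto_fockCh l ε using 2
    rw [fockVal]
    generalize Complex.exp (2 * Real.pi * ε * (l - P.alphaZero / 2)) = x
    rw [mul_assoc, mul_div_assoc', mul_mul_mul_comm, mul_comm (qInt _ _), hXp,
      mul_comm (qInt _ _), hYp, ← pow_two, div_self (pow_ne_zero 2 hZ), mul_one]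
  · simp only [one_mul]
    have h := tendsto_halfSum_continuous ha hL hε 1 1 sign₂
      (expo₂ (s * P.pp) (r * P.pm) ((n - 2) * (P.pp * P.pm)))
      fun h m hm => P.modeVanishes_inner (h0 h m hm).1 (h0 h m hm).2 r s _ 1
    convert h using 2
    rw [sum_halfLimit, sum_sign₂_qE, qE_mul_pm, qE_mul_pp, qE_mul_pp_pm, ← qX_mul_qInt,
      ← qY_mul_qInt, hw, atypicalVal, zpow_sub₀ hZ0, zpow_ofNat]
    generalize qInt r (P.qX ε) = x
    generalize qInt s (P.qY ε) = y
    generalize P.qX ε - (P.qX ε)⁻¹ = X at *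
    generalize P.qY ε - (P.qY ε)⁻¹ = Y at *
    have e : P.qZ ε * (P.qZ ε - (P.qZ ε)⁻¹) = P.qZ ε ^ 2 - 1 := by field_simp
    generalize hd : P.qZ ε - (P.qZ ε)⁻¹ = d at *
    field_simp
    linear_combination (-(x * y)) * e
  · simp only [one_mul]
    have h := tendsto_halfSum_continuous ha hL hε 1 0 sign₁
      (expo₁ (r * P.pm) ((n - 1) * (P.pp * P.pm)))
      fun h m hm => P.modeVanishes_plusBorder (h0 h m hm).1 r _
    convert h using 2
    rw [sum_halfLimit, sum_sign₁_qE, qE_mul_pm, qE_mul_pp_pm, ← qX_mul_qInt, hw,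
      atypicalVal, zpow_sub₀ hZ0, zpow_one]
    rw [show P.qZ ε ^ n * (qInt r (P.qX ε) * qInt P.pm (P.qY ε)) *
      ((P.qX ε - (P.qX ε)⁻¹) * (P.qY ε - (P.qY ε)⁻¹) / (P.qZ ε - (P.qZ ε)⁻¹) ^ 2) =
      P.qZ ε ^ n * qInt r (P.qX ε) * (P.qX ε - (P.qX ε)⁻¹) *
      ((P.qY ε - (P.qY ε)⁻¹) * qInt P.pm (P.qY ε)) / (P.qZ ε - (P.qZ ε)⁻¹) ^ 2 by ring, hYp]
    generalize P.qZ ε - (P.qZ ε)⁻¹ = d at *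
    generalize P.qX ε - (P.qX ε)⁻¹ = X at *
    field_simp
    ring
  · simp only [one_mul]
    have h := tendsto_halfSum_continuous ha hL hε 1 0 sign₁
      (expo₁ (s * P.pp) ((n - 1) * (P.pp * P.pm)))
      fun h m hm => P.modeVanishes_minusBorder (h0 h m hm).2 s _
    convert h using 2
    rw [sum_halfLimit, sum_sign₁_qE, qE_mul_pp, qE_mul_pp_pm, ← qY_mul_qInt, hw,
      atypicalVal, zpow_sub₀ hZ0, zpow_one]
    rw [show P.qZ ε ^ n * (qInt P.pp (P.qX ε) * qInt s (P.qY ε)) *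
      ((P.qX ε - (P.qX ε)⁻¹) * (P.qY ε - (P.qY ε)⁻¹) / (P.qZ ε - (P.qZ ε)⁻¹) ^ 2) =
      P.qZ ε ^ n * qInt s (P.qY ε) * (P.qY ε - (P.qY ε)⁻¹) *
      ((P.qX ε - (P.qX ε)⁻¹) * qInt P.pp (P.qX ε)) / (P.qZ ε - (P.qZ ε)⁻¹) ^ 2 by ring, hXp]
    generalize P.qZ ε - (P.qZ ε)⁻¹ = d at *
    generalize P.qY ε - (P.qY ε)⁻¹ = Y at *
    field_simp
    ring

end Params

end Singlet

/-! ### Quantum dimensions governed by a dominating mode -/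

namespace Singlet

variable {a : ℝ} {L : ℕ} {ι : Type*} [Fintype ι]

theorem tendsto_ofReal_zero : Tendsto (fun y : ℝ => (y : ℂ)) (𝓝[>] 0) (𝓝 0) := by
  have : Continuous fun y : ℝ => (y : ℂ) := Complex.continuous_ofReal
  simpa using (this.tendsto 0).mono_left nhdsWithin_le_nhds

/-- The scale on which the mode `M` has size `1`. -/
def modeScale (a : ℝ) (ε : ℂ) (M : ℤ) (y : ℝ) : ℂ := a * √y * (modeExp a ε M y)⁻¹

theorem modeScale_ne_zero (ha : 0 < a) (ε : ℂ) (M : ℤ) {y : ℝ} (hy : 0 < y) :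
    modeScale a ε M y ≠ 0 := by
  have h1 : (a : ℂ) ≠ 0 := by exact_mod_cast ha.ne'
  have h2 : ((√y : ℝ) : ℂ) ≠ 0 := by exact_mod_cast (Real.sqrt_pos.2 hy).ne'
  exact mul_ne_zero (mul_ne_zero h1 h2) (inv_ne_zero (modeExp_ne_zero a ε M y))

/-- The extra factor y selects the 1/y part of the mode coefficient, which comes from the linear
weights. -/
theorem tendsto_mul_modeScale_mul (ha : 0 < a) (hL : a * a = L) {ε : ℂ} (hε : ε.re < 0) (u v : ℂ)
    (σ : ι → ℂ) (c : ι → ℤ) {M : ℤ} (hM : 0 < modeRate a ε M)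
    (h0 : ∀ m, m ≠ M → modeRate a ε M ≤ modeRate a ε m → ModeVanishes L v σ c m) :
    Tendsto (fun y : ℝ => y * modeScale a ε M y * halfSum a L ε u v σ c y) (𝓝[>] 0)
      (𝓝 (-(v * (ε - Complex.I * M / a) / a) * amp L σ c M)) := by
  have h := tendsto_ofReal_zero.mul (tendsto_halfSum_mode ha hL hε u v σ c hM h0)
  have h1 := (tendsto_ofReal_zero.mul_const
    (u * amp L σ c M + v * amp L (fun i => σ i * c i) c M / L)).add_const
      (-(v * (ε - Complex.I * M / a) / a) * amp L σ c M)
  have h2 := h.add h1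
  rw [zero_mul, zero_mul, zero_add, zero_add] at h2
  refine h2.congr' ?_
  filter_upwards [self_mem_nhdsWithin] with y hy
  have hy' : (y : ℂ) ≠ 0 := by exact_mod_cast (ne_of_gt hy)
  rw [modeCoef, modeScale]
  field_simp
  ring

/-- If the amplitude vanishes or the weights are constant, the 1/y part is absent and the
coefficient is independent of y. -/
theorem tendsto_modeScale_mul (ha : 0 < a) (hL : a * a = L) {ε : ℂ} (hε : ε.re < 0) (u v : ℂ)
    (σ : ι → ℂ) (c : ι → ℤ) {M : ℤ} (hM : 0 < modeRate a ε M)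
    (h0 : ∀ m, m ≠ M → modeRate a ε M ≤ modeRate a ε m → ModeVanishes L v σ c m)
    (hv : v * amp L σ c M = 0) :
    Tendsto (fun y : ℝ => modeScale a ε M y * halfSum a L ε u v σ c y) (𝓝[>] 0)
      (𝓝 (u * amp L σ c M + v * amp L (fun i => σ i * c i) c M / L)) := by
  have h := (tendsto_halfSum_mode ha hL hε u v σ c hM h0).add_const
    (u * amp L σ c M + v * amp L (fun i => σ i * c i) c M / L)
  rw [zero_add] at h
  refine h.congr' ?_
  filter_upwards [self_mem_nhdsWithin] with y hy
  rw [modeCoef, modeScale]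
  linear_combination ((ε - Complex.I * M / a) / a / y) * hv

namespace Params

variable (P : Params)

/-- X is a 2p₊-th root of unity, and it is not ±1 because p₊ does not divide M. -/
theorem qInt_pp_modeParam {M : ℤ} (hM : ¬ (P.pp : ℤ) ∣ M) :
    qInt P.pp (P.qX (P.modeParam M)) = 0 := by
  refine qInt_self_eq_zero (P.qX_ne_zero _)
    (sub_inv_ne_zero (P.qX_ne_zero _) fun h => hM ((P.qX_sq_iff M).1 h)) ?_
  have h := P.qX_pow (P.modeParam M)
  rw [zpow_natCast] at h
  rw [mul_comm, pow_mul, h, qZ_modeParam_sq]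

theorem qInt_pm_modeParam {M : ℤ} (hM : ¬ (P.pm : ℤ) ∣ M) :
    qInt P.pm (P.qY (P.modeParam M)) = 0 := by
  refine qInt_self_eq_zero (P.qY_ne_zero _)
    (sub_inv_ne_zero (P.qY_ne_zero _) fun h => hM ((P.qY_sq_iff M).1 h)) ?_
  have h := P.qY_pow (P.modeParam M)
  rw [zpow_natCast] at h
  rw [mul_comm, pow_mul, h, qZ_modeParam_sq]

/-- The Fourier mode `M` dominates all modes that are not divisible by `p₊` and `p₋`. -/
structure Dominates (M : ℤ) (ε : ℂ) : Prop where
  re_neg : ε.re < 0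
  rate_pos : 0 < modeRate P.alpha ε M
  dvd_of_rate_le : ∀ m, m ≠ M → modeRate P.alpha ε M ≤ modeRate P.alpha ε m →
    (P.pp : ℤ) ∣ m ∧ (P.pm : ℤ) ∣ m

variable {P}

theorem Dominates.sub_ne_zero {M : ℤ} {ε : ℂ} (h : P.Dominates M ε) :
    ε - Complex.I * M / P.alpha ≠ 0 := by
  intro h0
  have h1 := congrArg Complex.re h0
  have e : (Complex.I * M / P.alpha : ℂ) = ((M / P.alpha : ℝ) : ℂ) * Complex.I := by
    push_cast; ring
  rw [e, Complex.sub_re, Complex.re_ofReal_mul, Complex.I_re, mul_zero, sub_zero] at h1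
  exact h.re_neg.ne h1

/-- Both factors of the amplitude at M are nonzero, so the linear weights make the inner characters
larger by 1/y than those on the border. Border and Fock modules therefore have limit 0, in
accordance with [p₊]_X = [p₋]_Y = 0. -/
theorem Dominates.hasQdim_generic {M : ℤ} {ε : ℂ} (h : P.Dominates M ε) (hp : ¬ (P.pp : ℤ) ∣ M)
    (hm : ¬ (P.pm : ℤ) ∣ M) (N : P.SimpleModule) :
    P.HasQdim N ε (P.moduleVal (P.modeParam M) N) := by
  have ha := P.alpha_pos
  have ha' : (P.alpha : ℂ) ≠ 0 := by exact_mod_cast ha.ne'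
  have hL := P.alpha_mul_self
  set e := P.modeParam M with he
  have hX : P.qX e - (P.qX e)⁻¹ ≠ 0 :=
    sub_inv_ne_zero (P.qX_ne_zero _) fun h => hp ((P.qX_sq_iff M).1 h)
  have hY : P.qY e - (P.qY e)⁻¹ ≠ 0 :=
    sub_inv_ne_zero (P.qY_ne_zero _) fun h => hm ((P.qY_sq_iff M).1 h)
  have hZ := P.qZ_ne_zero e
  have hp0 : qInt P.pp (P.qX e) = 0 := P.qInt_pp_modeParam hp
  have hm0 : qInt P.pm (P.qY e) = 0 := P.qInt_pm_modeParam hm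
  have hsub := h.sub_ne_zero
  have hscale : ∀ {f : ℝ → ℂ} {l : ℂ}, Tendsto f (𝓝[>] 0) (𝓝 l) →
      Tendsto (fun y : ℝ => y * modeScale P.alpha ε M y * f y) (𝓝[>] 0) (𝓝 0) := by
    intro f l hf
    have := tendsto_ofReal_zero.mul (tendsto_modeScale_mul_zero h.rate_pos hf)
    rw [zero_mul] at this
    exact this.congr fun y => by rw [modeScale]; ring
  -- The constant is the 1/y coefficient of the vacuum at M; it is nonzero since Re ε < 0 keeps ε
  -- off the imaginary axis.
  refine P.hasQdim_of_scale ε e (-((ε - Complex.I * M / P.alpha) / P.alpha) *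
    ((P.qZ e ^ 2)⁻¹ * ((P.qY e - (P.qY e)⁻¹) * (P.qX e - (P.qX e)⁻¹))))
    (fun y => y * modeScale P.alpha ε M y)
    (mul_ne_zero (neg_ne_zero.2 (div_ne_zero hsub ha'))
      (mul_ne_zero (inv_ne_zero (pow_ne_zero _ hZ)) (mul_ne_zero hY hX)))
    (fun y hy => mul_ne_zero (by exact_mod_cast hy.ne') (modeScale_ne_zero ha ε M hy))
    (fun r s => hscale (P.tendsto_minimalNumer r s)) (fun l => ?_) (fun r s n hr hs => ?_)
    (fun r n hr => ?_) (fun s n hs => ?_) N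
  · rw [fockVal, hp0, zero_mul, mul_zero, zero_mul]
    exact hscale (P.tendsto_fockCh l ε)
  · convert tendsto_mul_modeScale_mul ha hL h.re_neg 1 1 sign₂
      (expo₂ (s * P.pp) (r * P.pm) ((n - 2) * (P.pp * P.pm))) h.rate_pos
      (fun m hmM hle => P.modeVanishes_inner (h.dvd_of_rate_le m hmM hle).1
        (h.dvd_of_rate_le m hmM hle).2 r s _ 1) using 2
    rw [amp_sign₂, ← he, qE_mul_pm, qE_mul_pp, qE_mul_pp_pm, ← qX_mul_qInt, ← qY_mul_qInt,
      atypicalVal, zpow_sub₀ hZ, zpow_ofNat]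
    ring
  · convert tendsto_mul_modeScale_mul ha hL h.re_neg 1 0 sign₁
      (expo₁ (r * P.pm) ((n - 1) * (P.pp * P.pm))) h.rate_pos
      (fun m hmM hle => P.modeVanishes_plusBorder (h.dvd_of_rate_le m hmM hle).1 r _) using 2
    rw [atypicalVal, hm0]; ring
  · convert tendsto_mul_modeScale_mul ha hL h.re_neg 1 0 sign₁
      (expo₁ (s * P.pp) ((n - 1) * (P.pp * P.pm))) h.rate_pos
      (fun m hmM hle => P.modeVanishes_minusBorder (h.dvd_of_rate_le m hmM hle).2 s _) using 2
    rw [atypicalVal, hp0]; ring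

theorem Dominates.tendsto_scale_mul {M : ℤ} {ε : ℂ} (h : P.Dominates M ε) {f : ℝ → ℂ} {l : ℂ}
    (hf : Tendsto f (𝓝[>] 0) (𝓝 l)) :
    Tendsto (fun y : ℝ => modeScale P.alpha ε M y * f y) (𝓝[>] 0) (𝓝 0) :=
  tendsto_modeScale_mul_zero h.rate_pos hf

theorem add_inv_zpow_of_sq {X : ℂ} (hX : X ^ 2 = 1) (r : ℕ) :
    X ^ (r : ℤ) + (X ^ (r : ℤ))⁻¹ = 2 * X ^ r := by
  have := zpow_sub_inv_of_sq hX r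
  rw [zpow_natCast] at this ⊢
  linear_combination -this

/-- Now Y = ±1, so the plain inner amplitude vanishes and with it the 1/y part. The derivative of
the Y-factor remains and yields [s]_Y up to constants; it has the same order as the modules
I_{r,p₋;n}. The modules I_{p₊,s;n} lose their amplitude and Fock modules do not grow, matching
[p₊]_X = 0. -/
theorem Dominates.hasQdim_plus {M : ℤ} {ε : ℂ} (h : P.Dominates M ε) (hp : ¬ (P.pp : ℤ) ∣ M)
    (hm : (P.pm : ℤ) ∣ M) (N : P.SimpleModule) :
    P.HasQdim N ε (P.moduleVal (P.modeParam M) N) := by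
  have ha := P.alpha_pos
  have hL := P.alpha_mul_self
  have hpp := P.pp_ne_zero
  have hpm := P.pm_ne_zero
  set e := P.modeParam M with he
  have hX : P.qX e - (P.qX e)⁻¹ ≠ 0 :=
    sub_inv_ne_zero (P.qX_ne_zero _) fun h => hp ((P.qX_sq_iff M).1 h)
  have hY : P.qY e ^ 2 = 1 := (P.qY_sq_iff M).2 hm
  have hY0 := P.qY_ne_zero e
  have hZ := P.qZ_ne_zero e
  have hp0 : qInt P.pp (P.qX e) = 0 := P.qInt_pp_modeParam hp
  have hper : (P.period : ℂ) = 2 * P.pp * P.pm := by rw [period]; push_cast; ring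
  -- The denominator p₋ comes from 2s p₊ divided by the period 2p₊p₋.
  refine P.hasQdim_of_scale ε e ((P.qZ e ^ 2)⁻¹ * (P.qY e * (P.qX e - (P.qX e)⁻¹)) / P.pm)
    (modeScale P.alpha ε M) (by positivity)
    (fun y hy => modeScale_ne_zero ha ε M hy)
    (fun r s => h.tendsto_scale_mul (P.tendsto_minimalNumer r s)) (fun l => ?_)
    (fun r s n hr hs => ?_) (fun r n hr => ?_) (fun s n hs => ?_) N
  · rw [fockVal, hp0, zero_mul, mul_zero, zero_mul]
    exact h.tendsto_scale_mul (P.tendsto_fockCh l ε)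
  · have h1 := zpow_sub_inv_of_sq hY s
    have hamp : amp P.period sign₂
        (expo₂ (s * P.pp) (r * P.pm) ((n - 2) * (P.pp * P.pm))) M = 0 := by
      rw [amp_sign₂, ← he, qE_mul_pp, h1]; ring
    convert tendsto_modeScale_mul ha hL h.re_neg 1 1 sign₂
      (expo₂ (s * P.pp) (r * P.pm) ((n - 2) * (P.pp * P.pm))) h.rate_pos
      (fun m hmM hle => P.modeVanishes_inner (h.dvd_of_rate_le m hmM hle).1
        (h.dvd_of_rate_le m hmM hle).2 r s _ 1) (by rw [hamp, mul_zero]) using 2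
    rw [hamp, amp_sign₂_expo₂, ← he, qE_mul_pm, qE_mul_pp, qE_mul_pp_pm, h1,
      add_inv_zpow_of_sq hY, ← qX_mul_qInt, atypicalVal, zpow_sub₀ hZ, zpow_ofNat, hper]
    have h2 := qInt_of_sq_eq_one s hY
    push_cast
    linear_combination P.qZ e ^ n * (P.qZ e ^ 2)⁻¹ * (P.qX e - (P.qX e)⁻¹) *
      qInt r (P.qX e) * (P.pm : ℂ)⁻¹ * (h2 - s * P.qY e ^ s * mul_inv_cancel₀ hpp)
  · convert tendsto_modeScale_mul ha hL h.re_neg 1 0 sign₁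
      (expo₁ (r * P.pm) ((n - 1) * (P.pp * P.pm))) h.rate_pos
      (fun m hmM hle => P.modeVanishes_plusBorder (h.dvd_of_rate_le m hmM hle).1 r _)
      (zero_mul _) using 2
    have h2 := qInt_of_sq_eq_one P.pm hY
    have h3 := P.qY_pow e
    rw [zpow_natCast] at h3
    rw [h3] at h2
    rw [amp_sign₁, ← he, qE_mul_pm, qE_mul_pp_pm, ← qX_mul_qInt, atypicalVal, zpow_sub₀ hZ,
      zpow_one]
    linear_combination P.qZ e ^ n * (P.qX e - (P.qX e)⁻¹) * qInt r (P.qX e) *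
      ((P.qZ e ^ 2)⁻¹ * (P.pm : ℂ)⁻¹ * h2 + (P.qZ e)⁻¹ * (P.qZ e * (P.qZ e)⁻¹) *
        mul_inv_cancel₀ hpm + (P.qZ e)⁻¹ * mul_inv_cancel₀ hZ)
  · have h1 := zpow_sub_inv_of_sq hY s
    convert tendsto_modeScale_mul ha hL h.re_neg 1 0 sign₁
      (expo₁ (s * P.pp) ((n - 1) * (P.pp * P.pm))) h.rate_pos
      (fun m hmM hle => P.modeVanishes_minusBorder (h.dvd_of_rate_le m hmM hle).2 s _)
      (zero_mul _) using 2
    rw [amp_sign₁, ← he, qE_mul_pp, h1, atypicalVal, hp0]; ring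

/-- The mirror image of `Dominates.hasQdim_plus`: now X = ±1, the X-factor is differentiated, and p₊
appears as the denominator. -/
theorem Dominates.hasQdim_minus {M : ℤ} {ε : ℂ} (h : P.Dominates M ε) (hp : (P.pp : ℤ) ∣ M)
    (hm : ¬ (P.pm : ℤ) ∣ M) (N : P.SimpleModule) :
    P.HasQdim N ε (P.moduleVal (P.modeParam M) N) := by
  have ha := P.alpha_pos
  have hL := P.alpha_mul_self
  have hpp := P.pp_ne_zero
  have hpm := P.pm_ne_zero
  set e := P.modeParam M with he
  have hY : P.qY e - (P.qY e)⁻¹ ≠ 0 :=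
    sub_inv_ne_zero (P.qY_ne_zero _) fun h => hm ((P.qY_sq_iff M).1 h)
  have hX : P.qX e ^ 2 = 1 := (P.qX_sq_iff M).2 hp
  have hX0 := P.qX_ne_zero e
  have hZ := P.qZ_ne_zero e
  have hm0 : qInt P.pm (P.qY e) = 0 := P.qInt_pm_modeParam hm
  have hper : (P.period : ℂ) = 2 * P.pp * P.pm := by rw [period]; push_cast; ring
  refine P.hasQdim_of_scale ε e ((P.qZ e ^ 2)⁻¹ * (P.qX e * (P.qY e - (P.qY e)⁻¹)) / P.pp)
    (modeScale P.alpha ε M) (by positivity)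
    (fun y hy => modeScale_ne_zero ha ε M hy)
    (fun r s => h.tendsto_scale_mul (P.tendsto_minimalNumer r s)) (fun l => ?_)
    (fun r s n hr hs => ?_) (fun r n hr => ?_) (fun s n hs => ?_) N
  · rw [fockVal, hm0, mul_zero, mul_zero, zero_mul]
    exact h.tendsto_scale_mul (P.tendsto_fockCh l ε)
  · have h1 := zpow_sub_inv_of_sq hX r
    have hamp : amp P.period sign₂
        (expo₂ (s * P.pp) (r * P.pm) ((n - 2) * (P.pp * P.pm))) M = 0 := by
      rw [amp_sign₂, ← he, qE_mul_pm, h1]; ring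
    convert tendsto_modeScale_mul ha hL h.re_neg 1 1 sign₂
      (expo₂ (s * P.pp) (r * P.pm) ((n - 2) * (P.pp * P.pm))) h.rate_pos
      (fun m hmM hle => P.modeVanishes_inner (h.dvd_of_rate_le m hmM hle).1
        (h.dvd_of_rate_le m hmM hle).2 r s _ 1) (by rw [hamp, mul_zero]) using 2
    rw [hamp, amp_sign₂_expo₂, ← he, qE_mul_pm, qE_mul_pp, qE_mul_pp_pm, h1,
      add_inv_zpow_of_sq hX, ← qY_mul_qInt, atypicalVal, zpow_sub₀ hZ, zpow_ofNat, hper]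
    have h2 := qInt_of_sq_eq_one r hX
    push_cast
    linear_combination P.qZ e ^ n * (P.qZ e ^ 2)⁻¹ * (P.qY e - (P.qY e)⁻¹) *
      qInt s (P.qY e) * (P.pp : ℂ)⁻¹ * (h2 - r * P.qX e ^ r * mul_inv_cancel₀ hpm)
  · have h1 := zpow_sub_inv_of_sq hX r
    convert tendsto_modeScale_mul ha hL h.re_neg 1 0 sign₁
      (expo₁ (r * P.pm) ((n - 1) * (P.pp * P.pm))) h.rate_pos
      (fun m hmM hle => P.modeVanishes_plusBorder (h.dvd_of_rate_le m hmM hle).1 r _)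
      (zero_mul _) using 2
    rw [amp_sign₁, ← he, qE_mul_pm, h1, atypicalVal, hm0]; ring
  · convert tendsto_modeScale_mul ha hL h.re_neg 1 0 sign₁
      (expo₁ (s * P.pp) ((n - 1) * (P.pp * P.pm))) h.rate_pos
      (fun m hmM hle => P.modeVanishes_minusBorder (h.dvd_of_rate_le m hmM hle).2 s _)
      (zero_mul _) using 2
    have h2 := qInt_of_sq_eq_one P.pp hX
    have h3 := P.qX_pow e
    rw [zpow_natCast] at h3
    rw [h3] at h2
    rw [amp_sign₁, ← he, qE_mul_pp, qE_mul_pp_pm, ← qY_mul_qInt, atypicalVal, zpow_sub₀ hZ,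
      zpow_one]
    linear_combination P.qZ e ^ n * (P.qY e - (P.qY e)⁻¹) * qInt s (P.qY e) *
      ((P.qZ e ^ 2)⁻¹ * (P.pp : ℂ)⁻¹ * h2 + (P.qZ e)⁻¹ * (P.qZ e * (P.qZ e)⁻¹) *
        mul_inv_cancel₀ hpp + (P.qZ e)⁻¹ * mul_inv_cancel₀ hZ)

end Params

end Singlet

namespace Singlet

namespace Params

variable (P : Params)

/-! ### The regions and their dominating modes -/

theorem mul_dvd_iff (m : ℤ) :
    ((P.pp * P.pm : ℕ) : ℤ) ∣ m ↔ (P.pp : ℤ) ∣ m ∧ (P.pm : ℤ) ∣ m := by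
  push_cast
  constructor
  · exact fun h => ⟨(Dvd.intro _ rfl).trans h, (Dvd.intro_left _ rfl).trans h⟩
  · exact fun h => IsCoprime.mul_dvd (Nat.isCoprime_iff_coprime.2 P.coprime) h.1 h.2

theorem pp_not_dvd_one : ¬ (P.pp : ℤ) ∣ 1 := by
  have := P.two_le_pp
  intro h
  have := Int.le_of_dvd one_pos h
  omega

theorem pm_not_dvd_one : ¬ (P.pm : ℤ) ∣ 1 := by
  have := P.two_le_pm
  intro h
  have := Int.le_of_dvd one_pos h
  omega

theorem wall_set_bddBelow (ε : ℂ) : BddBelow {x : ℝ | ∃ m : ℤ,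
    ¬ ((P.pp * P.pm : ℕ) : ℤ) ∣ m ∧ x = |m / P.alpha - ε.im|} :=
  ⟨0, by rintro _ ⟨m, -, rfl⟩; exact abs_nonneg _⟩

/-- A mode of nonnegative rate satisfies |m/α - Im ε| ≤ |Re ε|. If it were not divisible by p₊p₋,
this would place a point with Re ε < 0 on or beyond the wall. -/
theorem hasQdim_of_mem_continuousRegion {ε : ℂ} (h : ε ∈ P.continuousRegion)
    (M : P.SimpleModule) : P.HasQdim M ε (P.moduleVal ε M) := by
  refine P.hasQdim_continuous h.2 (fun hneg m hm => ?_) M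
  by_contra hc
  have h1 : sInf {x : ℝ | ∃ m : ℤ, ¬ ((P.pp * P.pm : ℕ) : ℤ) ∣ m ∧
      x = |m / P.alpha - ε.im|} ≤ |m / P.alpha - ε.im| :=
    csInf_le (P.wall_set_bddBelow ε) ⟨m, fun hd => hc ((P.mul_dvd_iff m).1 hd), rfl⟩
  have h2 : -sInf {x : ℝ | ∃ m : ℤ, ¬ ((P.pp * P.pm : ℕ) : ℤ) ∣ m ∧
      x = |m / P.alpha - ε.im|} < ε.re := h.1
  have h3 : -ε.re < |m / P.alpha - ε.im| := by linarith
  have h4 : (-ε.re) ^ 2 < (m / P.alpha - ε.im) ^ 2 := by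
    rw [← sq_abs (m / P.alpha - ε.im)]
    exact pow_lt_pow_left₀ h3 (by linarith) two_ne_zero
  rw [modeRate] at hm
  nlinarith

variable {P}

/-- The infimum defining the wall is attained at the closest admissible mode M, so lying beyond the
wall means that M grows. For fixed ε a larger rate means a smaller distance, so only excluded modes
can compete with M. -/
theorem dominates_of_closest {ε : ℂ} (hε : ε.re < P.wall ε) {M : ℤ}
    (hM : ¬ ((P.pp : ℤ) ∣ M ∧ (P.pm : ℤ) ∣ M))
    (hcl : ∀ n : ℤ, n ≠ M → ¬ ((P.pp : ℤ) ∣ n ∧ (P.pm : ℤ) ∣ n) →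
      |M - P.alpha * ε.im| < |n - P.alpha * ε.im|) : P.Dominates M ε := by
  have ha := P.alpha_pos
  have hdist : ∀ n : ℤ, |n / P.alpha - ε.im| = |n - P.alpha * ε.im| / P.alpha := by
    intro n
    rw [← abs_of_pos ha, ← abs_div, abs_of_pos ha]
    congr 1
    field_simp
  have hle : ∀ n : ℤ, ¬ ((P.pp : ℤ) ∣ n ∧ (P.pm : ℤ) ∣ n) →
      |M / P.alpha - ε.im| ≤ |n / P.alpha - ε.im| := by
    intro n hn
    by_cases hnM : n = M
    · rw [hnM]
    · rw [hdist, hdist]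
      have := (hcl n hnM hn).le
      gcongr
  have hinf : |M / P.alpha - ε.im| ≤ sInf {x : ℝ | ∃ m : ℤ,
      ¬ ((P.pp * P.pm : ℕ) : ℤ) ∣ m ∧ x = |m / P.alpha - ε.im|} := by
    refine le_csInf ⟨_, M, fun hd => hM ((P.mul_dvd_iff M).1 hd), rfl⟩ ?_
    rintro _ ⟨m, hm, rfl⟩
    exact hle m fun hd => hm ((P.mul_dvd_iff m).2 hd)
  have h1 : |M / P.alpha - ε.im| < -ε.re := by
    have : ε.re < -sInf {x : ℝ | ∃ m : ℤ,
      ¬ ((P.pp * P.pm : ℕ) : ℤ) ∣ m ∧ x = |m / P.alpha - ε.im|} := hε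
    linarith
  have h0 := abs_nonneg (M / P.alpha - ε.im)
  refine ⟨by linarith, ?_, fun m hmM hrate => ?_⟩
  · have h4 : (M / P.alpha - ε.im) ^ 2 < (-ε.re) ^ 2 := by
      rw [← sq_abs (M / P.alpha - ε.im)]
      exact pow_lt_pow_left₀ h1 h0 two_ne_zero
    rw [modeRate]
    nlinarith
  · by_contra hc
    have h2 := hcl m hmM hc
    have h3 : |M / P.alpha - ε.im| < |m / P.alpha - ε.im| := by
      rw [hdist, hdist]; gcongr
    have h4 : (M / P.alpha - ε.im) ^ 2 < (m / P.alpha - ε.im) ^ 2 := by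
      rw [← sq_abs (M / P.alpha - ε.im), ← sq_abs (m / P.alpha - ε.im)]
      exact pow_lt_pow_left₀ h3 h0 two_ne_zero
    rw [modeRate, modeRate] at hrate
    nlinarith

theorem dominates_of_abs_lt {ε : ℂ} (hε : ε.re < P.wall ε) {M : ℤ}
    (hM : ¬ ((P.pp : ℤ) ∣ M ∧ (P.pm : ℤ) ∣ M)) (h : |M - P.alpha * ε.im| < 1 / 2) :
    P.Dominates M ε := by
  refine dominates_of_closest hε hM fun n hn _ => ?_
  have h1 : (1 : ℝ) ≤ |(n : ℝ) - M| := by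
    have : 1 ≤ |n - M| := Int.one_le_abs (sub_ne_zero.2 hn)
    exact_mod_cast this
  have h2 : |(n : ℝ) - M| ≤ |n - P.alpha * ε.im| + |M - P.alpha * ε.im| := by
    rw [abs_sub_comm (M : ℝ)]
    have := abs_add_le ((n : ℝ) - P.alpha * ε.im) (P.alpha * ε.im - M)
    rwa [sub_add_sub_cancel] at this
  linarith

/-- As α² = 2p₊p₋, the strip is the set where α Im ε is within 1/2 of the integer 2p₊p₋k + m. Thus
the strips index the nearest integer. -/
theorem mem_strip_iff (ε : ℂ) (k : ℤ) (m : ℕ) : ε ∈ P.strip k m ↔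
    |((2 * (P.pp * P.pm) * k + m : ℤ) : ℝ) - P.alpha * ε.im| < 1 / 2 := by
  have ha := P.alpha_pos
  have h1 : (0 : ℝ) < P.pp := by exact_mod_cast (by have := P.two_le_pp; omega : 0 < P.pp)
  have h2 : (0 : ℝ) < P.pm := by exact_mod_cast (by have := P.two_le_pm; omega : 0 < P.pm)
  have e1 : ε.im / P.alpha = P.alpha * ε.im / (2 * P.pp * P.pm) := by
    rw [← P.alpha_sq]; field_simp
  have e2 : (k + (2 * m - 1) / (4 * P.pp * P.pm) : ℝ) =
      (2 * (P.pp * P.pm) * k + m - 1 / 2) / (2 * P.pp * P.pm) := by field_simp; ring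
  have e3 : (k + (2 * m + 1) / (4 * P.pp * P.pm) : ℝ) =
      (2 * (P.pp * P.pm) * k + m + 1 / 2) / (2 * P.pp * P.pm) := by field_simp; ring
  have hpos : (0 : ℝ) < 2 * P.pp * P.pm := by positivity
  rw [strip, Set.mem_ofPred_eq, e1, e2, e3, div_lt_div_iff_of_pos_right hpos,
    div_lt_div_iff_of_pos_right hpos, abs_lt]
  push_cast
  constructor <;> rintro ⟨h3, h4⟩ <;> constructor <;> linarith

theorem pp_dvd_iff (k : ℤ) (m : ℕ) :
    (P.pp : ℤ) ∣ 2 * (P.pp * P.pm) * k + m ↔ P.pp ∣ m := by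
  rw [Int.dvd_add_right ⟨2 * P.pm * k, by ring⟩, Int.natCast_dvd_natCast]

theorem pm_dvd_iff (k : ℤ) (m : ℕ) :
    (P.pm : ℤ) ∣ 2 * (P.pp * P.pm) * k + m ↔ P.pm ∣ m := by
  rw [Int.dvd_add_right ⟨2 * P.pp * k, by ring⟩, Int.natCast_dvd_natCast]

theorem exists_dominates_of_mem_affinePlusRegion {ε : ℂ} (h : ε ∈ P.affinePlusRegion) :
    ∃ M, P.Dominates M ε ∧ ¬ (P.pp : ℤ) ∣ M ∧ (P.pm : ℤ) ∣ M := by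
  obtain ⟨hw, k, m, -, hs, h1, h2⟩ := h
  rw [← pm_dvd_iff k] at h1
  rw [← pp_dvd_iff k] at h2
  exact ⟨_, dominates_of_abs_lt hw (fun h => h2 h.1) ((mem_strip_iff ε k m).1 hs), h2, h1⟩

theorem exists_dominates_of_mem_affineMinusRegion {ε : ℂ} (h : ε ∈ P.affineMinusRegion) :
    ∃ M, P.Dominates M ε ∧ (P.pp : ℤ) ∣ M ∧ ¬ (P.pm : ℤ) ∣ M := by
  obtain ⟨hw, k, m, -, hs, h1, h2⟩ := h
  rw [← pp_dvd_iff k] at h1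
  rw [← pm_dvd_iff k] at h2
  exact ⟨_, dominates_of_abs_lt hw (fun h => h2 h.2) ((mem_strip_iff ε k m).1 hs), h1, h2⟩

/-- If p₊p₋ divides the nearest integer N, that mode is absent and the neighbour N ± 1 on the same
side as α Im ε takes over; neither p₊ nor p₋ divides it. On the centre line the two neighbours tie,
which is why that line is excluded. -/
theorem exists_dominates_of_mem_minimalRegion {ε : ℂ} (h : ε ∈ P.minimalRegion) :
    ∃ M, P.Dominates M ε ∧ ¬ (P.pp : ℤ) ∣ M ∧ ¬ (P.pm : ℤ) ∣ M := by
  obtain ⟨hw, k, m, -, hs, ⟨h1, h2⟩ | ⟨h1, h2, h3⟩⟩ := h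
  · rw [← pp_dvd_iff k] at h1
    rw [← pm_dvd_iff k] at h2
    exact ⟨_, dominates_of_abs_lt hw (fun h => h2 h.2) ((mem_strip_iff ε k m).1 hs), h1, h2⟩
  · rw [← pp_dvd_iff k] at h1
    rw [← pm_dvd_iff k] at h2
    have ha := P.alpha_pos
    have hne : P.alpha * ε.im ≠ ((2 * (P.pp * P.pm) * k + m : ℤ) : ℝ) := by
      intro he
      apply h3
      have h4 := P.pp_ne_zero
      have h5 := P.pm_ne_zero
      norm_cast at h4 h5
      have h4 : (P.pp : ℝ) ≠ 0 := by exact_mod_cast h4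
      have h5 : (P.pm : ℝ) ≠ 0 := by exact_mod_cast h5
      have e1 : ε.im / P.alpha = P.alpha * ε.im / (2 * P.pp * P.pm) := by
        rw [← P.alpha_sq]; field_simp
      rw [e1, he]
      push_cast
      field_simp
      ring
    have hs' := (mem_strip_iff ε k m).1 hs
    generalize 2 * ((P.pp : ℤ) * P.pm) * k + m = N at h1 h2 hne hs'
    rw [abs_lt] at hs'
    rcases lt_or_gt_of_ne hne with hlt | hgt
    · have hp : ¬ (P.pp : ℤ) ∣ N - 1 := fun hd =>
        P.pp_not_dvd_one (by simpa using dvd_sub h1 hd)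
      have hm : ¬ (P.pm : ℤ) ∣ N - 1 := fun hd =>
        P.pm_not_dvd_one (by simpa using dvd_sub h2 hd)
      refine ⟨N - 1, dominates_of_closest hw (fun h => hp h.1) fun n hn hnd => ?_, hp, hm⟩
      have hnN : n ≠ N := fun h => hnd (h ▸ ⟨h1, h2⟩)
      push_cast
      have e : |(N : ℝ) - 1 - P.alpha * ε.im| = P.alpha * ε.im - N + 1 := by
        rw [abs_of_neg (by linarith)]; ring
      rw [e]
      rcases (by omega : n + 2 ≤ N ∨ N + 1 ≤ n) with h | h
      · have h' : (n : ℝ) + 2 ≤ N := by exact_mod_cast h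
        exact lt_of_lt_of_le (by linarith) (neg_le_abs _)
      · have h' : (N : ℝ) + 1 ≤ n := by exact_mod_cast h
        exact lt_of_lt_of_le (by linarith) (le_abs_self _)
    · have hp : ¬ (P.pp : ℤ) ∣ N + 1 := fun hd =>
        P.pp_not_dvd_one (by simpa using dvd_sub hd h1)
      have hm : ¬ (P.pm : ℤ) ∣ N + 1 := fun hd =>
        P.pm_not_dvd_one (by simpa using dvd_sub hd h2)
      refine ⟨N + 1, dominates_of_closest hw (fun h => hp h.1) fun n hn hnd => ?_, hp, hm⟩
      have hnN : n ≠ N := fun h => hnd (h ▸ ⟨h1, h2⟩)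
      push_cast
      have e : |(N : ℝ) + 1 - P.alpha * ε.im| = N + 1 - P.alpha * ε.im := by
        rw [abs_of_pos (by linarith)]
      rw [e]
      rcases (by omega : n + 1 ≤ N ∨ N + 2 ≤ n) with h | h
      · have h' : (n : ℝ) + 1 ≤ N := by exact_mod_cast h
        exact lt_of_lt_of_le (by linarith) (neg_le_abs _)
      · have h' : (N : ℝ) + 2 ≤ n := by exact_mod_cast h
        exact lt_of_lt_of_le (by linarith) (le_abs_self _)

/-- The dominating mode is a function of ε, so a mode obtained by choice on a region can be
identified at a given point. -/
theorem Dominates.unique {M M' : ℤ} {ε : ℂ} (h : P.Dominates M ε) (h' : P.Dominates M' ε)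
    (hM : ¬ ((P.pp : ℤ) ∣ M ∧ (P.pm : ℤ) ∣ M)) (hM' : ¬ ((P.pp : ℤ) ∣ M' ∧ (P.pm : ℤ) ∣ M')) :
    M = M' := by
  by_contra hne
  rcases le_total (modeRate P.alpha ε M) (modeRate P.alpha ε M') with hle | hle
  · exact hM' (h.dvd_of_rate_le M' (Ne.symm hne) hle)
  · exact hM (h'.dvd_of_rate_le M hne hle)

variable (P)

/-- Every mode that is not divisible by `p₊ p₋` dominates at some point of the strip around it. -/
theorem exists_dominates {M : ℤ} (hM : ¬ ((P.pp : ℤ) ∣ M ∧ (P.pm : ℤ) ∣ M)) :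
    ∃ (ε : ℂ) (k : ℤ) (m : ℕ), ε.re < P.wall ε ∧ m < 2 * P.pp * P.pm ∧ ε ∈ P.strip k m ∧
      P.Dominates M ε ∧ ((P.pp : ℤ) ∣ M ↔ P.pp ∣ m) ∧ ((P.pm : ℤ) ∣ M ↔ P.pm ∣ m) := by
  have ha := P.alpha_pos
  have hK : (0 : ℤ) < 2 * (P.pp * P.pm) := by
    have h1 := P.two_le_pp
    have h2 := P.two_le_pm
    have h3 : (0 : ℤ) < P.pp := by omega
    have h4 : (0 : ℤ) < P.pm := by omega
    positivity
  -- The imaginary part sits exactly at the mode M. The wall depends only on the imaginary part, so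
  -- it may be evaluated at real part 0 before moving one unit to its left.
  set ε : ℂ := ⟨P.wall ⟨0, M / P.alpha⟩ - 1, M / P.alpha⟩ with hε
  have hw : ε.re < P.wall ε := sub_one_lt (P.wall ε)
  have him : P.alpha * ε.im = M := by
    rw [hε]; field_simp
  have h1 := Int.emod_nonneg M hK.ne'
  have h2 := Int.emod_lt_of_pos M hK
  have h3 := Int.emod_add_mul_ediv M (2 * (P.pp * P.pm))
  obtain ⟨m, hm⟩ := Int.eq_ofNat_of_zero_le h1
  have h4 : 2 * (P.pp * P.pm) * (M / (2 * (P.pp * P.pm))) + m = M := by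
    rw [hm] at h3; linarith
  refine ⟨ε, M / (2 * (P.pp * P.pm)), m, hw, ?_, ?_, ?_, ?_, ?_⟩
  · rw [hm] at h2
    have : ((m : ℕ) : ℤ) < ((2 * P.pp * P.pm : ℕ) : ℤ) := by push_cast; linarith
    exact_mod_cast this
  · rw [mem_strip_iff, h4, him]; norm_num
  · exact dominates_of_abs_lt hw hM (by rw [him]; norm_num)
  · rw [← pp_dvd_iff (M / (2 * (P.pp * P.pm))), h4]
  · rw [← pm_dvd_iff (M / (2 * (P.pp * P.pm))), h4]

end Params

end Singlet

namespace Singlet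

/-! ### Linear independence of exponentials -/

/-- Dedekind's independence of characters for the group ℤ; the value at 1 recovers z. -/
theorem linearIndependent_zpow :
    LinearIndependent ℂ fun (z : ℂˣ) (m : ℤ) => ((z ^ m : ℂˣ) : ℂ) := by
  have h := (linearIndependent_monoidHom (Multiplicative ℤ) ℂ).comp
    (fun z : ℂˣ => (Units.coeHom ℂ).comp (zpowersHom ℂˣ z)) fun z w hzw => by
      have := DFunLike.congr_fun hzw (Multiplicative.ofAdd 1)
      exact Units.ext (by simpa [zpowersHom_apply] using this)
  exact h

/-- The character `t ↦ exp (t μ)` of the additive monoid of nonnegative reals. -/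
def expChar (μ : ℂ) : Multiplicative NNReal →* ℂ where
  toFun t := Complex.exp ((t.toAdd : ℝ) * μ)
  map_one' := by simp
  map_mul' s t := by rw [← Complex.exp_add, toAdd_mul]; push_cast; ring_nf

theorem expChar_injective : Function.Injective expChar := by
  intro μ ν h
  by_contra hne
  have hz : 0 < ‖μ - ν‖ := norm_pos_iff.2 (sub_ne_zero.2 hne)
  -- At this t the difference of the exponents has modulus 1, too small for a nonzero multiple of
  -- 2πi.
  set t : NNReal := ⟨‖μ - ν‖⁻¹, (inv_pos.2 hz).le⟩
  have h1 : Complex.exp ((t : ℝ) * μ) = Complex.exp ((t : ℝ) * ν) :=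
    DFunLike.congr_fun h (Multiplicative.ofAdd t)
  obtain ⟨n, hn⟩ := Complex.exp_eq_exp_iff_exists_int.1 h1
  have h2 : ((t : ℝ) : ℂ) * (μ - ν) = n * (2 * Real.pi * Complex.I) := by
    linear_combination hn
  have h3 := congrArg norm h2
  have ht : (t : ℝ) = ‖μ - ν‖⁻¹ := rfl
  rw [norm_mul, Complex.norm_real, Real.norm_of_nonneg (NNReal.coe_nonneg t), ht,
    inv_mul_cancel₀ hz.ne', norm_mul,
    norm_mul, norm_mul, Complex.norm_I, Complex.norm_intCast, Complex.norm_real,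
    Real.norm_of_nonneg Real.pi_pos.le, Complex.norm_ofNat] at h3
  by_cases hn0 : n = 0
  · simp [hn0] at h3
  · have h4 : (1 : ℝ) ≤ |(n : ℝ)| := by exact_mod_cast Int.one_le_abs hn0
    nlinarith [Real.pi_gt_three]

/-- Combinations of exponentials are determined by their values in the right half plane. -/
theorem eq_zero_of_exp_sum_eq_zero (F : ℂ →₀ ℂ)
    (h : ∀ ε : ℂ, 0 < ε.re → (F.sum fun μ c => c * Complex.exp (ε * μ)) = 0) : F = 0 := by
  have hli := (linearIndependent_monoidHom (Multiplicative NNReal) ℂ).comp expChar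
    expChar_injective
  rw [linearIndependent_iff'] at hli
  have h1 := hli F.support (fun μ => F μ * Complex.exp μ) (by
    funext t
    rw [Finset.sum_apply, Pi.zero_apply]
    -- The point 1 + t lies in the open right half plane for every t ≥ 0; the factor exp μ is
    -- absorbed into the coefficient.
    have h2 := h (1 + ((t.toAdd : ℝ) : ℂ)) (by
      have : (0 : ℝ) ≤ t.toAdd := t.toAdd.2
      rw [Complex.add_re, Complex.one_re, Complex.ofReal_re]
      linarith)
    rw [Finsupp.sum] at h2
    rw [← h2]
    refine Finset.sum_congr rfl fun μ _ => ?_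
    change F μ * Complex.exp μ * Complex.exp ((t.toAdd : ℝ) * μ) = _
    rw [mul_assoc, ← Complex.exp_add]
    congr 2
    ring)
  ext μ
  by_cases hμ : μ ∈ F.support
  · exact (mul_eq_zero.1 (h1 μ hμ)).resolve_right (Complex.exp_ne_zero _)
  · simpa using hμ

/-! ### Images of characters of fusion rings -/

namespace FusionTable

theorem range_evalHom_le {ι κ D : Type*} (R : Type*) [CommRing R] [Algebra R ℂ]
    (T : FusionTable ι) (U : FusionTable κ) {f : ι → D → ℂ} {g : κ → D → ℂ} (h1 : f T.unit = 1)
    (hmul : ∀ i j, Finsupp.linearCombination ℤ f (T.prod i j) = f i * f j) (k1 : g U.unit = 1)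
    (kmul : ∀ i j, Finsupp.linearCombination ℤ g (U.prod i j) = g i * g j)
    (hf : ∀ i, f i ∈ (U.evalHom R g k1 kmul).range) :
    (T.evalHom R f h1 hmul).range ≤ (U.evalHom R g k1 kmul).range := by
  have key : ∀ c : ι →₀ R,
      Finsupp.linearCombination R f c ∈ (U.evalHom R g k1 kmul).range := by
    intro c
    rw [Finsupp.linearCombination_apply, Finsupp.sum]
    refine sum_mem fun i _ => ?_
    obtain ⟨y, hy⟩ := hf i
    exact ⟨c i • y, by rw [evalHom_smul, hy]⟩
  rintro _ ⟨x, rfl⟩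
  exact key x

/-- Two fusion rings with characters of the same image, one of which is injective. -/
theorem exists_range_equiv {ι κ D : Type*} (R : Type*) [CommRing R] [Algebra R ℂ]
    (T : FusionTable ι) (U : FusionTable κ) {f : ι → D → ℂ} {g : κ → D → ℂ} (h1 : f T.unit = 1)
    (hmul : ∀ i j, Finsupp.linearCombination ℤ f (T.prod i j) = f i * f j) (k1 : g U.unit = 1)
    (kmul : ∀ i j, Finsupp.linearCombination ℤ g (U.prod i j) = g i * g j)
    (hf : ∀ i, f i ∈ (U.evalHom R g k1 kmul).range)
    (hg : ∀ i, g i ∈ (T.evalHom R f h1 hmul).range)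
    (hinj : Function.Injective (U.evalHom R g k1 kmul)) :
    ∃ e : (T.evalHom R f h1 hmul).range ≃+* U.Alg R, ∀ (c : R) (x : T.Alg R),
      e ((T.evalHom R f h1 hmul).rangeRestrict (c • x)) =
        c • e ((T.evalHom R f h1 hmul).rangeRestrict x) := by
  have hr : (T.evalHom R f h1 hmul).range = (U.evalHom R g k1 kmul).range :=
    le_antisymm (range_evalHom_le R T U h1 hmul k1 kmul hf)
      (range_evalHom_le R U T k1 kmul h1 hmul hg)
  have hb : Function.Bijective (U.evalHom R g k1 kmul).rangeRestrict :=
    ⟨fun x y hxy => hinj (congrArg Subtype.val hxy), RingHom.rangeRestrict_surjective _⟩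
  have hinv : ∀ z, U.evalHom R g k1 kmul ((RingEquiv.ofBijective _ hb).symm z) = z := by
    intro z
    exact congrArg Subtype.val ((RingEquiv.ofBijective _ hb).apply_symm_apply z)
  refine ⟨(RingEquiv.subringCongr hr).trans (RingEquiv.ofBijective _ hb).symm, fun c x => ?_⟩
  apply hinj
  rw [evalHom_smul]
  rw [RingEquiv.trans_apply, RingEquiv.trans_apply, hinv, hinv]
  exact evalHom_smul T R h1 hmul c x

end FusionTable

namespace Params

variable (P : Params)

/-! ### Injectivity in the continuous region -/

/-- The leading exponent of the character of a simple module, relative to the vacuum. -/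
def leadExp : P.VerlindeLabel → ℂ
  | .typical l _ => l - P.alphaZero / 2 + P.alpha
  | .atypical r s _ _ n => ((n * (P.pp * P.pm) + r * P.pm + s * P.pp : ℤ) : ℂ) / P.alpha

/-- The distances of the other exponents to the leading one, with their coefficients. -/
def gapExp : P.VerlindeLabel → Fin 3 → ℝ × ℂ
  -- From (Z - Z⁻¹)² = Z² - 2 + Z⁻²; the third entry is padding with coefficient 0 and an arbitrary
  -- positive gap.
  | .typical _ _ => ![(P.alpha, -2), (2 * P.alpha, 1), (1, 0)]
  | .atypical r s _ _ _ => ![(2 * r * P.pm / P.alpha, -1), (2 * s * P.pp / P.alpha, -1),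
      (2 * (r * P.pm + s * P.pp) / P.alpha, 1)]

/-- The value of the character at a simple module as a combination of exponentials. -/
def expansion (x : P.VerlindeLabel) : ℂ →₀ ℂ :=
  Finsupp.single (P.leadExp x) 1 +
    ∑ i, Finsupp.single (P.leadExp x - (P.gapExp x i).1) (P.gapExp x i).2

theorem gapExp_pos (x : P.VerlindeLabel) (i : Fin 3) : 0 < (P.gapExp x i).1 := by
  have ha := P.alpha_pos
  have h1 : (0 : ℝ) < P.pp := by exact_mod_cast (by have := P.two_le_pp; omega : 0 < P.pp)
  have h2 : (0 : ℝ) < P.pm := by exact_mod_cast (by have := P.two_le_pm; omega : 0 < P.pm)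
  cases x with
  | typical l h => fin_cases i <;> simp [gapExp, ha]
  | atypical r s hr hs n =>
    have h3 : (0 : ℝ) < r := by exact_mod_cast hr.1
    have h4 : (0 : ℝ) < s := by exact_mod_cast hs.1
    fin_cases i <;> simp [gapExp] <;> positivity

theorem natCast_dvd_sub_eq {p : ℕ} {r r' : ℕ} (hr : 1 ≤ r ∧ r ≤ p) (hr' : 1 ≤ r' ∧ r' ≤ p)
    (h : (p : ℤ) ∣ r - r') : r = r' := by
  have h1 : ((r : ℤ) - r').natAbs < p := by omega
  have h2 := Int.eq_zero_of_dvd_of_natAbs_lt_natAbs h (by simpa using h1)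
  omega

/-- Atypical leading exponents are integers over α, and a typical one is not, since α and α₀/2 also
are. Among atypical labels, reduction modulo p₊ and p₋ recovers r and s from their ranges, and then
n. -/
theorem leadExp_injective : Function.Injective P.leadExp := by
  have ha : (P.alpha : ℂ) ≠ 0 := by exact_mod_cast P.alpha_pos.ne'
  have hsq : (P.alpha : ℂ) * P.alpha = 2 * P.pp * P.pm := by exact_mod_cast P.alpha_sq
  have h0 : (P.alphaZero : ℂ) = 2 * (P.pm - P.pp) / P.alpha := by
    rw [alphaZero, P.alphaPlus_eq, P.alphaMinus_eq]; push_cast; ring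
  have hne : ∀ l, P.IsTypical l → ∀ N : ℤ, l - P.alphaZero / 2 + P.alpha ≠ (N : ℂ) / P.alpha := by
    intro l hl N h
    refine hl (N + (P.pm - P.pp) - 2 * P.pp * P.pm) ?_
    rw [h0] at h
    push_cast
    field_simp at h ⊢
    linear_combination h - hsq
  intro x y hxy
  cases x with
  | typical l h =>
    cases y with
    | typical l' h' =>
      have : l = l' := by simpa [leadExp] using hxy
      subst this; rfl
    | atypical r s hr hs n => exact absurd hxy (hne l h _)
  | atypical r s hr hs n =>
    cases y with
    | typical l h => exact absurd hxy.symm (hne l h _)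
    | atypical r' s' hr' hs' n' =>
      have h1 : (n * (P.pp * P.pm) + r * P.pm + s * P.pp : ℤ) =
          n' * (P.pp * P.pm) + r' * P.pm + s' * P.pp := by
        have := (div_left_inj' ha).1 hxy
        exact_mod_cast this
      have hco := Nat.isCoprime_iff_coprime.2 P.coprime
      have h2 : (P.pp : ℤ) ∣ r - r' := by
        refine hco.dvd_of_dvd_mul_right ⟨(n' - n) * P.pm + s' - s, ?_⟩
        linear_combination h1
      have h3 : (P.pm : ℤ) ∣ s - s' := by
        refine hco.symm.dvd_of_dvd_mul_right ⟨(n' - n) * P.pp + r' - r, ?_⟩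
        linear_combination h1
      obtain rfl := natCast_dvd_sub_eq hr hr' h2
      obtain rfl := natCast_dvd_sub_eq hs hs' h3
      have h4 : (n - n') * ((P.pp : ℤ) * P.pm) = 0 := by linear_combination h1
      have h5 : (P.pp : ℤ) * P.pm ≠ 0 := by
        have h6 := P.two_le_pp
        have h7 := P.two_le_pm
        exact mul_ne_zero (by omega) (by omega)
      have h6 : n = n' := sub_eq_zero.1 ((mul_eq_zero.1 h4).resolve_right h5)
      subst h6; rfl

theorem expansion_leadExp_self (x : P.VerlindeLabel) : P.expansion x (P.leadExp x) = 1 := by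
  rw [expansion, Finsupp.add_apply, Finsupp.single_eq_same, Finsupp.finsetSum_apply,
    Finset.sum_eq_zero, add_zero]
  intro i _
  rw [Finsupp.single_apply, if_neg]
  intro h
  have h1 := congrArg Complex.re h
  rw [Complex.sub_re, Complex.ofReal_re] at h1
  linarith [P.gapExp_pos x i]

/-- All exponents of x other than its leading one have strictly smaller real part, so they cannot
reach that of y. -/
theorem expansion_leadExp_of_ne {x y : P.VerlindeLabel} (hxy : x ≠ y)
    (hle : (P.leadExp x).re ≤ (P.leadExp y).re) : P.expansion x (P.leadExp y) = 0 := by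
  rw [expansion, Finsupp.add_apply, Finsupp.single_apply,
    if_neg fun h => hxy (P.leadExp_injective h), Finsupp.finsetSum_apply,
    Finset.sum_eq_zero, add_zero]
  intro i _
  rw [Finsupp.single_apply, if_neg]
  intro h
  have h1 := congrArg Complex.re h
  rw [Complex.sub_re, Complex.ofReal_re] at h1
  linarith [P.gapExp_pos x i]

/-- The Weyl denominators clear the quantum integers: an atypical value becomes a product of two
differences, a typical one becomes an exponential times (Z - Z⁻¹)². -/
theorem linearCombination_expansion (ε : ℂ) (x : P.VerlindeLabel) :
    Finsupp.linearCombination ℂ (fun μ => Complex.exp (2 * Real.pi * ε * μ)) (P.expansion x) =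
      P.labelVal ε x * ((P.qX ε - (P.qX ε)⁻¹) * (P.qY ε - (P.qY ε)⁻¹)) := by
  have ha : (P.alpha : ℂ) ≠ 0 := by exact_mod_cast P.alpha_pos.ne'
  have hsub : ∀ μ : ℂ, ∀ d : ℝ, Complex.exp (2 * Real.pi * ε * (μ - d)) =
      Complex.exp (2 * Real.pi * ε * μ) * (Complex.exp (2 * Real.pi * ε * d))⁻¹ := by
    intro μ d
    rw [← Complex.exp_neg, ← Complex.exp_add]; congr 1; ring
  have hXp := P.qX_mul_qInt ε P.pp
  have hYp := P.qY_mul_qInt ε P.pm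
  rw [qX_pow] at hXp
  rw [qY_pow] at hYp
  rw [expansion, map_add, map_sum, Finsupp.linearCombination_single, Fin.sum_univ_three]
  simp only [Finsupp.linearCombination_single, smul_eq_mul, hsub, one_mul]
  cases x with
  | typical l h =>
    have e1 : Complex.exp (2 * Real.pi * ε * P.alpha) = P.qZ ε ^ 2 := by
      rw [← exp_alpha, ← Complex.exp_nat_mul]; congr 1; push_cast; ring
    have e2 : Complex.exp (2 * Real.pi * ε * ((2 * P.alpha : ℝ) : ℂ)) = P.qZ ε ^ 4 := by
      rw [← exp_alpha, ← Complex.exp_nat_mul]; congr 1; push_cast; ring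
    have e3 : Complex.exp (2 * Real.pi * ε * (l - P.alphaZero / 2 + P.alpha)) =
        Complex.exp (2 * Real.pi * ε * (l - P.alphaZero / 2)) * P.qZ ε ^ 2 := by
      rw [← e1, ← Complex.exp_add]; congr 1; ring
    have hZ := P.qZ_ne_zero ε
    simp only [gapExp, leadExp, labelVal, Matrix.cons_val_zero, Matrix.cons_val_one,
      Matrix.cons_val, zero_mul, add_zero, e1, e2, e3, fockVal]
    rw [show ∀ w a b c d : ℂ, w * (a * b) * (c * d) = w * ((c * a) * (d * b)) from
      fun _ _ _ _ _ => by ring, hXp, hYp]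
    field_simp
    ring
  | atypical r s hr hs n =>
    have e1 : Complex.exp (2 * Real.pi * ε * ((2 * r * P.pm / P.alpha : ℝ) : ℂ)) =
        (P.qX ε ^ (r : ℤ)) ^ 2 := by
      rw [← qE_mul_pm, qE, ← Complex.exp_nat_mul]; congr 1; push_cast; ring
    have e2 : Complex.exp (2 * Real.pi * ε * ((2 * s * P.pp / P.alpha : ℝ) : ℂ)) =
        (P.qY ε ^ (s : ℤ)) ^ 2 := by
      rw [← qE_mul_pp, qE, ← Complex.exp_nat_mul]; congr 1; push_cast; ring
    have e3 : Complex.exp (2 * Real.pi * ε *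
        ((2 * (r * P.pm + s * P.pp) / P.alpha : ℝ) : ℂ)) =
        (P.qX ε ^ (r : ℤ)) ^ 2 * (P.qY ε ^ (s : ℤ)) ^ 2 := by
      rw [← e1, ← e2, ← Complex.exp_add]; congr 1; push_cast; ring
    have e4 : Complex.exp (2 * Real.pi * ε *
        (((n * (P.pp * P.pm) + r * P.pm + s * P.pp : ℤ) : ℂ) / P.alpha)) =
        P.qZ ε ^ n * P.qX ε ^ (r : ℤ) * P.qY ε ^ (s : ℤ) := by
      rw [← qE_mul_pm, ← qE_mul_pp, ← qE_mul_pp_pm, ← qE_add, ← qE_add, qE, mul_div_assoc]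
    have hX := zpow_ne_zero (r : ℤ) (P.qX_ne_zero ε)
    have hY := zpow_ne_zero (s : ℤ) (P.qY_ne_zero ε)
    simp only [gapExp, leadExp, labelVal, Matrix.cons_val_zero, Matrix.cons_val_one,
      Matrix.cons_val, e1, e2, e3, e4, atypicalVal]
    rw [show ∀ w a b c d : ℂ, w * (a * b) * (c * d) = w * ((c * a) * (d * b)) from
      fun _ _ _ _ _ => by ring, qX_mul_qInt, qY_mul_qInt]
    generalize P.qX ε ^ (r : ℤ) = X at *
    generalize P.qY ε ^ (s : ℤ) = Y at *
    field_simp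
    ring

theorem mem_continuousRegion_of_re_pos {ε : ℂ} (h : 0 < ε.re) : ε ∈ P.continuousRegion := by
  refine ⟨lt_of_le_of_lt ?_ h, h.ne'⟩
  refine neg_nonpos.2 (Real.sInf_nonneg ?_)
  rintro _ ⟨m, -, rfl⟩
  exact abs_nonneg _

theorem familyHom_continuous_injective (R : Type*) [CommRing R] [Algebra R ℂ]
    (hR : Function.Injective (algebraMap R ℂ)) :
    Function.Injective (P.familyHom R (fun ε : P.continuousRegion => (ε : ℂ))) := by
  rw [injective_iff_map_eq_zero]
  suffices key : ∀ c : P.VerlindeLabel →₀ R,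
      Finsupp.linearCombination R (fun x (ε : P.continuousRegion) => P.labelVal ε x) c = 0 →
        c = 0 from fun x hx => key x hx
  intro c hx
  by_contra hne
  set F : ℂ →₀ ℂ := ∑ i ∈ c.support, algebraMap R ℂ (c i) • P.expansion i with hF
  have hF0 : F = 0 := by
    refine eq_zero_of_exp_sum_eq_zero F fun ε hε => ?_
    have hε' : 0 < (ε / (2 * Real.pi)).re := by
      have : ε / (2 * Real.pi) = ((2 * Real.pi)⁻¹ : ℝ) * ε := by push_cast; ring
      rw [this, Complex.re_ofReal_mul]
      have := Real.pi_pos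
      positivity
    set ε' := ε / (2 * Real.pi) with hε'd
    have hpi : (Real.pi : ℂ) ≠ 0 := by exact_mod_cast Real.pi_ne_zero
    have h1 : (F.sum fun μ a => a * Complex.exp (ε * μ)) =
        Finsupp.linearCombination ℂ (fun μ => Complex.exp (2 * Real.pi * ε' * μ)) F := by
      rw [Finsupp.linearCombination_apply]
      refine Finsupp.sum_congr fun μ _ => ?_
      rw [smul_eq_mul, hε'd]
      congr 2
      field_simp
    have h2 := congrFun hx ⟨ε', P.mem_continuousRegion_of_re_pos hε'⟩
    have h3 : ∑ i ∈ c.support, algebraMap R ℂ (c i) * P.labelVal ε' i = 0 := by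
      refine Eq.trans ?_ h2
      rw [Finsupp.linearCombination_apply, Finsupp.sum, Finset.sum_apply]
      exact Finset.sum_congr rfl fun i _ => (Algebra.smul_def _ _).symm
    rw [h1, hF, map_sum]
    simp only [map_smul, linearCombination_expansion, smul_eq_mul, ← mul_assoc]
    rw [← Finset.sum_mul, ← Finset.sum_mul, h3, zero_mul, zero_mul]
  have hsupp : c.support.Nonempty := Finsupp.support_nonempty_iff.2 hne
  -- Among the labels with nonzero coefficient, one of maximal real leading exponent is alone in
  -- contributing to that exponent, so its coefficient must vanish.
  obtain ⟨y, hy, hmax⟩ := c.support.exists_max_image (fun i => (P.leadExp i).re) hsupp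
  have h1 : F (P.leadExp y) = algebraMap R ℂ (c y) := by
    rw [hF, Finsupp.finsetSum_apply, Finset.sum_eq_single y]
    · rw [Finsupp.smul_apply, expansion_leadExp_self, smul_eq_mul, mul_one]
    · intro i hi hiy
      rw [Finsupp.smul_apply, P.expansion_leadExp_of_ne hiy (hmax i hi), smul_zero]
    · exact fun h => absurd hy h
  rw [hF0, Finsupp.zero_apply] at h1
  have h2 : c y = 0 := hR (by rw [← h1, map_zero])
  exact (Finsupp.mem_support_iff.1 hy) h2

end Params

end Singlet

/-! ### Separating the values at roots of unity -/

namespace Singlet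

/-- The vanishing of [p] turns the Fock relation into a symmetry between r and p - r; this is the
source of the Kac identification and of the signs absorbed below. -/
theorem qInt_reflect {p r : ℕ} (hr : r ≤ p) {X : ℂ} (hX : X ≠ 0) (hp : qInt p X = 0) :
    qInt r X = -(X ^ (p : ℤ) * qInt (p - r) X) := by
  have h := qInt_add_mul hr hX
  rw [hp, mul_zero] at h
  linear_combination h

theorem zpow_of_sq_eq_one {Y : ℂ} (h : Y ^ 2 = 1) (n : ℤ) : Y ^ n = if Even n then 1 else Y := by
  have h0 : Y ≠ 0 := fun h0 => by simp [h0] at h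
  split_ifs with hn
  · obtain ⟨k, rfl⟩ := hn
    rw [← two_mul, zpow_mul, zpow_ofNat, h, one_zpow]
  · obtain ⟨k, rfl⟩ := Int.not_even_iff_odd.1 hn
    rw [zpow_add₀ h0, zpow_mul, zpow_ofNat, h, one_zpow, one_mul, zpow_one]

theorem mem_truncatedClebschGordan_bounds {p r s c : ℕ} (hr : 1 ≤ r ∧ r < p) (hs : 1 ≤ s ∧ s < p)
    (hc : c ∈ truncatedClebschGordan p r s) : 1 ≤ c ∧ c < p := by
  simp only [truncatedClebschGordan, clebschGordan, Finset.mem_filter, Finset.mem_Icc] at hc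
  obtain ⟨⟨⟨h1, h2⟩, h3⟩, h4⟩ := hc
  omega

theorem eq_zero_of_mul_bounds {k p a : ℤ} (h : a = k * p) (h1 : -p < a) (h2 : a < p) : k = 0 := by
  have hp : 0 < p := by linarith
  have h3 : k < 1 := lt_of_mul_lt_mul_right (by linarith) hp.le
  have h4 : -1 < k := lt_of_mul_lt_mul_right (by linarith) hp.le
  omega

/-- A relation between characters of `ℤ` that are combinations of powers of units. -/
theorem eq_zero_of_zpow_sum_eq_zero (F : ℂˣ →₀ ℂ)
    (h : ∀ m : ℤ, Finsupp.linearCombination ℂ (fun z : ℂˣ => ((z ^ m : ℂˣ) : ℂ)) F = 0) :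
    F = 0 := by
  refine linearIndependent_iff.1 linearIndependent_zpow F ?_
  funext m
  rw [Pi.zero_apply, ← h m, Finsupp.linearCombination_apply, Finsupp.linearCombination_apply,
    Finsupp.sum, Finsupp.sum, Finset.sum_apply]
  rfl

/-- A combination of functions is zero if its coefficients can be separated after expansion. -/
theorem eq_zero_of_dual_expansion {ι R : Type*} [CommRing R] [Algebra R ℂ]
    (hR : Function.Injective (algebraMap R ℂ)) (E : ι → ℂˣ →₀ ℂ) (u : ι → ℂˣ)
    (hu : ∀ i, E i (u i) ≠ 0) (hne : ∀ i j, i ≠ j → E i (u j) = 0) (c : ι →₀ R)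
    (h : ∀ m : ℤ, ∑ i ∈ c.support, algebraMap R ℂ (c i) *
      Finsupp.linearCombination ℂ (fun z : ℂˣ => ((z ^ m : ℂˣ) : ℂ)) (E i) = 0) : c = 0 := by
  have hF := eq_zero_of_zpow_sum_eq_zero (∑ i ∈ c.support, algebraMap R ℂ (c i) • E i)
    fun m => by rw [map_sum]; simpa only [map_smul, smul_eq_mul] using h m
  ext j
  by_contra hj
  have h1 := DFunLike.congr_fun hF (u j)
  rw [Finsupp.finsetSum_apply, Finset.sum_eq_single j (fun i _ hij => by
      rw [Finsupp.smul_apply, hne i j hij, smul_zero])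
    (fun h => absurd (Finsupp.mem_support_iff.2 hj) h), Finsupp.smul_apply, Finsupp.zero_apply,
    smul_eq_mul] at h1
  exact hj (hR (by rw [(mul_eq_zero.1 h1).resolve_right (hu j)]; simp))

namespace Params

variable (P : Params)

/-! ### The minimal model -/

/-- The root of unity `exp (π i c / (p₊ p₋))`. -/
def modeUnit (c : ℤ) : ℂˣ := Units.mk0 (P.qE (P.modeParam 1) c) (P.qE_ne_zero _ _)

theorem modeUnit_zpow (c m : ℤ) : ((P.modeUnit c ^ m : ℂˣ) : ℂ) = P.qE (P.modeParam m) c := by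
  rw [Units.val_zpow_eq_zpow_val, modeUnit, Units.val_mk0, qE, qE, ← Complex.exp_int_mul,
    modeParam, modeParam]
  congr 1
  push_cast
  ring

theorem period_dvd_of_modeUnit_eq {c d : ℤ} (h : P.modeUnit c = P.modeUnit d) :
    (2 * (P.pp * P.pm) : ℤ) ∣ c - d := by
  have h1 : P.qE (P.modeParam 1) c = P.qE (P.modeParam 1) d := congrArg Units.val h
  have hsq : (P.alpha : ℂ) * P.alpha = 2 * P.pp * P.pm := by exact_mod_cast P.alpha_sq
  have ha : (P.alpha : ℂ) ≠ 0 := by exact_mod_cast P.alpha_pos.ne'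
  have hpi : (Real.pi : ℂ) ≠ 0 := by exact_mod_cast Real.pi_ne_zero
  have hI := Complex.I_ne_zero
  rw [qE, qE, Complex.exp_eq_exp_iff_exists_int] at h1
  obtain ⟨n, hn⟩ := h1
  refine ⟨n, ?_⟩
  rw [modeParam] at hn
  field_simp at hn
  push_cast at hn
  have : (c : ℂ) - d = 2 * (P.pp * P.pm) * n := by linear_combination hn + n * hsq
  exact_mod_cast this

/-- The value at the label `(r, s)` of the character of the minimal model fusion ring with
index `m`. -/
def kacVal (m : ℤ) (x : P.KacLabel) : ℂ :=
  qInt x.r (P.qX (P.modeParam m)) * qInt x.s (P.qY (P.modeParam m))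

theorem qInt_reflect_qX {m : ℤ} (hp : ¬ (P.pp : ℤ) ∣ m) {r : ℕ} (hr : r ≤ P.pp) :
    qInt r (P.qX (P.modeParam m)) =
      -(P.qZ (P.modeParam m) * qInt (P.pp - r) (P.qX (P.modeParam m))) := by
  rw [qInt_reflect hr (P.qX_ne_zero _) (P.qInt_pp_modeParam hp), qX_pow]

theorem qInt_reflect_qY {m : ℤ} (hm : ¬ (P.pm : ℤ) ∣ m) {s : ℕ} (hs : s ≤ P.pm) :
    qInt s (P.qY (P.modeParam m)) =
      -(P.qZ (P.modeParam m) * qInt (P.pm - s) (P.qY (P.modeParam m))) := by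
  rw [qInt_reflect hs (P.qY_ne_zero _) (P.qInt_pm_modeParam hm), qY_pow]

theorem isKac_or {a b : ℕ} (ha : 1 ≤ a ∧ a < P.pp) (hb : 1 ≤ b ∧ b < P.pm) :
    P.IsKac a b ∨ P.IsKac (P.pp - a) (P.pm - b) := by
  rcases lt_trichotomy (a * P.pm) (b * P.pp) with h | h | h
  · exact Or.inl ⟨ha.1, ha.2, hb.1, hb.2, h⟩
  · have h1 : P.pp ∣ a := P.coprime.dvd_of_dvd_mul_right ⟨b, by rw [h, mul_comm]⟩
    exact absurd (Nat.le_of_dvd (by omega) h1) (by omega)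
  · refine Or.inr ⟨by omega, by omega, by omega, by omega, ?_⟩
    rw [Nat.sub_mul, Nat.sub_mul, Nat.mul_comm P.pm P.pp]
    have h4 : a * P.pm < P.pp * P.pm := Nat.mul_lt_mul_of_pos_right ha.2 (by omega)
    omega

/-- Reflecting both indices produces two signs and Z² = 1, so the value respects L_{a,b} =
L_{p₊-a,p₋-b}. -/
theorem linearCombination_kacClass {m : ℤ} (hp : ¬ (P.pp : ℤ) ∣ m) (hm : ¬ (P.pm : ℤ) ∣ m)
    {a b : ℕ} (ha : 1 ≤ a ∧ a < P.pp) (hb : 1 ≤ b ∧ b < P.pm) :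
    Finsupp.linearCombination ℤ (P.kacVal m) (P.kacClass a b) =
      qInt a (P.qX (P.modeParam m)) * qInt b (P.qY (P.modeParam m)) := by
  by_cases h : P.IsKac a b
  · rw [kacClass, dif_pos h, Finsupp.linearCombination_single, one_smul]; rfl
  · have h2 := (P.isKac_or ha hb).resolve_left h
    rw [kacClass, dif_neg h, dif_pos h2, Finsupp.linearCombination_single, one_smul, kacVal,
      P.qInt_reflect_qX hp ha.2.le, P.qInt_reflect_qY hm hb.2.le]
    linear_combination (-(qInt (P.pp - a) (P.qX (P.modeParam m)) *
      qInt (P.pm - b) (P.qY (P.modeParam m)))) * P.qZ_modeParam_sq m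

theorem kacVal_unit {m : ℤ} (hp : ¬ (P.pp : ℤ) ∣ m) (hm : ¬ (P.pm : ℤ) ∣ m) :
    P.kacVal m P.kacUnit = 1 := by
  have h1 := P.two_le_pp
  have h2 := P.two_le_pm
  have h := P.linearCombination_kacClass hp hm (a := 1) (b := 1) ⟨le_rfl, by omega⟩
    ⟨le_rfl, by omega⟩
  rw [qInt_one, qInt_one, mul_one] at h
  rw [← h]
  by_cases hk : P.IsKac 1 1
  · rw [kacClass, dif_pos hk, Finsupp.linearCombination_single, one_smul, kacUnit, dif_pos hk]
  · rw [kacClass, dif_neg hk, dif_pos (P.isKac_top hk), Finsupp.linearCombination_single,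
      one_smul, kacUnit, dif_neg hk]

theorem qX_pow_two_mul (m : ℤ) : P.qX (P.modeParam m) ^ (2 * P.pp) = 1 := by
  have h := P.qX_pow (P.modeParam m)
  rw [zpow_natCast] at h
  rw [mul_comm, pow_mul, h, qZ_modeParam_sq]

theorem qY_pow_two_mul (m : ℤ) : P.qY (P.modeParam m) ^ (2 * P.pm) = 1 := by
  have h := P.qY_pow (P.modeParam m)
  rw [zpow_natCast] at h
  rw [mul_comm, pow_mul, h, qZ_modeParam_sq]

theorem linearCombination_kacProd {m : ℤ} (hp : ¬ (P.pp : ℤ) ∣ m) (hm : ¬ (P.pm : ℤ) ∣ m)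
    (x y : P.KacLabel) : Finsupp.linearCombination ℤ (P.kacVal m) (P.kacProd x y) =
      P.kacVal m x * P.kacVal m y := by
  obtain ⟨r, s, h1, h2, h3, h4, -⟩ := x
  obtain ⟨r', s', h1', h2', h3', h4', -⟩ := y
  have eX := qInt_mul_qInt_truncated (P.qX_ne_zero _)
    (sub_inv_ne_zero (P.qX_ne_zero _) fun h => hp ((P.qX_sq_iff m).1 h)) (P.qX_pow_two_mul m)
    h1 h2 h1' h2'
  have eY := qInt_mul_qInt_truncated (P.qY_ne_zero _)
    (sub_inv_ne_zero (P.qY_ne_zero _) fun h => hm ((P.qY_sq_iff m).1 h)) (P.qY_pow_two_mul m)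
    h3 h4 h3' h4'
  simp only [kacVal, kacProd, map_sum]
  rw [mul_mul_mul_comm, eX, eY, Finset.sum_mul_sum]
  refine Finset.sum_congr rfl fun a ha => Finset.sum_congr rfl fun b hb => ?_
  exact P.linearCombination_kacClass hp hm
    (mem_truncatedClebschGordan_bounds ⟨h1, h2⟩ ⟨h1', h2'⟩ ha)
    (mem_truncatedClebschGordan_bounds ⟨h3, h4⟩ ⟨h3', h4'⟩ hb)

/-- `kacVal m x` times the Weyl denominators, as a combination of `m`-th powers. -/
def kacExpansion (x : P.KacLabel) : ℂˣ →₀ ℂ :=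
  ∑ b, Finsupp.single (P.modeUnit (expo₂ (x.r * P.pm) (x.s * P.pp) 0 b)) (sign₂ b)

theorem linearCombination_kacExpansion (m : ℤ) (x : P.KacLabel) :
    Finsupp.linearCombination ℂ (fun z : ℂˣ => ((z ^ m : ℂˣ) : ℂ)) (P.kacExpansion x) =
      P.kacVal m x * ((P.qX (P.modeParam m) - (P.qX (P.modeParam m))⁻¹) *
        (P.qY (P.modeParam m) - (P.qY (P.modeParam m))⁻¹)) := by
  rw [kacExpansion, map_sum]
  simp only [Finsupp.linearCombination_single, modeUnit_zpow, smul_eq_mul]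
  rw [sum_sign₂_qE, qE_mul_pm, qE_mul_pp, kacVal, ← zpow_neg, ← zpow_neg,
    ← sub_inv_mul_qInt _ (P.qX_ne_zero _), ← sub_inv_mul_qInt _ (P.qY_ne_zero _)]
  simp [qE]
  ring

/-- The exponents agree modulo 2p₊p₋. Coprimality separates this into congruences modulo p₊ and p₋,
and the factor 2 becomes the parity condition on k + l. -/
theorem modeUnit_eq_imp {r s : ℤ} {y : P.KacLabel}
    (h : P.modeUnit (r * P.pm + s * P.pp) = P.modeUnit (y.r * P.pm + y.s * P.pp)) :
    ∃ k l : ℤ, r - y.r = k * P.pp ∧ s - y.s = l * P.pm ∧ Even (k + l) := by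
  have hco := Nat.isCoprime_iff_coprime.2 P.coprime
  obtain ⟨n, hn⟩ := P.period_dvd_of_modeUnit_eq h
  obtain ⟨k, hk⟩ : (P.pp : ℤ) ∣ r - y.r :=
    hco.dvd_of_dvd_mul_right ⟨2 * P.pm * n + y.s - s, by linear_combination hn⟩
  obtain ⟨l, hl⟩ : (P.pm : ℤ) ∣ s - y.s :=
    hco.symm.dvd_of_dvd_mul_right ⟨2 * P.pp * n + y.r - r, by linear_combination hn⟩
  have h0 : ((P.pp : ℤ) * P.pm) ≠ 0 := by
    exact_mod_cast mul_ne_zero P.pp_ne_zero P.pm_ne_zero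
  refine ⟨k, l, by linear_combination hk, by linear_combination hl, n, ?_⟩
  refine mul_left_cancel₀ h0 ?_
  linear_combination hn - hk * P.pm - hl * P.pp

/-- Each expansion has four exponents ±r p₋ ± s p₊. The mixed signs violate the parity condition,
and the double minus would require the reflected label (p₊ - r, p₋ - s), which the Kac inequality
excludes. Hence the exponents with two plus signs tell labels apart. -/
theorem kacExpansion_apply (x y : P.KacLabel) (c : ℂ) (hc : x ≠ y → c = 0) (hc' : x = y → c = 1) :
    P.kacExpansion x (P.modeUnit (y.r * P.pm + y.s * P.pp)) = c := by
  have hx := x.isKac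
  have hy := y.isKac
  obtain ⟨h1, h2, h3, h4, h5⟩ := x.isKac
  obtain ⟨h1', h2', h3', h4', h5'⟩ := y.isKac
  have hzero : ∀ r s : ℤ, (¬ ∃ k l : ℤ, r - y.r = k * P.pp ∧ s - y.s = l * P.pm ∧ Even (k + l)) →
      Finsupp.single (P.modeUnit (r * P.pm + s * P.pp)) (1 : ℂ)
        (P.modeUnit (y.r * P.pm + y.s * P.pp)) = 0 := fun r s hrs => by
    rw [Finsupp.single_apply, if_neg fun h => hrs (P.modeUnit_eq_imp h)]
  have e1 := hzero x.r (-x.s) (by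
    rintro ⟨k, l, hk, hl, n, hn⟩
    have hk0 := eq_zero_of_mul_bounds hk (by omega) (by omega)
    have hl0 : l + 1 = 0 := eq_zero_of_mul_bounds (a := -x.s - y.s + P.pm) (p := P.pm)
      (by linear_combination hl) (by omega) (by omega)
    omega)
  have e2 := hzero (-x.r) x.s (by
    rintro ⟨k, l, hk, hl, n, hn⟩
    have hk0 : k + 1 = 0 := eq_zero_of_mul_bounds (a := -x.r - y.r + P.pp) (p := P.pp)
      (by linear_combination hk) (by omega) (by omega)
    have hl0 := eq_zero_of_mul_bounds hl (by omega) (by omega)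
    omega)
  have e3 := hzero (-x.r) (-x.s) (by
    rintro ⟨k, l, hk, hl, n, hn⟩
    have hk0 : k + 1 = 0 := eq_zero_of_mul_bounds (a := -x.r - y.r + P.pp) (p := P.pp)
      (by linear_combination hk) (by omega) (by omega)
    have hl0 : l + 1 = 0 := eq_zero_of_mul_bounds (a := -x.s - y.s + P.pm) (p := P.pm)
      (by linear_combination hl) (by omega) (by omega)
    obtain rfl : k = -1 := by omega
    obtain rfl : l = -1 := by omega
    have a1 : (y.r : ℤ) = P.pp - x.r := by linarith
    have a2 : (y.s : ℤ) = P.pm - x.s := by linarith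
    zify at h5 h5'
    rw [a1, a2] at h5'
    nlinarith)
  have e0 : Finsupp.single (P.modeUnit ((x.r : ℤ) * P.pm + x.s * P.pp)) (1 : ℂ)
      (P.modeUnit (y.r * P.pm + y.s * P.pp)) = c := by
    by_cases hxy : x = y
    · rw [hc' hxy, hxy, Finsupp.single_eq_same]
    · rw [hc hxy]
      refine hzero _ _ ?_
      rintro ⟨k, l, hk, hl, -⟩
      rw [eq_zero_of_mul_bounds hk (by omega) (by omega)] at hk
      rw [eq_zero_of_mul_bounds hl (by omega) (by omega)] at hl
      apply hxy
      obtain ⟨r, s, hrs⟩ := x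
      obtain ⟨r', s', hrs'⟩ := y
      dsimp only at hk hl
      obtain rfl : r = r' := by omega
      obtain rfl : s = s' := by omega
      rfl
  have hsm : ∀ (z w : ℂˣ) (a : ℂ), Finsupp.single z a w = a * Finsupp.single z (1 : ℂ) w :=
    fun z w a => by rw [← smul_eq_mul, ← Finsupp.smul_apply, Finsupp.smul_single, smul_eq_mul,
      mul_one]
  rw [kacExpansion, Finsupp.finsetSum_apply]
  simp only [hsm _ _ (sign₂ _)]
  rw [sum_sign₂]
  simp only [expo₂, sgn, if_true, Bool.false_eq_true, if_false, one_mul, neg_one_mul, add_zero]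
  simp only [neg_mul] at e1 e2 e3
  rw [e0, e1, e2, e3]
  ring

/-- At an m divisible by p₊ or p₋ a Weyl denominator vanishes, so after multiplication by the
denominators the relation holds for all integers m, and independence of the characters of ℤ applies.
-/
theorem kacVal_injective {R : Type*} [CommRing R] [Algebra R ℂ]
    (hR : Function.Injective (algebraMap R ℂ)) {D : Type*} {M : D → ℤ}
    (hM : ∀ m, ¬ (P.pp : ℤ) ∣ m → ¬ (P.pm : ℤ) ∣ m → ∃ d, M d = m) (c : P.KacLabel →₀ R)
    (hc : Finsupp.linearCombination R (fun x d => P.kacVal (M d) x) c = 0) : c = 0 := by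
  classical
  refine eq_zero_of_dual_expansion hR P.kacExpansion
    (fun x => P.modeUnit (x.r * P.pm + x.s * P.pp))
    (fun x => by rw [P.kacExpansion_apply x x 1 (fun h => absurd rfl h) fun _ => rfl]
                 exact one_ne_zero)
    (fun x y hxy => P.kacExpansion_apply x y 0 (fun _ => rfl) fun h => absurd h hxy) c
    fun m => ?_
  simp only [linearCombination_kacExpansion, ← mul_assoc]
  rw [← Finset.sum_mul, ← Finset.sum_mul]
  by_cases hp : (P.pp : ℤ) ∣ m
  · rw [(sub_inv_eq_zero_iff (P.qX_ne_zero _)).2 ((P.qX_sq_iff m).2 hp), mul_zero, zero_mul]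
  by_cases hm : (P.pm : ℤ) ∣ m
  · rw [(sub_inv_eq_zero_iff (P.qY_ne_zero _)).2 ((P.qY_sq_iff m).2 hm), mul_zero]
  obtain ⟨d, rfl⟩ := hM m hp hm
  have h := congrFun hc d
  rw [Finsupp.linearCombination_apply, Finsupp.sum, Finset.sum_apply] at h
  have h' : ∑ i ∈ c.support, algebraMap R ℂ (c i) * P.kacVal (M d) i = 0 := by
    refine Eq.trans (Finset.sum_congr rfl fun i _ => ?_) h
    exact (Algebra.smul_def _ _).symm
  rw [h', zero_mul, zero_mul]

/-- The image of a family of characters whose indices run through all integers not divisible by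
`p₊` or `p₋` is the minimal model fusion ring. -/
theorem imageIsoFusion_minimalModel {R : Type*} [CommRing R] [Algebra R ℂ]
    (hR : Function.Injective (algebraMap R ℂ)) {D : Set ℂ} {M : D → ℤ}
    (hp : ∀ d, ¬ (P.pp : ℤ) ∣ M d) (hm : ∀ d, ¬ (P.pm : ℤ) ∣ M d)
    (hM : ∀ m, ¬ (P.pp : ℤ) ∣ m → ¬ (P.pm : ℤ) ∣ m → ∃ d, M d = m) :
    P.ImageIsoFusion (P.familyHom R fun d => P.modeParam (M d)) P.minimalModelFusion := by
  have k1 : (fun d : D => P.kacVal (M d) P.minimalModelFusion.unit) = 1 :=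
    funext fun d => P.kacVal_unit (hp d) (hm d)
  have kmul : ∀ x y, Finsupp.linearCombination ℤ (fun x (d : D) => P.kacVal (M d) x)
      (P.minimalModelFusion.prod x y) =
      (fun d : D => P.kacVal (M d) x) * fun d => P.kacVal (M d) y := fun x y => funext fun d => by
    rw [linearCombination_pi_apply]
    exact P.linearCombination_kacProd (hp d) (hm d) x y
  refine FusionTable.exists_range_equiv R P.verlinde P.minimalModelFusion _ _ k1 kmul ?_ ?_ ?_
  · have hV : ∀ a b : ℕ, 1 ≤ a ∧ a < P.pp → 1 ≤ b ∧ b < P.pm →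
        (fun d : D => qInt a (P.qX (P.modeParam (M d))) * qInt b (P.qY (P.modeParam (M d)))) ∈
          (P.minimalModelFusion.evalHom R _ k1 kmul).range := by
      intro a b ha hb
      by_cases h : P.IsKac a b
      · exact ⟨P.minimalModelFusion.basis R ⟨a, b, h⟩, FusionTable.evalHom_basis _ _ _ _ _⟩
      · have h2 := (P.isKac_or ha hb).resolve_left h
        refine ⟨P.minimalModelFusion.basis R ⟨_, _, h2⟩, ?_⟩
        rw [FusionTable.evalHom_basis]
        funext d
        rw [← P.linearCombination_kacClass (hp d) (hm d) ha hb, kacClass, dif_neg h, dif_pos h2,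
          Finsupp.linearCombination_single, one_smul]
    intro x
    cases x with
    | typical l hl =>
      convert zero_mem (P.minimalModelFusion.evalHom R _ k1 kmul).range using 1
      funext d
      simp [labelVal, fockVal, P.qInt_pp_modeParam (hp d)]
    | atypical r s hr hs n =>
      rcases hr.2.eq_or_lt with rfl | hr'
      · convert zero_mem (P.minimalModelFusion.evalHom R _ k1 kmul).range using 1
        funext d
        simp [labelVal, atypicalVal, P.qInt_pp_modeParam (hp d)]
      rcases hs.2.eq_or_lt with rfl | hs'
      · convert zero_mem (P.minimalModelFusion.evalHom R _ k1 kmul).range using 1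
        funext d
        simp [labelVal, atypicalVal, P.qInt_pm_modeParam (hm d)]
      by_cases hn : Even n
      · convert hV r s ⟨hr.1, hr'⟩ ⟨hs.1, hs'⟩ using 1
        funext d
        rw [labelVal, atypicalVal, zpow_of_sq_eq_one (P.qZ_modeParam_sq _), if_pos hn, one_mul]
      -- For odd n the factor Z remains, and reflection rewrites Z[r]_X as -[p₊ - r]_X.
      · convert neg_mem (hV (P.pp - r) s ⟨by omega, by omega⟩ ⟨hs.1, hs'⟩) using 1
        funext d
        rw [labelVal, atypicalVal, zpow_of_sq_eq_one (P.qZ_modeParam_sq _), if_neg hn, Pi.neg_apply,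
          P.qInt_reflect_qX (hp d) (Nat.sub_le _ _), Nat.sub_sub_self hr.2]
        ring
  · intro x
    obtain ⟨h1, h2, h3, h4, -⟩ := x.isKac
    refine ⟨P.verlinde.basis R (.atypical x.r x.s ⟨h1, h2.le⟩ ⟨h3, h4.le⟩ 0), ?_⟩
    rw [FusionTable.evalHom_basis]
    funext d
    simp [labelVal, atypicalVal, kacVal]
  · rw [injective_iff_map_eq_zero]
    exact fun x hx => P.kacVal_injective hR hM x hx

end Params

end Singlet

namespace Singlet

/-! ### Characters of the affine fusion ring -/

theorem linearCombination_affineClass {k c : ℕ} (hc : 1 ≤ c ∧ c ≤ k + 1) (W : ℂ) :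
    Finsupp.linearCombination ℤ (fun i : Fin (k + 1) => qInt (i.val + 1) W) (affineClass k c) =
      qInt c W := by
  rw [affineClass, dif_pos hc, Finsupp.linearCombination_single, one_smul]
  change qInt (c - 1 + 1) W = _
  rw [Nat.sub_add_cancel hc.1]

theorem linearCombination_affineFusion {k : ℕ} {W : ℂ} (h0 : W ≠ 0) (h1 : W - W⁻¹ ≠ 0)
    (h2 : W ^ (2 * (k + 2)) = 1) (i j : Fin (k + 1)) :
    Finsupp.linearCombination ℤ (fun i : Fin (k + 1) => qInt (i.val + 1) W)
      ((affineFusion k).prod i j) = qInt (i.val + 1) W * qInt (j.val + 1) W := by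
  have hi := i.isLt
  have hj := j.isLt
  rw [qInt_mul_qInt_truncated h0 h1 h2 (by omega) (by omega) (by omega) (by omega)]
  change Finsupp.linearCombination ℤ _ (∑ c ∈ _, affineClass k c) = _
  rw [map_sum]
  refine Finset.sum_congr rfl fun c hc => linearCombination_affineClass ?_ W
  have := mem_truncatedClebschGordan_bounds (p := k + 2) (r := i.val + 1) (s := j.val + 1)
    ⟨by omega, by omega⟩ ⟨by omega, by omega⟩ hc
  omega

/-- `qInt c (u ^ m)` times the Weyl denominator, as a combination of `m`-th powers. -/
def affineExpansion (u : ℂˣ) (c : ℤ) : ℂˣ →₀ ℂ :=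
  Finsupp.single (u ^ c) 1 - Finsupp.single (u ^ (-c)) 1

theorem linearCombination_affineExpansion (u : ℂˣ) (c : ℕ) (m : ℤ) :
    Finsupp.linearCombination ℂ (fun z : ℂˣ => ((z ^ m : ℂˣ) : ℂ)) (affineExpansion u c) =
      qInt c ((u : ℂ) ^ m) * ((u : ℂ) ^ m - ((u : ℂ) ^ m)⁻¹) := by
  rw [affineExpansion, map_sub, Finsupp.linearCombination_single,
    Finsupp.linearCombination_single, one_smul, one_smul, mul_comm (qInt _ _),
    sub_inv_mul_qInt _ (zpow_ne_zero _ u.ne_zero), ← zpow_mul, ← zpow_mul]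
  push_cast
  rw [← zpow_mul, ← zpow_mul, mul_comm m, mul_comm m]

/-- As for the minimal model, the denominator extends the relation to all integers. The powers u^c
and u^{-c} for 1 ≤ c ≤ k + 1 are distinct because u has order 2(k + 2). -/
theorem affineQInt_injective {R : Type*} [CommRing R] [Algebra R ℂ]
    (hR : Function.Injective (algebraMap R ℂ)) {k : ℕ} {u : ℂˣ}
    (hu : ∀ a : ℤ, u ^ a = 1 ↔ (2 * (k + 2) : ℤ) ∣ a) {D : Type*} {m : D → ℤ}
    (hm : ∀ n : ℤ, ¬ ((k : ℤ) + 2) ∣ n → ∃ d, m d = n) (c : Fin (k + 1) →₀ R)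
    (hc : Finsupp.linearCombination R
      (fun (i : Fin (k + 1)) (d : D) => qInt (i.val + 1) ((u : ℂ) ^ m d)) c = 0) : c = 0 := by
  have hu' : ∀ a b : ℤ, -(2 * (k + 2) : ℤ) < a - b → a - b < 2 * (k + 2) →
      u ^ a = u ^ b → a = b := by
    intro a b h1 h2 h
    have h3 : u ^ (a - b) = 1 := by rw [zpow_sub, h, mul_inv_cancel]
    obtain ⟨l, hl⟩ := (hu _).1 h3
    have := eq_zero_of_mul_bounds (p := 2 * (k + 2)) (k := l) (a := a - b)
      (by linear_combination hl) h1 h2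
    rw [this] at hl
    linarith
  refine eq_zero_of_dual_expansion hR
    (fun i => affineExpansion u ((i.val + 1 : ℕ) : ℤ)) (fun i => u ^ ((i.val + 1 : ℕ) : ℤ))
    (fun i => ?_) (fun i j hij => ?_) c fun n => ?_
  · have := i.isLt
    rw [affineExpansion, Finsupp.sub_apply, Finsupp.single_eq_same, Finsupp.single_apply,
      if_neg fun h => ?_, sub_zero]
    · exact one_ne_zero
    · have := hu' _ _ (by omega) (by omega) h
      omega
  · have hi := i.isLt
    have hj := j.isLt
    have hne : i.val ≠ j.val := fun h => hij (Fin.ext h)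
    rw [affineExpansion, Finsupp.sub_apply, Finsupp.single_apply, Finsupp.single_apply,
      if_neg fun h => ?_, if_neg fun h => ?_, sub_zero]
    · have := hu' _ _ (by omega) (by omega) h
      omega
    · have := hu' _ _ (by omega) (by omega) h
      omega
  · simp only [linearCombination_affineExpansion, ← mul_assoc]
    rw [← Finset.sum_mul]
    by_cases hn : ((k : ℤ) + 2) ∣ n
    · rw [(sub_inv_eq_zero_iff (zpow_ne_zero _ u.ne_zero)).2, mul_zero]
      have : u ^ (n * 2) = 1 := (hu _).2 (by
        obtain ⟨l, rfl⟩ := hn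
        exact ⟨l, by ring⟩)
      have h := congrArg Units.val this
      rw [← zpow_natCast, ← zpow_mul]
      simpa using h
    · obtain ⟨d, rfl⟩ := hm n hn
      have h := congrFun hc d
      rw [Finsupp.linearCombination_apply, Finsupp.sum, Finset.sum_apply] at h
      have h' : ∑ i ∈ c.support, algebraMap R ℂ (c i) * qInt (i.val + 1) ((u : ℂ) ^ m d) = 0 := by
        refine Eq.trans (Finset.sum_congr rfl fun i _ => ?_) h
        exact (Algebra.smul_def _ _).symm
      rw [h', zero_mul]

theorem qInt_mul_of_sq_eq_one (r : ℕ) {W Y : ℂ} (hY : Y ^ 2 = 1) :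
    qInt r (W * Y) = Y ^ ((r : ℤ) + 1) * qInt r W := by
  have h0 : Y ≠ 0 := fun h0 => by simp [h0] at hY
  rw [qInt, qInt, Finset.mul_sum]
  refine Finset.sum_congr rfl fun i _ => ?_
  rw [mul_zpow, mul_comm, show (2 * (i : ℤ) + 1 - r) = (r + 1) + 2 * (i - r) by ring, zpow_add₀ h0,
    zpow_mul Y, zpow_ofNat, hY, one_zpow, mul_one]

theorem qInt_eq_of_sq_eq_one (s : ℕ) {Y : ℂ} (hY : Y ^ 2 = 1) :
    qInt s Y = s * Y ^ ((s : ℤ) + 1) := by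
  have h0 : Y ≠ 0 := fun h0 => by simp [h0] at hY
  have h := qInt_of_sq_eq_one s hY
  rw [zpow_add₀ h0, zpow_natCast, zpow_one]
  linear_combination Y * h - qInt s Y * hY

/-- `exp (π i q m / p)` -/
def affineX (p q : ℕ) (m : ℤ) : ℂ := Complex.exp (Real.pi * Complex.I * (q * m : ℤ) / p)

/-- `(-1) ^ m` -/
def affineY (m : ℤ) : ℂ := Complex.exp (Real.pi * Complex.I * m)

/-- An odd number congruent to `q` modulo `p`. -/
def oddShift (p q : ℕ) : ℕ := if Odd q then q else q + p

/-- The root of unity `exp (π i t / p)`, where `t` is odd and congruent to `q` modulo `p`. -/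
def affineUnit (p q : ℕ) : ℂˣ :=
  Units.mk0 (Complex.exp (Real.pi * Complex.I * oddShift p q / p)) (Complex.exp_ne_zero _)

theorem affineY_sq (m : ℤ) : affineY m ^ 2 = 1 := by
  rw [affineY, ← Complex.exp_nat_mul, Complex.exp_eq_one_iff]
  exact ⟨m, by push_cast; ring⟩

section

variable {p q : ℕ}

/-- If q is even, coprimality makes p odd, so q + p is odd. -/
theorem odd_oddShift (h : p.Coprime q) : Odd (oddShift p q) := by
  rw [oddShift]
  split_ifs with hq
  · exact hq
  · have hq' := Nat.not_odd_iff_even.1 hq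
    refine hq'.add_odd (Nat.not_even_iff_odd.1 fun hp => ?_)
    have h2 := Nat.dvd_gcd hp.two_dvd hq'.two_dvd
    rw [h.gcd_eq_one] at h2
    omega

theorem coprime_oddShift (h : p.Coprime q) : (oddShift p q).Coprime p := by
  rw [oddShift]
  split_ifs
  · exact h.symm
  · rw [Nat.coprime_add_self_left]; exact h.symm

theorem affineUnit_zpow (m : ℤ) : ((affineUnit p q : ℂˣ) : ℂ) ^ m =
    Complex.exp (Real.pi * Complex.I * oddShift p q * m / p) := by
  rw [affineUnit, Units.val_mk0, ← Complex.exp_int_mul]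
  congr 1
  ring

/-- The numerator t is odd and prime to p, hence prime to 2p, so the root of unity is primitive of
order 2p. For even q the number exp(πiq/p) itself would not be. -/
theorem affineUnit_zpow_eq_one_iff (hp : (p : ℂ) ≠ 0) (h : p.Coprime q) (a : ℤ) :
    affineUnit p q ^ a = 1 ↔ (2 * p : ℤ) ∣ a := by
  rw [← Units.val_inj, Units.val_zpow_eq_zpow_val, affineUnit_zpow, Units.val_one,
    Complex.exp_eq_one_iff]
  have hpi : (Real.pi : ℂ) ≠ 0 := by exact_mod_cast Real.pi_ne_zero
  have hI := Complex.I_ne_zero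
  have hco : IsCoprime (2 * p : ℤ) (oddShift p q) := by
    have h1 : IsCoprime (2 : ℤ) (oddShift p q) := by
      exact_mod_cast Nat.isCoprime_iff_coprime.2
        (Nat.coprime_two_left.2 (odd_oddShift h))
    exact h1.mul_left (Nat.isCoprime_iff_coprime.2 (coprime_oddShift h)).symm
  constructor
  · rintro ⟨n, hn⟩
    refine hco.dvd_of_dvd_mul_left ⟨n, ?_⟩
    field_simp at hn
    have : (oddShift p q : ℂ) * a = 2 * p * n := by linear_combination hn
    exact_mod_cast this
  · rintro ⟨n, rfl⟩
    refine ⟨oddShift p q * n, ?_⟩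
    push_cast
    field_simp

theorem affineX_eq (hp : (p : ℂ) ≠ 0) (m : ℤ) : affineX p q m =
    if Odd q then ((affineUnit p q : ℂˣ) : ℂ) ^ m
    else ((affineUnit p q : ℂˣ) : ℂ) ^ m * affineY m := by
  rw [affineUnit_zpow, affineX, oddShift]
  split_ifs
  · congr 1; push_cast; ring
  · rw [affineY, ← Complex.exp_add, Complex.exp_eq_exp_iff_exists_int]
    refine ⟨-m, ?_⟩
    push_cast
    field_simp
    ring

theorem affineX_pow (hp : (p : ℂ) ≠ 0) (m : ℤ) : affineX p q m ^ p = affineY m ^ q := by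
  rw [affineX, affineY, ← Complex.exp_nat_mul, ← Complex.exp_nat_mul]
  congr 1
  push_cast
  field_simp

/-- Since t is odd, the p-th power is (-1)^m. Reflection therefore exchanges this sign against r ↦ p
- r. -/
theorem affineUnit_zpow_pow (hp : (p : ℂ) ≠ 0) (h : p.Coprime q) (m : ℤ) :
    (((affineUnit p q : ℂˣ) : ℂ) ^ m) ^ (p : ℤ) = affineY m := by
  have h1 : (((affineUnit p q : ℂˣ) : ℂ) ^ m) ^ (p : ℤ) = affineY m ^ (oddShift p q : ℤ) := by
    rw [affineUnit_zpow, affineY, ← Complex.exp_int_mul, ← Complex.exp_int_mul]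
    congr 1
    push_cast
    field_simp
  rw [h1, zpow_of_sq_eq_one (affineY_sq m), if_neg]
  exact Int.not_even_iff_odd.2 (by exact_mod_cast odd_oddShift h)

/-- The sign exponent of the value of an atypical module. -/
def affineParity (q r s : ℕ) (n : ℤ) : ℤ := q * n + (s + 1) + if Odd q then 0 else (r : ℤ) + 1

/-- X differs from u^m by at most the sign (-1)^m, and Y = (-1)^m; the second quantum integer
collapses to s times a sign, and all signs are collected in one parity. -/
theorem affine_value (hp : (p : ℂ) ≠ 0) (r s : ℕ) (n m : ℤ) :
    (affineX p q m ^ p) ^ n * (qInt r (affineX p q m) * qInt s (affineY m)) =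
      s * (affineY m ^ affineParity q r s n *
        qInt r (((affineUnit p q : ℂˣ) : ℂ) ^ m)) := by
  have hY := affineY_sq m
  have h0 : affineY m ≠ 0 := Complex.exp_ne_zero _
  rw [affineX_pow hp, affineX_eq hp, qInt_eq_of_sq_eq_one s hY, affineParity, ← zpow_natCast,
    ← zpow_mul, zpow_add₀ h0 (q * n + (s + 1)), zpow_add₀ h0 (q * n)]
  split_ifs
  · rw [zpow_zero]; ring
  · rw [qInt_mul_of_sq_eq_one r hY]; ring

/-- A fusion ring whose image under a family of characters is an affine fusion ring. -/
theorem exists_range_equiv_affine {ι D R : Type*} [CommRing R] [Algebra R ℂ]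
    (hR : Function.Injective (algebraMap R ℂ)) (T : FusionTable ι) {f : ι → D → ℂ}
    (h1 : f T.unit = 1)
    (hmul : ∀ i j, Finsupp.linearCombination ℤ f (T.prod i j) = f i * f j)
    (k : ℕ) (hp : p = k + 2) (hq : 2 ≤ q) (hco : p.Coprime q) (h2 : Odd q ∨ IsUnit (2 : R))
    {m : D → ℤ} (hm : ∀ d, ¬ (p : ℤ) ∣ m d) (hsurj : ∀ n : ℤ, ¬ (p : ℤ) ∣ n → ∃ d, m d = n)
    (hf : ∀ i, f i = 0 ∨ ∃ (r s : ℕ) (n : ℤ), (1 ≤ r ∧ r < p) ∧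
      ∀ d, f i d = (affineX p q (m d) ^ p) ^ n *
        (qInt r (affineX p q (m d)) * qInt s (affineY (m d))))
    (hf' : ∀ r s, (1 ≤ r ∧ r < p) → (1 ≤ s ∧ s ≤ q) →
      ∃ i, ∀ d, f i d = qInt r (affineX p q (m d)) * qInt s (affineY (m d))) :
    ∃ e : (T.evalHom R f h1 hmul).range ≃+* (affineFusion k).Alg R, ∀ (c : R) (x : T.Alg R),
      e ((T.evalHom R f h1 hmul).rangeRestrict (c • x)) =
        c • e ((T.evalHom R f h1 hmul).rangeRestrict x) := by
  have hp0 : (p : ℂ) ≠ 0 := by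
    rw [hp]; exact_mod_cast (by omega : k + 2 ≠ 0)
  set u := affineUnit p q with hu
  set W : D → ℂ := fun d => (u : ℂ) ^ m d with hW
  have hW0 : ∀ d, W d ≠ 0 := fun d => zpow_ne_zero _ u.ne_zero
  have hWp : ∀ d, W d ^ (p : ℤ) = affineY (m d) := fun d => affineUnit_zpow_pow hp0 hco _
  have hW2p : ∀ d, W d ^ (2 * p) = 1 := fun d => by
    rw [mul_comm, pow_mul, ← zpow_natCast (W d), hWp, affineY_sq]
  have hWne : ∀ d, W d - (W d)⁻¹ ≠ 0 := fun d => sub_inv_ne_zero (hW0 d) fun h => hm d (by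
    have h3 : u ^ (m d * 2) = 1 := by
      refine Units.ext ?_
      rw [Units.val_zpow_eq_zpow_val, zpow_mul, zpow_ofNat]
      exact h
    obtain ⟨l, hl⟩ := (affineUnit_zpow_eq_one_iff hp0 hco _).1 h3
    exact ⟨l, by linarith⟩)
  have hrefl : ∀ d r, r ≤ p → qInt r (W d) = -(affineY (m d) * qInt (p - r) (W d)) :=
    fun d r hr => by
      rw [← hWp, ← qInt_reflect hr (hW0 d) (qInt_self_eq_zero (hW0 d) (hWne d) (hW2p d))]
  have k1 : (fun d => qInt ((affineFusion k).unit.val + 1) (W d)) = 1 :=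
    funext fun d => qInt_one _
  have kmul : ∀ i j, Finsupp.linearCombination ℤ (fun (i : Fin (k + 1)) d => qInt (i.val + 1) (W d))
      ((affineFusion k).prod i j) =
      (fun d => qInt (i.val + 1) (W d)) * fun d => qInt (j.val + 1) (W d) :=
    fun i j => funext fun d => by
      rw [linearCombination_pi_apply]
      exact linearCombination_affineFusion (hW0 d) (hWne d) (by rw [← hp]; exact hW2p d) i j
  have hN : ∀ r, 1 ≤ r ∧ r < p → (fun d => qInt r (W d)) ∈
      ((affineFusion k).evalHom R _ k1 kmul).range := fun r hr => by
    refine ⟨(affineFusion k).basis R ⟨r - 1, by omega⟩, ?_⟩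
    rw [FusionTable.evalHom_basis]
    funext d
    rw [Nat.sub_add_cancel hr.1]
  refine FusionTable.exists_range_equiv R T (affineFusion k) h1 hmul k1 kmul ?_ ?_ ?_
  · intro i
    rcases hf i with h | ⟨r, s, n, hr, h⟩
    · rw [h]; exact zero_mem _
    · have hs : ∀ g : D → ℂ, g ∈ ((affineFusion k).evalHom R _ k1 kmul).range →
          (s • g) ∈ ((affineFusion k).evalHom R _ k1 kmul).range := fun g hg => nsmul_mem hg s
      by_cases hpar : Even (affineParity q r s n)
      -- With even parity the value is s times a basis character; with odd parity the sign (-1)^m is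
      -- traded for -[p - r].
      · convert hs _ (hN r hr) using 1
        funext d
        rw [h, affine_value hp0, zpow_of_sq_eq_one (affineY_sq _), if_pos hpar, one_mul,
          Pi.smul_apply, nsmul_eq_mul]
      · convert hs _ (neg_mem (hN (p - r) ⟨by omega, by omega⟩)) using 1
        funext d
        rw [h, affine_value hp0, zpow_of_sq_eq_one (affineY_sq _), if_neg hpar,
          Pi.smul_apply, nsmul_eq_mul, Pi.neg_apply, hrefl d (p - r) (Nat.sub_le _ _),
          Nat.sub_sub_self hr.2.le, neg_neg]
  · intro j
    have hj := j.isLt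
    have hr : 1 ≤ j.val + 1 ∧ j.val + 1 < p := ⟨by omega, by omega⟩
    by_cases hpar : Even (affineParity q (j.val + 1) 1 0)
    · obtain ⟨i, hi⟩ := hf' (j.val + 1) 1 hr ⟨le_rfl, by omega⟩
      refine ⟨T.basis R i, ?_⟩
      rw [FusionTable.evalHom_basis]
      funext d
      have h3 := affine_value (q := q) hp0 (j.val + 1) 1 0 (m d)
      rw [zpow_of_sq_eq_one (affineY_sq _), if_pos hpar, zpow_zero, one_mul, one_mul,
        Nat.cast_one, one_mul] at h3
      rw [hi, h3]
    -- Odd parity at s = 1, n = 0 can occur only for even q. Passing to s = 2 corrects the parity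
    -- but doubles the value, and this is where 2 must be invertible.
    · have hodd : ¬ Odd q := fun hq' => hpar (by
        rw [affineParity, if_pos hq']; exact ⟨1, by norm_num⟩)
      obtain ⟨v, hv⟩ := (h2.resolve_left hodd).exists_left_inv
      obtain ⟨i, hi⟩ := hf' (j.val + 1) 2 hr ⟨by omega, hq⟩
      have hpar2 : Even (affineParity q (j.val + 1) 2 0) := by
        have e : affineParity q (j.val + 1) 2 0 = affineParity q (j.val + 1) 1 0 + 1 := by
          rw [affineParity, affineParity]; push_cast; ring
        rw [e]
        exact (Int.not_even_iff_odd.1 hpar).add_one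
      refine ⟨v • T.basis R i, ?_⟩
      rw [FusionTable.evalHom_smul, FusionTable.evalHom_basis]
      funext d
      have h3 := affine_value (q := q) hp0 (j.val + 1) 2 0 (m d)
      rw [zpow_of_sq_eq_one (affineY_sq _), if_pos hpar2, zpow_zero, one_mul, one_mul] at h3
      have h4 : algebraMap R ℂ v * 2 = 1 := by
        have := congrArg (algebraMap R ℂ) hv
        rwa [map_mul, map_one, map_ofNat] at this
      rw [Pi.smul_apply, hi, h3, Algebra.smul_def, ← mul_assoc, Nat.cast_ofNat, h4, one_mul]
  · rw [injective_iff_map_eq_zero]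
    refine fun x hx => affineQInt_injective hR (u := u) (m := m) (fun a => ?_) (fun n hn => ?_) x hx
    · rw [hu, affineUnit_zpow_eq_one_iff hp0 hco, hp]; push_cast; rfl
    · exact hsurj n (by rw [hp]; push_cast; exact hn)

end

end Singlet

namespace Singlet

namespace Params

variable (P : Params)

/-! ### Quantum dimensions as ring homomorphisms -/

theorem isQdimMap_familyHom {R : Type*} [CommRing R] [Algebra R ℂ] {D : Set ℂ} (e : D → ℂ)
    (h : ∀ (N : P.SimpleModule) (ε : D), P.HasQdim N ε (P.moduleVal (e ε) N)) :
    P.IsQdimMap (P.familyHom R e) := by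
  refine ⟨fun c x => FusionTable.evalHom_smul _ _ _ _ c x, fun N ε => ?_⟩
  cases N with
  | verlinde x =>
    rw [simpleClass, familyHom, FusionTable.evalHom_basis]
    exact h (.verlinde x) ε
  | minimal x =>
    rw [simpleClass, map_zero]
    exact h (.minimal x) ε

theorem qX_modeParam_mul (n : ℤ) : P.qX (P.modeParam (P.pm * n)) = affineX P.pp P.pm n := by
  rw [qX_modeParam, affineX]

theorem qY_modeParam_mul (n : ℤ) : P.qY (P.modeParam (P.pm * n)) = affineY n := by
  have h := P.pm_ne_zero
  rw [qY_modeParam, affineY]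
  congr 1
  push_cast
  field_simp

theorem qY_modeParam_mul' (n : ℤ) : P.qY (P.modeParam (P.pp * n)) = affineX P.pm P.pp n := by
  rw [qY_modeParam, affineX]

theorem qX_modeParam_mul' (n : ℤ) : P.qX (P.modeParam (P.pp * n)) = affineY n := by
  have h := P.pp_ne_zero
  rw [qX_modeParam, affineY]
  congr 1
  push_cast
  field_simp

/-- For modes p₋n one has Y = (-1)^n and X = exp(πi p₋n/p₊), the situation of
`exists_range_equiv_affine` with p = p₊ and q = p₋; coprimality reduces the divisibility conditions
to n. -/
theorem imageIsoFusion_affinePlus {R : Type*} [CommRing R] [Algebra R ℂ]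
    (hR : Function.Injective (algebraMap R ℂ)) (h2 : Odd P.pm ∨ IsUnit (2 : R)) {D : Set ℂ}
    {n : D → ℤ} (hp : ∀ d, ¬ (P.pp : ℤ) ∣ P.pm * n d)
    (hM : ∀ m, ¬ (P.pp : ℤ) ∣ P.pm * m → ∃ d, n d = m) :
    P.ImageIsoFusion (P.familyHom R fun d => P.modeParam (P.pm * n d))
      (affineFusion (P.pp - 2)) := by
  have hpp := P.two_le_pp
  have hd : ∀ m : ℤ, (P.pp : ℤ) ∣ P.pm * m ↔ (P.pp : ℤ) ∣ m := fun m =>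
    ⟨(Nat.isCoprime_iff_coprime.2 P.coprime).dvd_of_dvd_mul_left, fun h => h.mul_left _⟩
  refine exists_range_equiv_affine hR P.verlinde _ _ (P.pp - 2) (by omega) P.two_le_pm P.coprime
    h2 (m := n) (fun d h => hp d ((hd _).2 h)) (fun m h => hM m fun h' => h ((hd _).1 h'))
    (fun x => ?_) (fun r s hr hs => ?_)
  · cases x with
    | typical l hl =>
      refine Or.inl (funext fun d => ?_)
      simp [labelVal, fockVal, P.qInt_pp_modeParam (hp d)]
    | atypical r s hr hs N =>
      rcases hr.2.eq_or_lt with rfl | hr'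
      · refine Or.inl (funext fun d => ?_)
        simp [labelVal, atypicalVal, P.qInt_pp_modeParam (hp d)]
      · refine Or.inr ⟨r, s, N, ⟨hr.1, hr'⟩, fun d => ?_⟩
        rw [labelVal, atypicalVal, ← qX_pow, qX_modeParam_mul, qY_modeParam_mul, zpow_natCast]
  · refine ⟨.atypical r s ⟨hr.1, hr.2.le⟩ hs 0, fun d => ?_⟩
    rw [labelVal, atypicalVal, qX_modeParam_mul, qY_modeParam_mul, zpow_zero, one_mul]

theorem imageIsoFusion_affineMinus {R : Type*} [CommRing R] [Algebra R ℂ]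
    (hR : Function.Injective (algebraMap R ℂ)) (h2 : Odd P.pp ∨ IsUnit (2 : R)) {D : Set ℂ}
    {n : D → ℤ} (hm : ∀ d, ¬ (P.pm : ℤ) ∣ P.pp * n d)
    (hM : ∀ m, ¬ (P.pm : ℤ) ∣ P.pp * m → ∃ d, n d = m) :
    P.ImageIsoFusion (P.familyHom R fun d => P.modeParam (P.pp * n d))
      (affineFusion (P.pm - 2)) := by
  have hpm := P.two_le_pm
  have hd : ∀ m : ℤ, (P.pm : ℤ) ∣ P.pp * m ↔ (P.pm : ℤ) ∣ m := fun m =>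
    ⟨(Nat.isCoprime_iff_coprime.2 P.coprime.symm).dvd_of_dvd_mul_left, fun h => h.mul_left _⟩
  refine exists_range_equiv_affine hR P.verlinde _ _ (P.pm - 2) (by omega) P.two_le_pp
    P.coprime.symm h2 (m := n) (fun d h => hm d ((hd _).2 h))
    (fun m h => hM m fun h' => h ((hd _).1 h')) (fun x => ?_) (fun s r hs hr => ?_)
  · cases x with
    | typical l hl =>
      refine Or.inl (funext fun d => ?_)
      simp [labelVal, fockVal, P.qInt_pm_modeParam (hm d)]
    | atypical r s hr hs N =>
      rcases hs.2.eq_or_lt with rfl | hs'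
      · refine Or.inl (funext fun d => ?_)
        simp [labelVal, atypicalVal, P.qInt_pm_modeParam (hm d)]
      · refine Or.inr ⟨s, r, N, ⟨hs.1, hs'⟩, fun d => ?_⟩
        rw [labelVal, atypicalVal, ← qY_pow, qY_modeParam_mul', qX_modeParam_mul', zpow_natCast,
          mul_comm (qInt r _)]
  · refine ⟨.atypical r s hr ⟨hs.1, hs.2.le⟩ 0, fun d => ?_⟩
    rw [labelVal, atypicalVal, qY_modeParam_mul', qX_modeParam_mul', zpow_zero, one_mul, mul_comm]

theorem exists_qdimMap_minimalRegion {R : Type*} [CommRing R] [Algebra R ℂ]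
    (hR : Function.Injective (algebraMap R ℂ)) :
    ∃ Φ : P.verlinde.Alg R →+* (P.minimalRegion → ℂ),
      P.IsQdimMap Φ ∧ P.ImageIsoFusion Φ P.minimalModelFusion := by
  choose M hD hp hm using fun ε : P.minimalRegion =>
    exists_dominates_of_mem_minimalRegion ε.2
  refine ⟨P.familyHom R fun d => P.modeParam (M d),
    P.isQdimMap_familyHom _ fun N ε => (hD ε).hasQdim_generic (hp ε) (hm ε) N,
    P.imageIsoFusion_minimalModel hR hp hm fun m h1 h2 => ?_⟩
  -- Surjectivity onto the admissible modes: m dominates at some point of the region, and uniqueness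
  -- identifies it with the chosen mode there.
  obtain ⟨ε, k, j, hw, hj, hs, hdom, e1, e2⟩ := P.exists_dominates (fun h => h1 h.1)
  have hε : ε ∈ P.minimalRegion :=
    ⟨hw, k, j, hj, hs, Or.inl ⟨fun h => h1 (e1.2 h), fun h => h2 (e2.2 h)⟩⟩
  exact ⟨⟨ε, hε⟩, (hD ⟨ε, hε⟩).unique hdom (fun h => hp _ h.1) fun h => h1 h.1⟩

theorem exists_qdimMap_affinePlusRegion {R : Type*} [CommRing R] [Algebra R ℂ]
    (hR : Function.Injective (algebraMap R ℂ)) :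
    ∃ Φ : P.verlinde.Alg R →+* (P.affinePlusRegion → ℂ), P.IsQdimMap Φ ∧
      ((Odd P.pm ∨ IsUnit (2 : R)) → P.ImageIsoFusion Φ (affineFusion (P.pp - 2))) := by
  choose M hD hp hm using fun ε : P.affinePlusRegion =>
    exists_dominates_of_mem_affinePlusRegion ε.2
  choose n hn using hm
  -- Writing the mode as p₋n makes n the index of the affine characters.
  obtain rfl : M = fun ε => P.pm * n ε := funext hn
  refine ⟨P.familyHom R fun d => P.modeParam (P.pm * n d),
    P.isQdimMap_familyHom _ fun N ε => (hD ε).hasQdim_plus (hp ε) ⟨_, rfl⟩ N, fun h2 =>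
    P.imageIsoFusion_affinePlus hR h2 hp fun m h1 => ?_⟩
  obtain ⟨ε, k, j, hw, hj, hs, hdom, e1, e2⟩ := P.exists_dominates (fun h => h1 h.1)
  have hε : ε ∈ P.affinePlusRegion :=
    ⟨hw, k, j, hj, hs, e2.1 ⟨_, rfl⟩, fun h => h1 (e1.2 h)⟩
  have h3 := (hD ⟨ε, hε⟩).unique hdom (fun h => hp _ h.1) fun h => h1 h.1
  exact ⟨⟨ε, hε⟩, mul_left_cancel₀ (by exact_mod_cast P.pm_ne_zero) h3⟩

theorem exists_qdimMap_affineMinusRegion {R : Type*} [CommRing R] [Algebra R ℂ]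
    (hR : Function.Injective (algebraMap R ℂ)) :
    ∃ Φ : P.verlinde.Alg R →+* (P.affineMinusRegion → ℂ), P.IsQdimMap Φ ∧
      ((Odd P.pp ∨ IsUnit (2 : R)) → P.ImageIsoFusion Φ (affineFusion (P.pm - 2))) := by
  choose M hD hp hm using fun ε : P.affineMinusRegion =>
    exists_dominates_of_mem_affineMinusRegion ε.2
  choose n hn using hp
  obtain rfl : M = fun ε => P.pp * n ε := funext hn
  refine ⟨P.familyHom R fun d => P.modeParam (P.pp * n d),
    P.isQdimMap_familyHom _ fun N ε => (hD ε).hasQdim_minus ⟨_, rfl⟩ (hm ε) N, fun h2 =>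
    P.imageIsoFusion_affineMinus hR h2 hm fun m h1 => ?_⟩
  obtain ⟨ε, k, j, hw, hj, hs, hdom, e1, e2⟩ := P.exists_dominates (fun h => h1 h.2)
  have hε : ε ∈ P.affineMinusRegion :=
    ⟨hw, k, j, hj, hs, e1.1 ⟨_, rfl⟩, fun h => h1 (e2.2 h)⟩
  have h3 := (hD ⟨ε, hε⟩).unique hdom (fun h => hm _ h.2) fun h => h1 h.2
  exact ⟨⟨ε, hε⟩, mul_left_cancel₀ (by exact_mod_cast P.pp_ne_zero) h3⟩

end Params

end Singlet

end

theorem mainTheorem6 (P : Singlet.Params) (R : Type*) [CommRing R] [Algebra R ℂ]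
    (hR : Function.Injective (algebraMap R ℂ)) :
    (∃ Φ : P.verlinde.Alg R →+* (P.continuousRegion → ℂ),
      P.IsQdimMap Φ ∧ Function.Injective Φ) ∧
    (∃ Φ : P.verlinde.Alg R →+* (P.minimalRegion → ℂ),
      P.IsQdimMap Φ ∧ P.ImageIsoFusion Φ P.minimalModelFusion) ∧
    (∃ Φ : P.verlinde.Alg R →+* (P.affinePlusRegion → ℂ),
      P.IsQdimMap Φ ∧
        ((Odd P.pm ∨ IsUnit (2 : R)) →
          P.ImageIsoFusion Φ (Singlet.affineFusion (P.pp - 2)))) ∧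
    (∃ Φ : P.verlinde.Alg R →+* (P.affineMinusRegion → ℂ),
      P.IsQdimMap Φ ∧
        ((Odd P.pp ∨ IsUnit (2 : R)) →
          P.ImageIsoFusion Φ (Singlet.affineFusion (P.pm - 2)))) := by
  refine ⟨⟨P.familyHom R fun ε => ε, P.isQdimMap_familyHom _ fun N ε =>
      P.hasQdim_of_mem_continuousRegion ε.2 N,
    P.familyHom_continuous_injective R hR⟩, P.exists_qdimMap_minimalRegion hR,
    P.exists_qdimMap_affinePlusRegion hR, P.exists_qdimMap_affineMinusRegion hR⟩
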